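/- **Setting.** Let $q\in\{0,1\}$ and let $L$ be meromorphic in $\mathbb C$, analytic except possibly at $x=1$, where it has order exactly $-q$ (a simple pole if $q=1$; regular and nonzero if $q=0$). Assume that $L$ does not vanish in $\{\mathrm{Re}\,x>1\}$ and that $(\log L)^{(n)}(x)=O(x^{-N})$ as $x\to+\infty$ for all $n,N\in\mathbb N$. Assume $(x-1)^qL(x)=\mathbf G(x)\,\Xi(x)$ with $\mathbf G,\Xi$ entire of order $1$ and $\Xi(x)=\Xi(1-x)$. All zeros of $\mathbf G$ lie in $\{\mathrm{Re}\,x\le 0\}$. All zeros of $\Xi$ lie in $\{0<\mathrm{Re}\,x<1\}$ and, counted with multiplicities, are $\frac12\pm i\tau_k$ ($k=1,2,\dots$) with $\mathrm{Re}\,\tau_k>0$ non-decreasing. Assume that, as $x\to+\infty$, $$-\log\mathbf G(x)\sim\tilde a_1x(\log x-1)+b_1x+\tilde a_0\log x+b_0+\sum_{n\ge1}a_{-n}x^{-n},$$ indefinitely differentiable term by term. Put (powers being principal) * $\mathbf Z(s,\tfrac12)=\sum_k(\tfrac12-x_k)^{-s}$ for $\mathrm{Re}\,s>1$, the sum running over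 the zeros $x_k$ of $\mathbf G$ with multiplicities; * $\mathcal Z(\sigma,v)=\sum_k(\tau_k^2+v)^{-\sigma}$ for $\mathrm{Re}\,\sigma>\frac12$ and $\tau_k^2+v\notin(-\infty,0]$ for all $k$, and $\mathcal Z(\sigma)=\mathcal Z(\sigma,0)$; * $\mathfrak Z(\sigma,y)=\sum_k(\tau_k+y)^{-2\sigma}$ for $\mathrm{Re}\,\sigma>\frac12$ and $\tau_k+y\notin(-\infty,0]$ for all $k$. **Statement.** These series converge absolutely in the indicated half-planes, and the functions extend meromorphically (in $s$, resp. $\sigma$) to $\mathbb C$. $\mathbf Z(s,\frac12)$ is analytic for $s\neq1$. $\mathcal Z(\sigma)$ is analytic except possibly at $\sigma=\frac12-m$, $m\in\mathbb N=\{0,1,2,\dots\}$; for every integer $m\ge1$ it has at $\frac12-m$ at most a simple pole, with residue $$\mathcal R_m=\frac{(-1)^m}{2\pi}\Bigl[\mathbf Z(1-2m,\tfrac12)+q\,2^{1-2m}\Bigr].$$ For every admissible $y\in\mathbb C$ (that is, $\tau_k+y\notin(-\infty,0]$ for all $k$): 1. $\mathfrak Z(\sigma,y)$ is analytic in $\sigma$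 except possibly at $\sigma=\frac12(1-n)$, $n\in\mathbb N$. 2. If $|y|<\min_k|\tau_k|$, then for every $\sigma\notin\{\frac12(1-n):n\in\mathbb N\}$ $$\mathfrak Z(\sigma,y)=\sum_{\ell=0}^\infty\binom{-2\sigma}{\ell}\mathcal Z(\sigma+\tfrac12\ell)\,y^\ell,$$ where $\binom{w}{\ell}=\frac{w(w-1)\cdots(w-\ell+1)}{\ell!}$, the continuation of $\frac{\Gamma(1+w)}{\ell!\,\Gamma(1+w-\ell)}$. 3. For every $n\in\mathbb N$, as $\varepsilon\to0$ ($\varepsilon\ne0$), $$\mathfrak Z(\tfrac12(1-n)+\varepsilon,y)=\sum_{\ell=0}^n\binom{n-1-2\varepsilon}{\ell}\mathcal Z(\tfrac12(1-n+\ell)+\varepsilon)\,y^\ell+\begin{cases}O(1)&n=0,\\O(\varepsilon)&n\ge1.\end{cases}$$ 4. At $\sigma=\frac12$, $\mathfrak Z(\cdot,y)$ has a polar part independent of $y$, equal to that of $\mathcal Z(\cdot,v)$ for every admissible $v$ (that is, $\tau_k^2+v\notin(-\infty,0]$ for all $k$): $$\mathfrak Z(\tfrac12+\varepsilon,y)=\frac{\tilde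 a_1}{4\pi\varepsilon^2}+\frac{b_1}{2\pi\varepsilon}+O(1),\qquad \mathcal Z(\tfrac12+\varepsilon,v)=\frac{\tilde a_1}{4\pi\varepsilon^2}+\frac{b_1}{2\pi\varepsilon}+O(1)$$ (a double pole when $\tilde a_1\ne0$). 5. At $\sigma=\frac12(1-n)$, $n=1,2,\dots$, $\mathfrak Z(\cdot,y)$ has at most a simple pole, with residue $$r_n(y)=-\frac{\tilde a_1}{2\pi n}\,y^n+\sum_{0<2m\le n}\binom{n-1}{2m-1}\mathcal R_m\,y^{n-2m}.$$ 6. At $\sigma=0$ the residue is $r_1(y)=-\frac{\tilde a_1}{2\pi}y$, and the finite part (constant term of the Laurent expansion) is $\frac14\tilde a_1+\frac12(\tilde a_0+q)-\frac{b_1}{\pi}\,y$. -/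

import Mathlib

open Filter Topology Asymptotics

/-- `f` is an entire function of order exactly `ρ`: the infimum of the exponents `a ≥ 0` with
`f(z) = O(exp(|z|^a))` as `|z| → ∞` is `ρ`. -/
def IsEntireOfOrder (f : ℂ → ℂ) (ρ : ℝ) : Prop :=
  Differentiable ℂ f ∧
    IsGLB {a : ℝ | 0 ≤ a ∧
      f =O[Bornology.cobounded ℂ] fun z => Real.exp (‖z‖ ^ a)} ρ

/-- The primary functions: `L` is meromorphic in `ℂ` with at most one pole, at `x = 1`, of order
`q ∈ {0, 1}`; it is zero free in `Re x > 1`; all derivatives (including the zeroth) of `log L` are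
rapidly decreasing at `+∞`; and `(x-1)^q L = G Ξ` with `G`, `Ξ` entire of order `1` and
`Ξ(x) = Ξ(1-x)`. The (trivial) zeros of `G` lie in `Re x ≤ 0`; the (nontrivial) zeros of `Ξ` lie in
`0 < Re x < 1`, and, counted with multiplicities, they are the points `1/2 ± i τ k` with
`Re (τ k) > 0` and `Re (τ k)` non-decreasing in `k`. In particular no zero of `Ξ` is real. -/
structure IsPrimaryFunction (L G Ξ : ℂ → ℂ) (q : ℕ) (τ : ℕ → ℂ) : Prop where
  q_le_one : q ≤ 1
  analyticAt : ∀ x : ℂ, x ≠ 1 → AnalyticAt ℂ L x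
  meromorphicAt_one : MeromorphicAt L 1
  order_at_one : meromorphicOrderAt L 1 = ((-(q : ℤ) : ℤ) : WithTop ℤ)
  ne_zero : ∀ x : ℂ, 1 < x.re → L x ≠ 0
  log_decay : ∀ n N : ℕ,
    iteratedDeriv n (fun x : ℝ => Complex.log (L (x : ℂ))) =O[atTop] fun x : ℝ => (x ^ N)⁻¹
  order_G : IsEntireOfOrder G 1
  order_Ξ : IsEntireOfOrder Ξ 1
  factorization : ∀ x : ℂ, x ≠ 1 → G x * Ξ x = (x - 1) ^ q * L x
  symmetry : ∀ x : ℂ, Ξ x = Ξ (1 - x)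
  trivial_zeros : ∀ x : ℂ, G x = 0 → x.re ≤ 0
  strip : ∀ x : ℂ, Ξ x = 0 → 0 < x.re ∧ x.re < 1
  τ_re_pos : ∀ k, 0 < (τ k).re
  τ_re_mono : Monotone fun k => (τ k).re
  zeros : ∀ x : ℂ, analyticOrderAt Ξ x =
    {k : ℕ | 1 / 2 + Complex.I * τ k = x}.encard + {k : ℕ | 1 / 2 - Complex.I * τ k = x}.encard

/-- The expansion
`-log G(x) ∼ a₁ x (log x - 1) + b₁ x + a₀ log x + b₀ + ∑_{n ≥ 1} a_{-n} x^{-n}` as `x → +∞`,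
indefinitely differentiable term by term. Here `a n` stands for `a_{-n}` (`n ≥ 1`), and `g` is a
holomorphic branch of `log G` on the right half-plane. -/
def HasStirlingExpansion (G : ℂ → ℂ) (a₁ a₀ b₁ b₀ : ℂ) (a : ℕ → ℂ) : Prop :=
  ∃ g : ℂ → ℂ, DifferentiableOn ℂ g {z | 0 < z.re} ∧
    (∀ z : ℂ, 0 < z.re → Complex.exp (g z) = G z) ∧
    ∀ N k : ℕ,
      iteratedDeriv k (fun x : ℝ => -g (x : ℂ) -
        (a₁ * x * ((Real.log x : ℂ) - 1) + b₁ * x + a₀ * (Real.log x : ℂ) + b₀ +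
          ∑ n ∈ Finset.Icc 1 N, a n * ((x : ℂ) ^ n)⁻¹))
      =O[atTop] fun x : ℝ => (x ^ (N + 1 + k))⁻¹

/-- `F` is a meromorphic function on `ℂ` which in the half-plane `Re s > c` is the sum of the
(absolutely convergent) series `∑ i, f i s`. -/
def IsMeromorphicContinuation {ι : Type*} (f : ι → ℂ → ℂ) (c : ℝ) (F : ℂ → ℂ) : Prop :=
  Meromorphic F ∧ ∀ s : ℂ, c < s.re → HasSum (fun i => f i s) (F s)

/-- `F(p + ε) = c₂ / ε² + c₁ / ε + O(1)` as `ε → 0`, `ε ≠ 0`. -/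
def HasPolarPart (F : ℂ → ℂ) (p c₂ c₁ : ℂ) : Prop :=
  (fun ε : ℂ => F (p + ε) - (c₂ / ε ^ 2 + c₁ / ε)) =O[𝓝[≠] (0 : ℂ)] fun _ => (1 : ℂ)

/-- The general term, at the point `z`, of the zeta function over the zeros of `G`,
`∑ (x - x_k)^{-s}`, each zero being weighted with its multiplicity. -/
noncomputable def shadowTerm (G : ℂ → ℂ) (x : ℂ) (z s : ℂ) : ℂ :=
  (analyticOrderNatAt G z : ℂ) * (x - z) ^ (-s)

/-- The general term of `𝒵(σ, v) = ∑ (τ_k² + v)^{-σ}`. -/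
noncomputable def secondTerm (τ : ℕ → ℂ) (v : ℂ) (k : ℕ) (σ : ℂ) : ℂ :=
  (τ k ^ 2 + v) ^ (-σ)

/-- The general term of the half zeta function `𝔷(σ, y) = ∑ (τ_k + y)^{-2σ}`. -/
noncomputable def halfTerm (τ : ℕ → ℂ) (y : ℂ) (k : ℕ) (σ : ℂ) : ℂ :=
  (τ k + y) ^ (-2 * σ)

/-- `ℛ_m = (-1)^m / (2π) * (𝐙(1 - 2m, 1/2) + q 2^{1-2m})` (for `m ≥ 1`), where `S` is the
continuation of `s ↦ 𝐙(s, 1/2)`. -/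
noncomputable def secondResidue (S : ℂ → ℂ) (q m : ℕ) : ℂ :=
  (-1) ^ m / (2 * Real.pi) * (S (1 - 2 * m) + q * (2 : ℂ) ^ (1 - 2 * (m : ℤ)))

/-- `r_n(y) = - a₁ yⁿ / (2πn) + ∑_{0 < 2m ≤ n} C(n-1, 2m-1) ℛ_m y^{n-2m}` (for `n ≥ 1`). -/
noncomputable def halfResidue (a₁ : ℂ) (R : ℕ → ℂ) (n : ℕ) (y : ℂ) : ℂ :=
  -(a₁ / (2 * Real.pi * n)) * y ^ n +
    ∑ m ∈ Finset.Icc 1 (n / 2), ((n - 1).choose (2 * m - 1) : ℂ) * R m * y ^ (n - 2 * m)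

/-- The generalized binomial coefficient `Ring.choose w ℓ = w (w-1) ⋯ (w-ℓ+1) / ℓ!` is the
analytic continuation of the quotient `Γ(1+w) / (ℓ! Γ(1+w-ℓ))`. -/
theorem choose_eq_Gamma_div (w : ℂ) (hw : ∀ n : ℤ, w ≠ n) (l : ℕ) :
    Ring.choose w l =
      Complex.Gamma (1 + w) / ((l.factorial : ℂ) * Complex.Gamma (1 + w - l)) := by
  have key : ∀ l : ℕ, Complex.Gamma (1 + w) =
      (∏ j ∈ Finset.range l, (w - j)) * Complex.Gamma (1 + w - l) := by
    intro l
    induction l with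
    | zero => simp
    | succ l ih =>
      rw [ih, Finset.prod_range_succ, mul_assoc]
      congr 1
      have h0 : w - l ≠ 0 := by
        intro h
        exact hw l (by push_cast; linear_combination h)
      have := Complex.Gamma_add_one (w - l) h0
      rw [show (1 + w - l : ℂ) = w - l + 1 by ring, this]
      congr 2
      push_cast
      ring
  have hG : Complex.Gamma (1 + w - l) ≠ 0 := by
    apply Complex.Gamma_ne_zero
    intro m h
    exact hw (l - 1 - m) (by push_cast; linear_combination h)
  have hc : Ring.choose w l = (∏ j ∈ Finset.range l, (w - j)) / (l.factorial : ℂ) := by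
    have h : (descPochhammer ℤ l).smeval w = ∏ j ∈ Finset.range l, (w - j) := by
      rw [← descPochhammer_eval_eq_prod_range, ← descPochhammer_map (Int.castRingHom ℂ),
        Polynomial.eval_map, ← Polynomial.eval₂_smulOneHom_eq_smeval]
      congr 1
      exact Subsingleton.elim _ _
    rw [Ring.choose_eq_smul, h, smul_eq_mul]
    ring
  rw [hc, key l]
  have : (l.factorial : ℂ) ≠ 0 := by exact_mod_cast l.factorial_ne_zero
  field_simp

/-! Let `f` be entire of order at most `1` with `f 0 ≠ 0` and zeros `ζ_i` avoiding a sector around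
the positive axis. Hadamard's theorem in differentiated form reads `f'/f(t) - f'/f(0) = ∑ (1/(t -
ζ_i) + 1/ζ_i)`. Integrating against `t^(-s)`, for `1 < Re s < 2`, turns each term into `(-ζ_i)^(-s)
π / sin(πs)`. The zeta function of the zeros is therefore `sin(πs)/π` times a Mellin transform, and
an expansion `A log t + B + ∑ c_j t^(-j)` of `f'/f` at `+∞` continues that transform, with polar
terms `A/(s-1)^2 + B/(s-1)` and `c_j/(s+j-1)`.

For `f(z) = G(1/2 + z)` the sine cancels every pole except the one at `s = 1`, and the values at `1
- j` are read off from the Stirling coefficients (`exists_shadow_zeta`). For `f(z) = Ξ(1/2 + z)` the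
zeros are `±iτ_k`, and pairing them gives a factor `2 cos(πs/2)`. Hence `∑ τ_k^(-s)` is
`sin(πs/2)/π` times the transform (`IsPrimaryFunction.exists_zeta`). Poles survive only at `1 - 2m`,
the one at `1` being double. Since `Ξ'/Ξ = -G'/G + q/(x-1) + L'/L` with `L'/L` rapidly decreasing,
both zeta functions come from the same coefficients `c_j`, up to the contribution of `q`. This is
why the residues `ℛ_m` involve `𝐙(1 - 2m, 1/2) + q 2^(1-2m)`.

The shift by `y` is a binomial expansion. Subtracting from `(τ_k + y)^(-s)` its first `N` terms
leaves `O(|τ_k|^(-Re s - N))`, so `∑ (τ_k + y)^(-s)` equals `∑_{l<N} C(-s, l) Z(s + l) y^l` plus a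
function `T_N` analytic in `Re s > 1 - N` (`exists_shifted_zeta`). Moreover `T_N` vanishes at `0,
-1, …, -(N-1)`, where the binomial series terminates. The poles, their residues and the finite part
at `0` follow by multiplying Laurent expansions: near `s = 1 - n` the term `l = n` meets the double
pole of `Z` at `1`, but its coefficient vanishes there to first order, so only a simple pole
remains. Finally `s = 2σ`. -/

/-! ### Growth of entire functions of order one -/

/-- `f` grows at most like an entire function of order `1`. -/
def HasOrderOneGrowth (f : ℂ → ℂ) : Prop :=
  ∀ p : ℝ, 1 < p → ∃ K : ℝ, ∀ z, ‖f z‖ ≤ Real.exp (K * (1 + ‖z‖) ^ p)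

/-- The order controls `f` only outside a large disc. The maximum on that disc and the implied
constant are absorbed into `K`, which is possible because `(1 + ‖z‖) ^ p ≥ 1`. -/
theorem IsEntireOfOrder.hasOrderOneGrowth {f : ℂ → ℂ} (hf : IsEntireOfOrder f 1) :
    HasOrderOneGrowth f := by
  intro p hp
  obtain ⟨hd, hglb⟩ := hf
  obtain ⟨a, ⟨ha0, ha⟩, -, hap⟩ := hglb.exists_between hp
  obtain ⟨C, hC⟩ := ha.bound
  obtain ⟨r, -, hr⟩ := (hasBasis_cobounded_norm (E := ℂ)).eventually_iff.1 hC
  obtain ⟨B, hB⟩ := (isCompact_closedBall (0 : ℂ) r).exists_bound_of_continuousOn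
    hd.continuous.continuousOn
  have hB0 : 0 ≤ Real.log (1 + |B|) := Real.log_nonneg (by linarith [abs_nonneg B])
  have hC0 : 0 ≤ Real.log (1 + |C|) := Real.log_nonneg (by linarith [abs_nonneg C])
  refine ⟨Real.log (1 + |B|) + Real.log (1 + |C|) + 1, fun z => ?_⟩
  have h1 : 1 ≤ (1 + ‖z‖) ^ p :=
    Real.one_le_rpow (by linarith [norm_nonneg z]) (by linarith)
  rcases le_total r ‖z‖ with hz | hz
  · have h2 : ‖z‖ ^ a ≤ (1 + ‖z‖) ^ p :=
      (Real.rpow_le_rpow (norm_nonneg z) (by linarith) ha0).trans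
        (Real.rpow_le_rpow_of_exponent_le (by linarith [norm_nonneg z]) hap.le)
    calc ‖f z‖ ≤ C * ‖Real.exp (‖z‖ ^ a)‖ := hr hz
      _ ≤ (1 + |C|) * Real.exp (‖z‖ ^ a) := by
          rw [Real.norm_of_nonneg (Real.exp_nonneg _)]
          gcongr
          linarith [le_abs_self C]
      _ = Real.exp (Real.log (1 + |C|) + ‖z‖ ^ a) := by
          rw [Real.exp_add, Real.exp_log (by positivity)]
      _ ≤ _ := Real.exp_le_exp.2 (by nlinarith)
  · calc ‖f z‖ ≤ B := hB z (by simpa using hz)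
      _ ≤ 1 + |B| := by linarith [le_abs_self B]
      _ = Real.exp (Real.log (1 + |B|)) := by rw [Real.exp_log (by positivity)]
      _ ≤ _ := Real.exp_le_exp.2 (by nlinarith)

theorem HasOrderOneGrowth.comp_const_add {f : ℂ → ℂ} (hf : HasOrderOneGrowth f) (c : ℂ) :
    HasOrderOneGrowth fun z => f (c + z) := by
  intro p hp
  obtain ⟨K, hK⟩ := hf p hp
  refine ⟨|K| * (1 + ‖c‖) ^ p, fun z => (hK _).trans (Real.exp_le_exp.2 ?_)⟩
  have h1 : 1 + ‖c + z‖ ≤ (1 + ‖c‖) * (1 + ‖z‖) := by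
    nlinarith [norm_add_le c z, norm_nonneg c, norm_nonneg z]
  calc K * (1 + ‖c + z‖) ^ p ≤ |K| * (1 + ‖c + z‖) ^ p := by
        gcongr
        exact le_abs_self K
    _ ≤ |K| * ((1 + ‖c‖) * (1 + ‖z‖)) ^ p := by gcongr
    _ = |K| * (1 + ‖c‖) ^ p * (1 + ‖z‖) ^ p := by
        rw [Real.mul_rpow (by positivity) (by positivity), mul_assoc]

/-! ### Zeros with multiplicities: counting and summability -/

/-- `ζ` enumerates the zeros of `f` with multiplicities. -/
def EnumeratesZeros {ι : Type*} (f : ℂ → ℂ) (ζ : ι → ℂ) : Prop :=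
  ∀ z, analyticOrderAt f z = {i | ζ i = z}.encard

section Zeros

variable {ι : Type*} {f : ℂ → ℂ} {ζ : ι → ℂ}

theorem EnumeratesZeros.ne_zero (h : EnumeratesZeros f ζ) (hf : Differentiable ℂ f)
    (h0 : f 0 ≠ 0) (i : ι) : ζ i ≠ 0 := by
  intro hi
  have h1 := h 0
  rw [((hf.analyticAt 0).analyticOrderAt_eq_zero).2 h0, eq_comm, Set.encard_eq_zero] at h1
  exact Set.eq_empty_iff_forall_notMem.1 h1 i hi

/-- Zeros are divided out one at a time with `dslope`. Additivity of the order then shows that the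
quotient keeps exactly the zeros indexed outside `s`, so it is zero free on a disc once `s` contains
all the zeros there. -/
theorem exists_entire_mul_prod (hf : Differentiable ℂ f) (h : EnumeratesZeros f ζ)
    (hζ : ∀ i, ζ i ≠ 0) (s : Finset ι) :
    ∃ F : ℂ → ℂ, Differentiable ℂ F ∧ (∀ z, f z = F z * ∏ i ∈ s, (1 - z / ζ i)) ∧
      ∀ z, analyticOrderAt F z = {i | i ∉ s ∧ ζ i = z}.encard := by
  classical
  induction s using Finset.induction_on with
  | empty => exact ⟨f, hf, by simp, fun z => by simpa using h z⟩
  | insert a s ha ih =>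
    obtain ⟨F, hF, hfF, hord⟩ := ih
    have hset : ∀ z, {i | i ∉ s ∧ ζ i = z}.encard =
        {i | i ∉ insert a s ∧ ζ i = z}.encard + if ζ a = z then 1 else 0 := by
      intro z
      split_ifs with haz
      · rw [← Set.encard_insert_of_notMem (a := a)]
        · congr 1
          ext i
          by_cases hia : i = a
          · simp [hia, ha, haz]
          · simp [hia]
        · simp
      · rw [add_zero]
        congr 1
        ext i
        by_cases hia : i = a
        · simp [hia, haz]
        · simp [hia]
    have hFa : F (ζ a) = 0 := by
      apply apply_eq_zero_of_analyticOrderAt_ne_zero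
      rw [hord, hset]
      simp
    let F1 : ℂ → ℂ := fun z => -ζ a * dslope F (ζ a) z
    have hF1 : Differentiable ℂ F1 := by
      have : Differentiable ℂ (dslope F (ζ a)) := by
        rw [← differentiableOn_univ]
        exact (Complex.differentiableOn_dslope univ_mem).2 hF.differentiableOn
      exact this.const_mul _
    have hFF1 : ∀ z, F z = F1 z * (1 - z / ζ a) := by
      intro z
      have h1 := sub_smul_dslope F (ζ a) z
      rw [hFa, sub_zero, smul_eq_mul] at h1
      rw [← h1]
      have := hζ a
      simp only [F1]
      field_simp
      ring
    refine ⟨F1, hF1, fun z => ?_, fun z => ?_⟩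
    · rw [hfF, hFF1, Finset.prod_insert ha, mul_assoc]
    · have hlin : Differentiable ℂ fun w : ℂ => 1 - w / ζ a := by fun_prop
      have h1 : analyticOrderAt F z = analyticOrderAt F1 z +
          analyticOrderAt (fun w => 1 - w / ζ a) z := by
        rw [← analyticOrderAt_mul (hF1.analyticAt z) (hlin.analyticAt z)]
        congr 1
        ext w
        exact hFF1 w
      have h2 : analyticOrderAt (fun w => 1 - w / ζ a) z = if ζ a = z then 1 else 0 := by
        split_ifs with haz
        · have := (hlin.analyticAt z).analyticOrderAt_eq_one_of_zero_deriv_ne_zero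
            (by simp [← haz, hζ a])
          apply this
          have hd : HasDerivAt (fun w => 1 - w / ζ a) (-(1 / ζ a)) z := by
            simpa using ((hasDerivAt_id z).div_const (ζ a)).const_sub 1
          rw [hd.deriv]
          simp [hζ a]
        · rw [(hlin.analyticAt z).analyticOrderAt_eq_zero]
          intro h3
          apply haz
          have := hζ a
          field_simp at h3
          linear_combination h3
      rw [hord, hset, h2] at h1
      -- Cancellation in `ℕ∞` requires the common term to be finite.
      have h3 : (if ζ a = z then (1 : ℕ∞) else 0) ≠ ⊤ := by split_ifs <;> simp
      exact (WithTop.add_right_cancel h3 h1).symm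

/-- A substitute for Jensen's formula: on `‖w‖ = 4R` each factor `1 - w / ζ i` has modulus at least
`4 - 1 = 3`, and the maximum principle carries the bound inside. At `z = 0` it counts zeros;
elsewhere it bounds the zero free quotient. -/
theorem norm_le_of_mul_prod {F : ℂ → ℂ} (hF : Differentiable ℂ F) {s : Finset ι} {R B : ℝ}
    (hR : 0 < R) (hfF : ∀ z, f z = F z * ∏ i ∈ s, (1 - z / ζ i)) (hζ : ∀ i, ζ i ≠ 0)
    (hs : ∀ i ∈ s, ‖ζ i‖ ≤ R) (hB : ∀ z, ‖z‖ = 4 * R → ‖f z‖ ≤ B) {z : ℂ} (hz : ‖z‖ ≤ 4 * R) :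
    3 ^ s.card * ‖F z‖ ≤ B := by
  have h3 : (0 : ℝ) < 3 ^ s.card := by positivity
  rw [← le_div_iff₀' h3]
  refine Complex.norm_le_of_forall_mem_frontier_norm_le (U := Metric.ball 0 (4 * R))
    Metric.isBounded_ball hF.diffContOnCl (fun w hw => ?_) ?_
  · rw [frontier_ball _ (by positivity), mem_sphere_zero_iff_norm] at hw
    rw [le_div_iff₀' h3]
    refine le_trans ?_ (hB w hw)
    rw [hfF, norm_mul, mul_comm, norm_prod]
    gcongr
    rw [← Finset.prod_const]
    refine Finset.prod_le_prod (fun _ _ => by norm_num) fun i hi => ?_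
    have h4 : 4 ≤ ‖w / ζ i‖ := by
      rw [norm_div, hw, le_div_iff₀ (norm_pos_iff.2 (hζ i))]
      linarith [hs i hi]
    have := norm_sub_norm_le (w / ζ i) 1
    rw [norm_sub_rev, norm_one] at this
    linarith
  · rw [closure_ball _ (by positivity)]
    simpa using hz

/-- The number of zeros in a disc of radius `R` is `O(R ^ p)` for every `p > 1`. -/
theorem EnumeratesZeros.exists_card_le (h : EnumeratesZeros f ζ) (hf : Differentiable ℂ f)
    (h0 : f 0 ≠ 0) (hgr : HasOrderOneGrowth f) {p : ℝ} (hp : 1 < p) :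
    ∃ C : ℝ, 0 ≤ C ∧ ∀ R : ℝ, 0 ≤ R → ∀ s : Finset ι, (∀ i ∈ s, ‖ζ i‖ ≤ R) →
      (s.card : ℝ) ≤ C * (1 + R) ^ p := by
  obtain ⟨K, hK⟩ := hgr p hp
  -- The disc has radius `1 + R`, which is positive even for `R = 0`. On the circle of radius `4 (1
  -- + R)` one has `1 + ‖z‖ ≤ 8 (1 + R)`, whence `8 ^ p`; the logarithm of `‖f 0‖` comes from
  -- evaluating at `0`.
  refine ⟨|K| * 8 ^ p + |Real.log ‖f 0‖|, by positivity, fun R hR s hs => ?_⟩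
  have hζ := h.ne_zero hf h0
  obtain ⟨F, hF, hfF, -⟩ := exists_entire_mul_prod hf h hζ s
  have hB : ∀ z : ℂ, ‖z‖ = 4 * (1 + R) →
      ‖f z‖ ≤ Real.exp (|K| * 8 ^ p * (1 + R) ^ p) := by
    intro z hz
    refine (hK z).trans (Real.exp_le_exp.2 ?_)
    rw [mul_assoc, ← Real.mul_rpow (by norm_num) (by positivity), hz]
    have : 1 + 4 * (1 + R) ≤ 8 * (1 + R) := by linarith
    gcongr
    exact le_abs_self K
  have h1 := norm_le_of_mul_prod hF (R := 1 + R) (by positivity) hfF hζ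
    (fun i hi => (hs i hi).trans (by linarith)) hB (z := 0) (by rw [norm_zero]; positivity)
  have hF0 : F 0 = f 0 := by rw [hfF 0]; simp
  rw [hF0] at h1
  have h2 := Real.log_le_log (by positivity) h1
  rw [Real.log_exp, Real.log_mul (by positivity) (by simpa using h0), Real.log_pow] at h2
  have h3 : (1 : ℝ) ≤ Real.log 3 := by
    rw [Real.le_log_iff_exp_le (by norm_num)]
    exact Real.exp_one_lt_three.le
  have h4 : (1 : ℝ) ≤ (1 + R) ^ p := Real.one_le_rpow (by linarith) (by linarith)
  have h5 := neg_abs_le (Real.log ‖f 0‖)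
  have h6 : (s.card : ℝ) ≤ s.card * Real.log 3 := le_mul_of_one_le_right (Nat.cast_nonneg _) h3
  nlinarith [abs_nonneg (Real.log ‖f 0‖)]

theorem finite_of_card_le {P : ι → Prop} {C : ℝ}
    (h : ∀ s : Finset ι, (∀ i ∈ s, P i) → (s.card : ℝ) ≤ C) : {i | P i}.Finite := by
  by_contra hinf
  obtain ⟨n, hn⟩ := exists_nat_gt C
  obtain ⟨t, ht, htn⟩ := Set.Infinite.exists_subset_card_eq hinf n
  have := h t fun i hi => ht hi
  rw [htn] at this
  linarith

/-- Dyadic blocks: at most `C (4 · 2^n)^p` indices have `2^n ≤ 1 + x i < 2^(n+1)`, each contributing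
at most `2^(-nr)`. The blocks are thus dominated by a geometric series of ratio `2^(p - r) < 1`. -/
theorem summable_one_add_rpow_of_card_le {x : ι → ℝ} (hx : ∀ i, 0 ≤ x i) {C p r : ℝ}
    (hC : 0 ≤ C) (hp : 0 < p) (hr : p < r)
    (h : ∀ R : ℝ, 0 ≤ R → ∀ s : Finset ι, (∀ i ∈ s, x i ≤ R) → (s.card : ℝ) ≤ C * (1 + R) ^ p) :
    Summable fun i => (1 + x i) ^ (-r) := by
  classical
  set θ : ℝ := 2 ^ (p - r) with hθ
  have hθ0 : 0 ≤ θ := by positivity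
  have hθ1 : θ < 1 := Real.rpow_lt_one_of_one_lt_of_neg (by norm_num) (by linarith)
  let m : ι → ℕ := fun i => Nat.log 2 ⌊1 + x i⌋₊
  have hm1 : ∀ i, (2 : ℝ) ^ m i ≤ 1 + x i := by
    intro i
    have h1 : 2 ^ m i ≤ ⌊1 + x i⌋₊ := Nat.pow_log_le_self 2
      (Nat.floor_pos.2 (by linarith [hx i])).ne'
    have := (Nat.le_floor_iff (by linarith [hx i])).1 h1
    exact_mod_cast this
  have hm2 : ∀ i, 1 + x i ≤ (2 : ℝ) ^ (m i + 1) := by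
    intro i
    have h1 : ⌊1 + x i⌋₊ < 2 ^ (m i + 1) := Nat.lt_pow_succ_log_self (by norm_num) _
    have := (Nat.floor_lt (by linarith [hx i])).1 h1
    exact le_of_lt (by exact_mod_cast this)
  refine summable_of_sum_le (c := ∑' n : ℕ, C * 4 ^ p * θ ^ n)
    (fun i => Real.rpow_nonneg (by linarith [hx i]) _) fun s => ?_
  have hsum : Summable fun n : ℕ => C * 4 ^ p * θ ^ n :=
    (summable_geometric_of_lt_one hθ0 hθ1).mul_left _
  rw [← Finset.sum_fiberwise_of_maps_to (t := s.image m)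
    (fun i hi => Finset.mem_image_of_mem m hi)]
  refine le_trans (Finset.sum_le_sum fun n _ => ?_)
    (hsum.sum_le_tsum _ fun n _ => by positivity)
  have hcard := h (2 ^ (n + 1)) (by positivity) (s.filter fun i => m i = n) fun i hi => by
    rw [Finset.mem_filter] at hi
    have := hm2 i
    rw [hi.2] at this
    linarith
  have hpow : ((2 : ℝ) ^ n) ^ (-r) * ((2 : ℝ) ^ n) ^ p = θ ^ n := by
    rw [← Real.rpow_add (by positivity), ← Real.rpow_natCast, ← Real.rpow_natCast,
      ← Real.rpow_mul (by norm_num), hθ, ← Real.rpow_mul (by norm_num)]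
    congr 1
    ring
  calc ∑ i ∈ s with m i = n, (1 + x i) ^ (-r)
      ≤ ∑ i ∈ s with m i = n, ((2 : ℝ) ^ n) ^ (-r) := by
        refine Finset.sum_le_sum fun i hi => ?_
        rw [Finset.mem_filter] at hi
        have := hm1 i
        rw [hi.2] at this
        exact Real.rpow_le_rpow_of_nonpos (by positivity) this (by linarith)
    _ = (s.filter fun i => m i = n).card * ((2 : ℝ) ^ n) ^ (-r) := by
        rw [Finset.sum_const, nsmul_eq_mul]
    _ ≤ C * (4 * 2 ^ n) ^ p * ((2 : ℝ) ^ n) ^ (-r) := by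
        gcongr
        refine hcard.trans ?_
        gcongr
        have : (1 : ℝ) ≤ 2 ^ n := one_le_pow₀ (by norm_num)
        rw [pow_succ]
        linarith
    _ = C * 4 ^ p * θ ^ n := by
        rw [Real.mul_rpow (by norm_num) (by positivity), ← hpow]
        ring

theorem EnumeratesZeros.finite_norm_le (h : EnumeratesZeros f ζ) (hf : Differentiable ℂ f)
    (h0 : f 0 ≠ 0) (hgr : HasOrderOneGrowth f) (R : ℝ) : {i | ‖ζ i‖ ≤ R}.Finite := by
  obtain ⟨C, -, hC⟩ := h.exists_card_le hf h0 hgr (p := 2) (by norm_num)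
  rcases le_total 0 R with hR | hR
  · exact finite_of_card_le fun s hs => hC R hR s hs
  · exact finite_of_card_le fun s hs => hC 0 le_rfl s fun i hi => (hs i hi).trans hR

theorem summable_norm_rpow_of_one_add {x : ι → ℝ} (hx : ∀ i, 0 ≤ x i) {r : ℝ} (hr : 0 ≤ r)
    (hfin : {i | x i ≤ 1}.Finite) (h : Summable fun i => (1 + x i) ^ (-r)) :
    Summable fun i => x i ^ (-r) := by
  refine Summable.of_norm_bounded_eventually (h.mul_left (2 ^ r)) ?_
  filter_upwards [hfin.compl_mem_cofinite] with i hi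
  have hi : 1 < x i := not_le.1 hi
  rw [Real.norm_of_nonneg (Real.rpow_nonneg (hx i) _)]
  have h2 : (2 : ℝ) ^ r = 2⁻¹ ^ (-r) := by
    rw [Real.inv_rpow (by norm_num), Real.rpow_neg (by norm_num), inv_inv]
  rw [h2, ← Real.mul_rpow (by norm_num) (by linarith)]
  exact Real.rpow_le_rpow_of_nonpos (by linarith) (by linarith) (by linarith)

theorem EnumeratesZeros.summable_norm_rpow (h : EnumeratesZeros f ζ) (hf : Differentiable ℂ f)
    (h0 : f 0 ≠ 0) (hgr : HasOrderOneGrowth f) {r : ℝ} (hr : 1 < r) :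
    Summable fun i => ‖ζ i‖ ^ (-r) := by
  obtain ⟨p, hp1, hpr⟩ := exists_between hr
  obtain ⟨C, hC0, hC⟩ := h.exists_card_le hf h0 hgr hp1
  exact summable_norm_rpow_of_one_add (fun i => norm_nonneg _) (by linarith)
    (h.finite_norm_le hf h0 hgr 1)
    (summable_one_add_rpow_of_card_le (fun i => norm_nonneg _) hC0 (by linarith) hpr hC)

end Zeros

/-! ### The logarithmic derivative as a sum over the zeros -/

/-- A bound for the variation of the derivative of a holomorphic function `g` with `g 0 = 0` and
`Re g ≤ M`. -/
theorem norm_deriv_sub_deriv_zero_le {g : ℂ → ℂ} {R M : ℝ} (hR : 0 < R) (hM : 0 < M)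
    (hg : DifferentiableOn ℂ g (Metric.ball 0 R)) (hg0 : g 0 = 0)
    (hre : ∀ z ∈ Metric.ball (0 : ℂ) R, (g z).re ≤ M) {z : ℂ} (hz : ‖z‖ < R / 8) :
    ‖deriv g z - deriv g 0‖ ≤ 64 * M / R ^ 2 * ‖z‖ := by
  have hsub : ∀ {c : ℂ} {r s : ℝ}, ‖c‖ + r ≤ s → Metric.closedBall c r ⊆ Metric.closedBall 0 s := by
    intro c r s h
    exact Metric.closedBall_subset_closedBall' (by rw [dist_zero_right]; linarith)
  -- Nested discs: Borel–Carathéodory gives `2M` for `g` on radius `R/2`, Cauchy's estimate then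
  -- gives `8M/R` for `g'` on `R/4` and `64M/R²` for `g''` on `R/8`. The mean value inequality
  -- concludes.
  have hb : ∀ w ∈ Metric.closedBall (0 : ℂ) (R / 2), ‖g w‖ ≤ 2 * M := by
    intro w hw
    have hw' : ‖w‖ ≤ R / 2 := by simpa using hw
    refine (Complex.borelCaratheodory_zero hM hg hre hR (by
      simp only [Metric.mem_ball, dist_zero_right]; linarith) hg0).trans ?_
    rw [div_le_iff₀ (by linarith)]
    nlinarith
  have hball : ∀ s < R, Metric.closedBall (0 : ℂ) s ⊆ Metric.ball 0 R := fun s hs =>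
    Metric.closedBall_subset_ball hs
  have hd1 : ∀ w ∈ Metric.closedBall (0 : ℂ) (R / 4), ‖deriv g w‖ ≤ 8 * M / R := by
    intro w hw
    have hw' : ‖w‖ ≤ R / 4 := by simpa using hw
    have h1 : Metric.closedBall w (R / 4) ⊆ Metric.closedBall 0 (R / 2) := hsub (by linarith)
    have := Complex.norm_deriv_le_of_forall_mem_sphere_norm_le (c := w) (R := R / 4) (C := 2 * M)
      (f := g) (by linarith)
      ((hg.mono (h1.trans (hball _ (by linarith)))).diffContOnCl_ball subset_rfl)
      (fun u hu => hb u (h1 (Metric.sphere_subset_closedBall hu)))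
    refine this.trans (le_of_eq ?_)
    field_simp
    norm_num
  have hdg : DifferentiableOn ℂ (deriv g) (Metric.ball 0 R) := hg.deriv Metric.isOpen_ball
  have hd2 : ∀ w ∈ Metric.ball (0 : ℂ) (R / 8), ‖deriv (deriv g) w‖ ≤ 64 * M / R ^ 2 := by
    intro w hw
    have hw' : ‖w‖ < R / 8 := by simpa using hw
    have h1 : Metric.closedBall w (R / 8) ⊆ Metric.closedBall 0 (R / 4) := hsub (by linarith)
    have := Complex.norm_deriv_le_of_forall_mem_sphere_norm_le (c := w) (R := R / 8)
      (C := 8 * M / R) (f := deriv g) (by linarith)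
      ((hdg.mono (h1.trans (hball _ (by linarith)))).diffContOnCl_ball subset_rfl)
      (fun u hu => hd1 u (h1 (Metric.sphere_subset_closedBall hu)))
    refine this.trans (le_of_eq ?_)
    field_simp
    norm_num
  have := (convex_ball (0 : ℂ) (R / 8)).norm_image_sub_le_of_norm_deriv_le (f := deriv g)
    (fun w hw => (hdg w (Metric.ball_subset_ball (by linarith) hw)).differentiableAt
      (Metric.isOpen_ball.mem_nhds (Metric.ball_subset_ball (by linarith) hw))) hd2
    (Metric.mem_ball_self (by linarith)) (y := z) (by simpa using hz)
  simpa using this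

/-- A bound for the variation of the logarithmic derivative of a zero free holomorphic function. -/
theorem norm_logDeriv_sub_le {F : ℂ → ℂ} {R M : ℝ} (hR : 0 < R) (hF : Differentiable ℂ F)
    (hne : ∀ z ∈ Metric.ball (0 : ℂ) R, F z ≠ 0)
    (hM : 0 < M) (hb : ∀ z ∈ Metric.ball (0 : ℂ) R, ‖F z‖ ≤ ‖F 0‖ * Real.exp M) {z : ℂ}
    (hz : ‖z‖ < R / 8) :
    ‖logDeriv F z - logDeriv F 0‖ ≤ 64 * M / R ^ 2 * ‖z‖ := by
  have hld : DifferentiableOn ℂ (logDeriv F) (Metric.ball 0 R) := by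
    intro w hw
    exact ((hF.contDiff (n := 2)).differentiable_deriv_two w |>.div (hF w) (hne w hw))
      |>.differentiableWithinAt
  -- A primitive of `F'/F` normalised at `0` gives `F = F 0 · exp g`, so the bound on `‖F‖` becomes
  -- a bound on `Re g`.
  obtain ⟨g₀, hg₀⟩ := hld.isExactOn_ball
  set g : ℂ → ℂ := fun w => g₀ w - g₀ 0 with hg_def
  have hg : ∀ w ∈ Metric.ball (0 : ℂ) R, HasDerivAt g (logDeriv F w) w := fun w hw =>
    (hg₀ w hw).sub_const _
  have hgd : DifferentiableOn ℂ g (Metric.ball 0 R) := fun w hw =>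
    (hg w hw).differentiableAt.differentiableWithinAt
  have h0R : (0 : ℂ) ∈ Metric.ball (0 : ℂ) R := Metric.mem_ball_self hR
  have hexp : ∀ w ∈ Metric.ball (0 : ℂ) R, F w = F 0 * Complex.exp (g w) := by
    have hderiv : ∀ w ∈ Metric.ball (0 : ℂ) R,
        HasDerivAt (fun w => F w * Complex.exp (-g w)) 0 w := by
      intro w hw
      have h1 := (hF w).hasDerivAt.mul (hg w hw).neg.cexp
      convert! h1 using 1
      rw [logDeriv_apply]
      have := hne w hw
      field_simp
      simp
    intro w hw
    have hconst := (Metric.isOpen_ball (x := (0 : ℂ)) (ε := R)).is_const_of_deriv_eq_zero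
      (convex_ball (0 : ℂ) R).isPreconnected
      (fun u hu => (hderiv u hu).differentiableAt.differentiableWithinAt)
      (fun u hu => (hderiv u hu).deriv) hw h0R
    simp only [hg_def, sub_self, neg_zero, Complex.exp_zero, mul_one] at hconst
    rw [← hconst, mul_assoc, ← Complex.exp_add]
    simp [hg_def]
  have hre : ∀ w ∈ Metric.ball (0 : ℂ) R, (g w).re ≤ M := by
    intro w hw
    have h1 := hb w hw
    rw [hexp w hw, norm_mul, Complex.norm_exp] at h1
    exact Real.exp_le_exp.1 (le_of_mul_le_mul_left h1 (norm_pos_iff.2 (hne 0 h0R)))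
  have := norm_deriv_sub_deriv_zero_le hR hM hgd (by simp [hg_def]) hre hz
  rwa [(hg 0 h0R).deriv, (hg z (by simp only [Metric.mem_ball, dist_zero_right]; linarith)).deriv]
    at this

section Zeros

variable {ι : Type*} {f : ℂ → ℂ} {ζ : ι → ℂ}

theorem EnumeratesZeros.apply_ne_zero (h : EnumeratesZeros f ζ) (hf : Differentiable ℂ f)
    {z : ℂ} (hz : f z ≠ 0) (i : ι) : ζ i ≠ z := by
  intro hi
  have h1 := h z
  rw [((hf.analyticAt z).analyticOrderAt_eq_zero).2 hz, eq_comm, Set.encard_eq_zero] at h1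
  exact Set.eq_empty_iff_forall_notMem.1 h1 i hi

theorem EnumeratesZeros.summable_sub (h : EnumeratesZeros f ζ) (hf : Differentiable ℂ f)
    (h0 : f 0 ≠ 0) (hgr : HasOrderOneGrowth f) {z : ℂ} (hz : f z ≠ 0) :
    Summable fun i => 1 / (z - ζ i) + 1 / ζ i := by
  refine Summable.of_norm_bounded_eventually
    ((h.summable_norm_rpow hf h0 hgr (r := 2) (by norm_num)).mul_left (2 * ‖z‖)) ?_
  filter_upwards [(h.finite_norm_le hf h0 hgr (2 * ‖z‖)).compl_mem_cofinite] with i hi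
  have hi : 2 * ‖z‖ < ‖ζ i‖ := not_le.1 hi
  have hζ := h.ne_zero hf h0 i
  have hzζ : z - ζ i ≠ 0 := sub_ne_zero.2 (h.apply_ne_zero hf hz i).symm
  have h1 : 1 / (z - ζ i) + 1 / ζ i = z / (ζ i * (z - ζ i)) := by
    field_simp
    ring
  have hp : 0 < ‖ζ i‖ := norm_pos_iff.2 hζ
  have h2 : ‖ζ i‖ / 2 ≤ ‖z - ζ i‖ := by
    have := norm_sub_norm_le (ζ i) z
    rw [norm_sub_rev] at this
    linarith
  rw [h1, norm_div, norm_mul, Real.rpow_neg (norm_nonneg _), Real.rpow_two,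
    div_le_iff₀ (by positivity)]
  calc ‖z‖ = 2 * ‖z‖ * (‖ζ i‖ ^ 2)⁻¹ * (‖ζ i‖ * (‖ζ i‖ / 2)) := by field_simp
    _ ≤ _ := by gcongr

/-- The partial fraction expansion of the logarithmic derivative of an entire function of order
at most `1`. -/
theorem EnumeratesZeros.hasSum_logDeriv (h : EnumeratesZeros f ζ) (hf : Differentiable ℂ f)
    (h0 : f 0 ≠ 0) (hgr : HasOrderOneGrowth f) {z : ℂ} (hz : f z ≠ 0) :
    HasSum (fun i => 1 / (z - ζ i) + 1 / ζ i) (logDeriv f z - logDeriv f 0) := by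
  classical
  have hζ := h.ne_zero hf h0
  have hsum := h.summable_sub hf h0 hgr hz
  let s : ℕ → Finset ι := fun n => (h.finite_norm_le hf h0 hgr n).toFinset
  have hs : ∀ n i, i ∈ s n ↔ ‖ζ i‖ ≤ n := fun n i => by simp [s]
  have hs_top : Tendsto s atTop atTop := by
    refine tendsto_atTop_finset_of_monotone (fun m n hmn i hi => ?_) fun i => ?_
    · rw [hs] at hi ⊢
      exact hi.trans (by exact_mod_cast hmn)
    · obtain ⟨n, hn⟩ := exists_nat_ge ‖ζ i‖
      exact ⟨n, (hs n i).2 hn⟩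
  -- Any exponent strictly between `1` and `2` works: the error is of order `n ^ (3/2) / n ^ 2`.
  obtain ⟨K, hK⟩ := hgr (3 / 2) (by norm_num)
  set M : ℕ → ℝ := fun n => |K| * (1 + 4 * (n : ℝ)) ^ (3 / 2 : ℝ) + |Real.log ‖f 0‖| with hM
  have hest : ∀ᶠ n : ℕ in atTop,
      ‖(logDeriv f z - logDeriv f 0) - ∑ i ∈ s n, (1 / (z - ζ i) + 1 / ζ i)‖ ≤
        64 * (M n + 1) / (n : ℝ) ^ 2 * ‖z‖ := by
    obtain ⟨n₀, hn₀⟩ := exists_nat_gt (8 * ‖z‖)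
    filter_upwards [eventually_ge_atTop n₀] with n hn
    have hnz : 8 * ‖z‖ < n := hn₀.trans_le (by exact_mod_cast hn)
    have hn0 : (0 : ℝ) < n := lt_of_le_of_lt (by positivity) hnz
    obtain ⟨F, hF, hfF, hord⟩ := exists_entire_mul_prod hf h hζ (s n)
    have hF0 : F 0 = f 0 := by rw [hfF 0]; simp
    have hne : ∀ w ∈ Metric.ball (0 : ℂ) n, F w ≠ 0 := by
      intro w hw
      rw [← (hF.analyticAt w).analyticOrderAt_eq_zero, hord, Set.encard_eq_zero]
      refine Set.eq_empty_iff_forall_notMem.2 fun i hi => hi.1 ?_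
      rw [hs, hi.2]
      exact le_of_lt (by simpa using hw)
    have hb : ∀ w ∈ Metric.ball (0 : ℂ) n, ‖F w‖ ≤ ‖F 0‖ * Real.exp (M n + 1) := by
      intro w hw
      have hw' : ‖w‖ < n := by simpa using hw
      have h1 := norm_le_of_mul_prod hF hn0 hfF hζ (fun i hi => (hs n i).1 hi)
        (B := Real.exp (|K| * (1 + 4 * (n : ℝ)) ^ (3 / 2 : ℝ))) (fun u hu => by
          refine (hK u).trans (Real.exp_le_exp.2 ?_)
          rw [hu]
          gcongr
          exact le_abs_self K) (z := w) (by linarith)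
      have h2 : ‖F w‖ ≤ 3 ^ (s n).card * ‖F w‖ :=
        le_mul_of_one_le_left (norm_nonneg _) (one_le_pow₀ (by norm_num))
      refine (h2.trans h1).trans ?_
      have hpos : 0 < ‖f 0‖ := norm_pos_iff.2 h0
      rw [hF0]
      nth_rewrite 1 [← Real.exp_log hpos]
      rw [← Real.exp_add]
      refine Real.exp_le_exp.2 ?_
      have := neg_abs_le (Real.log ‖f 0‖)
      simp only [hM]
      linarith
    -- The quotient `F` has no zero in the disc of radius `n` and grows at most like `exp (M n)`
    -- there. Its logarithmic derivative therefore varies by `O(M n / n²)` between `0` and `z`.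
    -- Subtracting the value at `0` is what removes the unknown linear exponent of Hadamard's
    -- factorization.
    have hmain := norm_logDeriv_sub_le hn0 hF hne (M := M n + 1) (by positivity) hb (z := z)
      (by linarith)
    have hlog : ∀ w, f w ≠ 0 → logDeriv f w = logDeriv F w + ∑ i ∈ s n, 1 / (w - ζ i) := by
      intro w hw
      have hw' := hw
      rw [hfF, mul_ne_zero_iff, Finset.prod_ne_zero_iff] at hw'
      have hff : f = fun w => F w * ∏ i ∈ s n, (1 - w / ζ i) := funext hfF
      rw [hff, logDeriv_mul w hw'.1 (Finset.prod_ne_zero_iff.2 hw'.2) (hF w) (by fun_prop)]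
      congr 1
      rw [logDeriv_prod (s := s n) (f := fun i w => 1 - w / ζ i) hw'.2 (fun i _ => by fun_prop)]
      refine Finset.sum_congr rfl fun i hi => ?_
      have hd : HasDerivAt (fun w => 1 - w / ζ i) (-(1 / ζ i)) w := by
        simpa using ((hasDerivAt_id w).div_const (ζ i)).const_sub 1
      rw [logDeriv_apply, hd.deriv]
      have h3 := hw'.2 i hi
      have h4 := hζ i
      have h5 : w - ζ i ≠ 0 := sub_ne_zero.2 (h.apply_ne_zero hf hw i).symm
      have h6 : ζ i - w ≠ 0 := sub_ne_zero.2 (h.apply_ne_zero hf hw i)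
      field_simp
      ring
    rw [hlog z hz, hlog 0 h0]
    convert hmain using 2
    rw [Finset.sum_add_distrib]
    simp only [zero_sub, one_div, inv_neg, Finset.sum_neg_distrib]
    ring
  have hlim : Tendsto (fun n : ℕ => 64 * (M n + 1) / (n : ℝ) ^ 2 * ‖z‖) atTop (𝓝 0) := by
    have h1 : Tendsto (fun x : ℝ => x ^ (-(1 / 2) : ℝ)) atTop (𝓝 0) :=
      tendsto_rpow_neg_atTop (by norm_num)
    have h2 : Tendsto (fun n : ℕ => 64 * (|K| * 5 ^ (3 / 2 : ℝ) + |Real.log ‖f 0‖| + 1) * ‖z‖ *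
        (n : ℝ) ^ (-(1 / 2) : ℝ)) atTop (𝓝 0) := by
      simpa using (h1.comp tendsto_natCast_atTop_atTop).const_mul
        (64 * (|K| * 5 ^ (3 / 2 : ℝ) + |Real.log ‖f 0‖| + 1) * ‖z‖)
    refine squeeze_zero' (Eventually.of_forall fun n => by positivity) ?_ h2
    filter_upwards [eventually_ge_atTop 1] with n hn
    have hn1 : (1 : ℝ) ≤ n := by exact_mod_cast hn
    have h3 : (1 + 4 * (n : ℝ)) ^ (3 / 2 : ℝ) ≤ 5 ^ (3 / 2 : ℝ) * (n : ℝ) ^ (3 / 2 : ℝ) := by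
      rw [← Real.mul_rpow (by norm_num) (by positivity)]
      gcongr
      linarith
    have h4 : (1 : ℝ) ≤ (n : ℝ) ^ (3 / 2 : ℝ) := Real.one_le_rpow hn1 (by norm_num)
    have h5 : M n + 1 ≤
        (|K| * 5 ^ (3 / 2 : ℝ) + |Real.log ‖f 0‖| + 1) * (n : ℝ) ^ (3 / 2 : ℝ) := by
      have : |K| * (1 + 4 * (n : ℝ)) ^ (3 / 2 : ℝ) ≤
          |K| * (5 ^ (3 / 2 : ℝ) * (n : ℝ) ^ (3 / 2 : ℝ)) := by gcongr
      simp only [hM]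
      nlinarith [abs_nonneg (Real.log ‖f 0‖)]
    have h6 : (n : ℝ) ^ (-(1 / 2) : ℝ) = (n : ℝ) ^ (3 / 2 : ℝ) / (n : ℝ) ^ 2 := by
      rw [← Real.rpow_two, ← Real.rpow_sub (by positivity)]
      norm_num
    rw [h6]
    calc 64 * (M n + 1) / (n : ℝ) ^ 2 * ‖z‖
        ≤ 64 * ((|K| * 5 ^ (3 / 2 : ℝ) + |Real.log ‖f 0‖| + 1) * (n : ℝ) ^ (3 / 2 : ℝ)) /
          (n : ℝ) ^ 2 * ‖z‖ := by gcongr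
      _ = _ := by ring
  have h1 : Tendsto (fun n => ∑ i ∈ s n, (1 / (z - ζ i) + 1 / ζ i)) atTop
      (𝓝 (logDeriv f z - logDeriv f 0)) := by
    rw [tendsto_iff_norm_sub_tendsto_zero]
    refine squeeze_zero' (Eventually.of_forall fun n => norm_nonneg _) ?_ hlim
    filter_upwards [hest] with n hn
    rwa [norm_sub_rev]
  -- Convergence along the exhausting discs identifies the value of a sum already known to converge
  -- unconditionally.
  have h2 := hsum.hasSum.comp hs_top
  rw [← tendsto_nhds_unique h2 h1]
  exact hsum.hasSum

end Zeros

/-! ### The Mellin transform of `1 / (t + w)` -/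

open MeasureTheory Set in
theorem mellin_one_div_add_one {a : ℂ} (h0 : 0 < a.re) (h1 : a.re < 1) :
    mellin (fun t : ℝ => 1 / ((t : ℂ) + 1)) a = Real.pi / Complex.sin (Real.pi * a) := by
  have hbeta : Complex.betaIntegral a (1 - a) = Real.pi / Complex.sin (Real.pi * a) := by
    rw [Complex.betaIntegral_eq_Gamma_mul_div a (1 - a) h0 (by simpa using h1),
      Complex.Gamma_mul_Gamma_one_sub]
    simp
  -- The substitution `u = t / (1 + t)` identifies the transform with the Beta integral `B(a, 1 -
  -- a)`, which the reflection formula evaluates.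
  have himg : (fun t : ℝ => t / (1 + t)) '' Ioi 0 = Ioo 0 1 := by
    ext u
    constructor
    · rintro ⟨t, ht, rfl⟩
      have ht : 0 < t := ht
      exact ⟨by positivity, (div_lt_one (by positivity)).2 (by linarith)⟩
    · rintro ⟨hu0, hu1⟩
      refine ⟨u / (1 - u), div_pos hu0 (by linarith), ?_⟩
      have : 1 - u ≠ 0 := by linarith
      simp only
      field_simp
      ring
  have hinj : InjOn (fun t : ℝ => t / (1 + t)) (Ioi 0) := by
    intro x hx y hy hxy
    have hx : 0 < x := hx
    have hy : 0 < y := hy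
    have h1 : 1 + x ≠ 0 := by positivity
    have h2 : 1 + y ≠ 0 := by positivity
    simp only at hxy
    field_simp at hxy
    linarith
  have hder : ∀ t ∈ Ioi (0 : ℝ),
      HasDerivWithinAt (fun t : ℝ => t / (1 + t)) (1 / (1 + t) ^ 2) (Ioi 0) t := by
    intro t ht
    have ht : 0 < t := ht
    have h2 : 1 + t ≠ 0 := by positivity
    have := (hasDerivAt_id t).div ((hasDerivAt_id t).const_add 1) h2
    convert! this.hasDerivWithinAt using 1
    simp
  rw [← hbeta, Complex.betaIntegral, intervalIntegral.integral_of_le zero_le_one,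
    integral_Ioc_eq_integral_Ioo, ← himg,
    integral_image_eq_integral_abs_deriv_smul measurableSet_Ioi hder hinj, mellin]
  refine setIntegral_congr_fun measurableSet_Ioi fun t ht => ?_
  have ht : 0 < t := ht
  have hx : (0 : ℝ) < 1 + t := by linarith
  have hx' : ((1 + t : ℝ) : ℂ) ≠ 0 := by exact_mod_cast hx.ne'
  have h1 : ((t / (1 + t) : ℝ) : ℂ) = ((t : ℝ) : ℂ) * (((1 + t)⁻¹ : ℝ) : ℂ) := by
    push_cast
    ring
  have h2 : 1 - ((t / (1 + t) : ℝ) : ℂ) = (((1 + t)⁻¹ : ℝ) : ℂ) := by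
    push_cast at hx' ⊢
    field_simp
    ring
  have hy : ((((1 + t)⁻¹ : ℝ)) : ℂ) ≠ 0 := by exact_mod_cast (inv_pos.2 hx).ne'
  simp only [smul_eq_mul]
  rw [h2, h1, Complex.mul_cpow_ofReal_nonneg ht.le (by positivity), mul_assoc,
    ← Complex.cpow_add _ _ hy, show a - 1 + (1 - a - 1) = -1 by ring, Complex.cpow_neg_one,
    abs_of_pos (by positivity), Complex.real_smul]
  push_cast at hx' ⊢
  rw [inv_inv, add_comm (t : ℂ) 1]
  field_simp

theorem exists_sector_bound {w : ℂ} (hw : w ∈ Complex.slitPlane) :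
    ∃ c > 0, ∀ t : ℝ, 0 ≤ t → c * (1 + t) ≤ ‖(t : ℂ) + w‖ := by
  rcases hw with hre | him
  · refine ⟨min 1 w.re, lt_min one_pos hre, fun t ht => ?_⟩
    have h1 := Complex.re_le_norm ((t : ℂ) + w)
    simp only [Complex.add_re, Complex.ofReal_re] at h1
    nlinarith [min_le_left 1 w.re, min_le_right 1 w.re]
  · have him' : 0 < |w.im| := abs_pos.2 him
    refine ⟨(1 + (1 + ‖w‖) / |w.im|)⁻¹, by positivity, fun t ht => ?_⟩
    rw [inv_mul_le_iff₀ (by positivity), add_mul, one_mul, div_mul_eq_mul_div]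
    have h1 : |w.im| ≤ ‖(t : ℂ) + w‖ := by
      simpa using Complex.abs_im_le_norm ((t : ℂ) + w)
    have h2 : t ≤ ‖(t : ℂ) + w‖ + ‖w‖ := by
      have := norm_sub_le ((t : ℂ) + w) w
      simpa [abs_of_nonneg ht] using this
    have h3 : 1 + ‖w‖ ≤ (1 + ‖w‖) * ‖(t : ℂ) + w‖ / |w.im| := by
      rw [le_div_iff₀ him']
      gcongr
    linarith

/-- Local uniformity in `w`, as needed for differentiating under the integral sign. -/
theorem exists_sector_bound_nhds {w : ℂ} (hw : w ∈ Complex.slitPlane) :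
    ∃ c > 0, ∀ w' ∈ Metric.ball w c, ∀ t : ℝ, 0 ≤ t → c * (1 + t) ≤ ‖(t : ℂ) + w'‖ := by
  obtain ⟨c, hc, h⟩ := exists_sector_bound hw
  refine ⟨c / 2, by positivity, fun w' hw' t ht => ?_⟩
  have h1 := h t ht
  rw [mem_ball_iff_norm'] at hw'
  have h2 : ‖(t : ℂ) + w‖ ≤ ‖(t : ℂ) + w'‖ + ‖w - w'‖ := by
    refine le_trans (le_of_eq ?_) (norm_add_le _ _)
    congr 1
    ring
  nlinarith

open MeasureTheory Set in
theorem mellinConvergent_one_div_add {a w : ℂ} (h0 : 0 < a.re) (h1 : a.re < 1)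
    (hw : w ∈ Complex.slitPlane) : MellinConvergent (fun t : ℝ => 1 / ((t : ℂ) + w)) a := by
  obtain ⟨c, hc, h⟩ := exists_sector_bound hw
  have hb : ∀ t : ℝ, 0 < t → ‖1 / ((t : ℂ) + w)‖ ≤ c⁻¹ * (1 + t)⁻¹ := by
    intro t ht
    rw [norm_div, norm_one, one_div, ← mul_inv]
    exact inv_anti₀ (by positivity) (h t ht.le)
  refine mellinConvergent_of_isBigO_rpow (a := 1) (b := 0) ?_ ?_ h1 ?_ h0
  · refine ContinuousOn.locallyIntegrableOn (fun t ht => ?_) measurableSet_Ioi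
    have ht : 0 < t := ht
    have : (t : ℂ) + w ≠ 0 := norm_pos_iff.1 (lt_of_lt_of_le (by positivity) (h t ht.le))
    have h2 : ContinuousAt (fun t : ℝ => 1 / ((t : ℂ) + w)) t :=
      ContinuousAt.div₀ (by fun_prop) (by fun_prop) this
    exact h2.continuousWithinAt
  · refine IsBigO.of_bound c⁻¹ ?_
    filter_upwards [eventually_gt_atTop 0] with t ht
    refine (hb t ht).trans ?_
    rw [Real.rpow_neg_one, Real.norm_of_nonneg (by positivity)]
    gcongr
    linarith
  · refine IsBigO.of_bound c⁻¹ ?_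
    filter_upwards [self_mem_nhdsWithin] with t ht
    have ht : 0 < t := ht
    refine (hb t ht).trans ?_
    simp only [neg_zero, Real.rpow_zero, norm_one]
    gcongr
    exact inv_le_one_of_one_le₀ (by linarith)

open MeasureTheory Set in
theorem differentiableOn_mellin_one_div_add {a : ℂ} (h0 : 0 < a.re) (h1 : a.re < 1) :
    DifferentiableOn ℂ (fun w => mellin (fun t : ℝ => 1 / ((t : ℂ) + w)) a)
      Complex.slitPlane := by
  intro w hw
  obtain ⟨c, hc, h⟩ := exists_sector_bound_nhds hw
  have hwc : w ∈ Metric.ball w c := Metric.mem_ball_self hc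
  have hone : (1 : ℂ) ∈ Complex.slitPlane := by simp
  have hne : ∀ w' ∈ Metric.ball w c, ∀ t : ℝ, 0 < t → (t : ℂ) + w' ≠ 0 := fun w' hw' t ht =>
    norm_pos_iff.1 (lt_of_lt_of_le (by positivity) (h w' hw' t ht.le))
  have hmeas : ∀ w' ∈ Metric.ball w c, ∀ n : ℕ, AEStronglyMeasurable
      (fun t : ℝ => (t : ℂ) ^ (a - 1) * (1 / ((t : ℂ) + w') ^ n)) (volume.restrict (Ioi 0)) := by
    intro w' hw' n
    refine ContinuousOn.aestronglyMeasurable (fun t ht => ?_) measurableSet_Ioi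
    refine ContinuousAt.continuousWithinAt (ContinuousAt.mul ?_ ?_)
    · exact Complex.continuousAt_ofReal_cpow_const t _ (Or.inr (ne_of_gt ht))
    · exact ContinuousAt.div₀ (by fun_prop) (by fun_prop) (pow_ne_zero _ (hne w' hw' t ht))
  -- The `w'`-derivative is at most `c⁻² t^(Re a - 1) (1 + t)⁻²`. Weakening `(1 + t)⁻²` to `(1 +
  -- t)⁻¹` makes the convergence at `w = 1` supply the majorant.
  have hbound : Integrable (fun t : ℝ => (c⁻¹) ^ 2 *
      ‖(t : ℂ) ^ (a - 1) • (1 / ((t : ℂ) + 1))‖) (volume.restrict (Ioi 0)) :=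
    (mellinConvergent_one_div_add h0 h1 hone).norm.const_mul _
  have key := hasDerivAt_integral_of_dominated_loc_of_deriv_le
    (F := fun w' (t : ℝ) => (t : ℂ) ^ (a - 1) • (1 / ((t : ℂ) + w')))
    (F' := fun w' (t : ℝ) => (t : ℂ) ^ (a - 1) * (-(1 / ((t : ℂ) + w') ^ 2)))
    (μ := volume.restrict (Ioi 0)) (x₀ := w)
    (Metric.ball_mem_nhds w hc) ?_ (mellinConvergent_one_div_add h0 h1 hw) ?_ ?_ hbound ?_
  · exact key.2.differentiableAt.differentiableWithinAt
  · filter_upwards [Metric.ball_mem_nhds w hc] with w' hw'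
    simpa using hmeas w' hw' 1
  · have := (hmeas w hwc 2).neg
    refine this.congr (Eventually.of_forall fun t => ?_)
    simp
  · refine (ae_restrict_iff' measurableSet_Ioi).2 (Eventually.of_forall fun t ht w' hw' => ?_)
    have ht : 0 < t := ht
    have h2 : ‖(t : ℂ) + 1‖ = 1 + t := by
      rw [← Complex.ofReal_one, ← Complex.ofReal_add, Complex.norm_real,
        Real.norm_of_nonneg (by positivity), add_comm]
    rw [norm_mul, norm_neg, norm_smul, norm_div, norm_div, norm_one, norm_pow, h2,
      mul_left_comm]
    gcongr
    have h3 := h w' hw' t ht.le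
    calc 1 / ‖(t : ℂ) + w'‖ ^ 2 ≤ 1 / (c * (1 + t)) ^ 2 := by gcongr
      _ = c⁻¹ ^ 2 * (1 / (1 + t) ^ 2) := by rw [mul_pow]; field_simp
      _ ≤ c⁻¹ ^ 2 * (1 / (1 + t)) := by
          gcongr
          nlinarith
  · refine (ae_restrict_iff' measurableSet_Ioi).2 (Eventually.of_forall fun t ht w' hw' => ?_)
    have h3 := ((hasDerivAt_id w').const_add (t : ℂ)).inv (hne w' hw' t ht)
    have h4 := h3.const_mul ((t : ℂ) ^ (a - 1))
    convert! h4 using 1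
    · ext u
      simp
    · simp [neg_div]

-- For `w > 0` this is the case `w = 1` rescaled. Both sides are holomorphic in the slit plane, so
-- the identity theorem extends it.
open MeasureTheory Set in
theorem mellin_one_div_add {a w : ℂ} (h0 : 0 < a.re) (h1 : a.re < 1)
    (hw : w ∈ Complex.slitPlane) :
    mellin (fun t : ℝ => 1 / ((t : ℂ) + w)) a =
      w ^ (a - 1) * (Real.pi / Complex.sin (Real.pi * a)) := by
  have hreal : ∀ r : ℝ, 0 < r → mellin (fun t : ℝ => 1 / ((t : ℂ) + r)) a =
      (r : ℂ) ^ (a - 1) * (Real.pi / Complex.sin (Real.pi * a)) := by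
    intro r hr
    have hr' : (r : ℂ) ≠ 0 := by exact_mod_cast hr.ne'
    set g : ℝ → ℂ := fun t : ℝ => 1 / ((t : ℂ) + 1) with hg
    have hf : (fun t : ℝ => 1 / ((t : ℂ) + r)) = fun t : ℝ => (r : ℂ)⁻¹ • g (r⁻¹ * t) := by
      ext t
      simp only [hg]
      rw [smul_eq_mul, show ((r⁻¹ * t : ℝ) : ℂ) + 1 = (r : ℂ)⁻¹ * (t + r) by
        push_cast; field_simp]
      rw [one_div, one_div, mul_inv, inv_inv, inv_mul_cancel_left₀ hr']
    rw [hf, mellin_const_smul, mellin_comp_mul_left g _ (inv_pos.2 hr),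
      mellin_one_div_add_one h0 h1, smul_eq_mul, smul_eq_mul, ← mul_assoc]
    congr 1
    rw [Complex.ofReal_inv, Complex.inv_cpow _ _ (by
      rw [Complex.arg_ofReal_of_nonneg hr.le]; exact Real.pi_pos.ne), Complex.cpow_neg, inv_inv,
      Complex.cpow_sub _ _ hr', Complex.cpow_one, div_eq_inv_mul]
  have hA : AnalyticOnNhd ℂ (fun w => mellin (fun t : ℝ => 1 / ((t : ℂ) + w)) a)
      Complex.slitPlane :=
    (differentiableOn_mellin_one_div_add h0 h1).analyticOnNhd Complex.isOpen_slitPlane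
  have hB : AnalyticOnNhd ℂ (fun w => w ^ (a - 1) * (Real.pi / Complex.sin (Real.pi * a)))
      Complex.slitPlane := by
    refine DifferentiableOn.analyticOnNhd (fun w hw => ?_) Complex.isOpen_slitPlane
    exact ((differentiableAt_id.cpow_const hw).mul_const _).differentiableWithinAt
  refine hA.eqOn_of_preconnected_of_frequently_eq hB
    (Complex.starConvex_one_slitPlane.isPathConnected
      Complex.one_mem_slitPlane).isConnected.isPreconnected (z₀ := 1) (by simp) ?_ hw
  have ht : Tendsto (fun r : ℝ => (r : ℂ)) (𝓝[≠] 1) (𝓝[≠] 1) := by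
    refine tendsto_nhdsWithin_iff.2 ⟨?_, ?_⟩
    · exact (Complex.continuous_ofReal.tendsto' 1 1 (by simp)).mono_left nhdsWithin_le_nhds
    · filter_upwards [self_mem_nhdsWithin] with r hr
      simpa using hr
  refine ht.frequently (Eventually.frequently ?_)
  filter_upwards [nhdsWithin_le_nhds (lt_mem_nhds one_pos)] with r hr using hreal r hr

theorem re_two_sub_mem {s : ℂ} (h1 : 1 < s.re) (h2 : s.re < 2) :
    0 < (2 - s).re ∧ (2 - s).re < 1 := by
  simp only [Complex.sub_re, Complex.re_ofNat]
  exact ⟨by linarith, by linarith⟩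

theorem mem_slitPlane_of_sector {w : ℂ} (hw : w ≠ 0) {c : ℝ} (hc : 0 < c)
    (h : ∀ t : ℝ, 0 ≤ t → c * (t + ‖w‖) ≤ ‖(t : ℂ) + w‖) : w ∈ Complex.slitPlane := by
  by_contra hcon
  rw [Complex.mem_slitPlane_iff, not_or, not_lt, not_not] at hcon
  have h1 := h (-w.re) (by linarith [hcon.1])
  have h2 : ((-w.re : ℝ) : ℂ) + w = 0 := by
    apply Complex.ext <;> simp [hcon.2]
  rw [h2, norm_zero] at h1
  have := norm_pos_iff.2 hw
  nlinarith [hcon.1]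

-- The explicit dependence on `r` bounds the `L¹` norms below by multiples of `‖ζ i‖ ^ (-Re s)`,
-- which are summable.
open MeasureTheory Set in
theorem integral_rpow_div_add {α r : ℝ} (h0 : 0 < α) (h1 : α < 1) (hr : 0 < r) :
    IntegrableOn (fun t : ℝ => t ^ (α - 1) / (t + r)) (Ioi 0) ∧
      ∫ t in Ioi (0 : ℝ), t ^ (α - 1) / (t + r) =
        r ^ (α - 1) * (Real.pi / Real.sin (Real.pi * α)) := by
  have hw : (r : ℂ) ∈ Complex.slitPlane := by simpa using hr
  have hc := mellinConvergent_one_div_add (a := α) (by simpa using h0) (by simpa using h1) hw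
  have hm := mellin_one_div_add (a := α) (by simpa using h0) (by simpa using h1) hw
  have heq : ∀ t ∈ Ioi (0 : ℝ), (t : ℂ) ^ ((α : ℂ) - 1) • (1 / ((t : ℂ) + r)) =
      ((t ^ (α - 1) / (t + r) : ℝ) : ℂ) := by
    intro t ht
    have ht : 0 < t := ht
    rw [smul_eq_mul, mul_one_div]
    push_cast
    rw [Complex.ofReal_cpow ht.le]
    push_cast
    rfl
  rw [mellin, setIntegral_congr_fun measurableSet_Ioi heq, integral_complex_ofReal] at hm
  rw [MellinConvergent, integrableOn_congr_fun heq measurableSet_Ioi] at hc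
  constructor
  · exact hc.re
  · have h3 : ((r ^ (α - 1) * (Real.pi / Real.sin (Real.pi * α)) : ℝ) : ℂ) =
        (r : ℂ) ^ ((α : ℂ) - 1) * (Real.pi / Complex.sin (Real.pi * α)) := by
      push_cast
      rw [Complex.ofReal_cpow hr.le]
      push_cast
      rfl
    rw [← h3] at hm
    exact_mod_cast hm

/-! ### The Mellin transform of a logarithmic derivative -/

section Zeros

variable {ι : Type*} {f : ℂ → ℂ} {ζ : ι → ℂ}

theorem EnumeratesZeros.countable (h : EnumeratesZeros f ζ) (hf : Differentiable ℂ f)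
    (h0 : f 0 ≠ 0) (hgr : HasOrderOneGrowth f) : Countable ι := by
  rw [← Set.countable_univ_iff]
  refine (Set.countable_iUnion fun n : ℕ =>
    (h.finite_norm_le hf h0 hgr n).countable).mono fun i _ => ?_
  obtain ⟨n, hn⟩ := exists_nat_ge ‖ζ i‖
  exact Set.mem_iUnion.2 ⟨n, hn⟩

theorem EnumeratesZeros.apply_ofReal_ne_zero (h : EnumeratesZeros f ζ)
    (hf : Differentiable ℂ f) (h0 : f 0 ≠ 0) {c : ℝ} (hc : 0 < c)
    (hsec : ∀ i, ∀ t : ℝ, 0 ≤ t → c * (t + ‖ζ i‖) ≤ ‖(t : ℂ) - ζ i‖) {t : ℝ} (ht : 0 ≤ t) :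
    f t ≠ 0 := by
  intro hft
  have h1 : analyticOrderAt f t ≠ 0 :=
    (analyticOrderAt_ne_zero).2 ⟨hf.analyticAt _, hft⟩
  rw [h t] at h1
  obtain ⟨i, hi⟩ := Set.encard_ne_zero.1 h1
  have hi : ζ i = t := hi
  have h2 := hsec i t ht
  rw [hi, sub_self, norm_zero] at h2
  have h3 : 0 < ‖(t : ℂ)‖ := by
    rw [← hi]
    exact norm_pos_iff.2 (h.ne_zero hf h0 i)
  nlinarith

open MeasureTheory Set in
/-- The Mellin transform of the logarithmic derivative of an entire function of order at most `1`
whose zeros avoid a sector around the positive real axis. -/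
theorem EnumeratesZeros.hasSum_mellin_logDeriv (h : EnumeratesZeros f ζ)
    (hf : Differentiable ℂ f) (h0 : f 0 ≠ 0) (hgr : HasOrderOneGrowth f) {c : ℝ} (hc : 0 < c)
    (hsec : ∀ i, ∀ t : ℝ, 0 ≤ t → c * (t + ‖ζ i‖) ≤ ‖(t : ℂ) - ζ i‖) {s : ℂ}
    (hs1 : 1 < s.re) (hs2 : s.re < 2) :
    HasSum (fun i => (-ζ i) ^ (-s) * (Real.pi / Complex.sin (Real.pi * s)))
      (mellin (fun t : ℝ => logDeriv f t - logDeriv f 0) (1 - s)) := by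
  have := h.countable hf h0 hgr
  have hζ := h.ne_zero hf h0
  obtain ⟨ha0, ha1⟩ := re_two_sub_mem hs1 hs2
  have hsec' : ∀ i, ∀ t : ℝ, 0 ≤ t → c * (t + ‖-ζ i‖) ≤ ‖(t : ℂ) + -ζ i‖ := by
    intro i t ht
    rw [norm_neg, ← sub_eq_add_neg]
    exact hsec i t ht
  have hslit : ∀ i, -ζ i ∈ Complex.slitPlane := fun i =>
    mem_slitPlane_of_sector (neg_ne_zero.2 (hζ i)) hc (hsec' i)
  set F : ι → ℝ → ℂ := fun i t => (t : ℂ) ^ (1 - s - 1) * (1 / (t - ζ i) + 1 / ζ i) with hF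
  -- Since `1/(t - ζ) + 1/ζ = t / (ζ (t - ζ))`, the extra factor `t` moves the Mellin parameter from
  -- `1 - s` to `2 - s`, whose real part lies in `(0, 1)` exactly when `1 < Re s < 2`.
  have hFeq : ∀ i, ∀ t ∈ Ioi (0 : ℝ),
      F i t = (ζ i)⁻¹ * ((t : ℂ) ^ (2 - s - 1) • (1 / ((t : ℂ) + -ζ i))) := by
    intro i t ht
    have ht : 0 < t := ht
    have ht' : (t : ℂ) ≠ 0 := by exact_mod_cast ht.ne'
    have h1 : (t : ℂ) - ζ i ≠ 0 :=
      sub_ne_zero.2 (h.apply_ne_zero hf (h.apply_ofReal_ne_zero hf h0 hc hsec ht.le) i).symm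
    have h2 := hζ i
    simp only [hF]
    rw [show (2 : ℂ) - s - 1 = (1 - s - 1) + 1 by ring, Complex.cpow_add _ _ ht',
      Complex.cpow_one, smul_eq_mul, ← sub_eq_add_neg]
    field_simp
    ring
  have hint : ∀ i, IntegrableOn (F i) (Ioi 0) := fun i => by
    rw [integrableOn_congr_fun (hFeq i) measurableSet_Ioi]
    exact (mellinConvergent_one_div_add ha0 ha1 (hslit i)).const_mul _
  have hval : ∀ i, ∫ t in Ioi (0 : ℝ), F i t =
      (-ζ i) ^ (-s) * (Real.pi / Complex.sin (Real.pi * s)) := by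
    intro i
    have h1 : ∫ t in Ioi (0 : ℝ), (t : ℂ) ^ (2 - s - 1) • (1 / ((t : ℂ) + -ζ i)) =
        mellin (fun t : ℝ => 1 / ((t : ℂ) + -ζ i)) (2 - s) := rfl
    have hζ' := neg_ne_zero.2 (hζ i)
    rw [setIntegral_congr_fun measurableSet_Ioi (hFeq i), integral_const_mul, h1,
      mellin_one_div_add ha0 ha1 (hslit i), show (2 : ℂ) - s - 1 = -s + 1 by ring,
      Complex.cpow_add _ _ hζ', Complex.cpow_one,
      show (Real.pi : ℂ) * (2 - s) = 2 * Real.pi - Real.pi * s by ring,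
      Complex.sin_two_pi_sub]
    have := hζ i
    rw [div_neg]
    field_simp
  -- The sector condition makes this bound uniform in `i`, which justifies exchanging sum and
  -- integral.
  have hnorm : ∀ i, ∫ t in Ioi (0 : ℝ), ‖F i t‖ ≤
      (c⁻¹ * (Real.pi / Real.sin (Real.pi * (2 - s.re)))) * ‖ζ i‖ ^ (-s.re) := by
    intro i
    have hpos : 0 < ‖ζ i‖ := norm_pos_iff.2 (hζ i)
    obtain ⟨hi1, hi2⟩ := integral_rpow_div_add (α := 2 - s.re) (r := ‖ζ i‖) (by linarith)
      (by linarith) hpos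
    calc ∫ t in Ioi (0 : ℝ), ‖F i t‖
        ≤ ∫ t in Ioi (0 : ℝ), (c⁻¹ * ‖ζ i‖⁻¹) * (t ^ (2 - s.re - 1) / (t + ‖ζ i‖)) := by
          refine setIntegral_mono_on (hint i).norm (hi1.const_mul _) measurableSet_Ioi
            fun t ht => ?_
          rw [hFeq i t ht]
          have ht : 0 < t := ht
          rw [norm_mul, norm_smul, norm_div, norm_one, norm_inv,
            Complex.norm_cpow_eq_rpow_re_of_pos ht, mul_comm c⁻¹, mul_assoc]
          have h5 : (2 - s - 1).re = 2 - s.re - 1 := by simp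
          rw [h5]
          refine mul_le_mul_of_nonneg_left ?_ (by positivity)
          have h6 := hsec' i t ht.le
          rw [norm_neg] at h6
          calc t ^ (2 - s.re - 1) * (1 / ‖(t : ℂ) + -ζ i‖)
              ≤ t ^ (2 - s.re - 1) * (1 / (c * (t + ‖ζ i‖))) := by gcongr
            _ = c⁻¹ * (t ^ (2 - s.re - 1) / (t + ‖ζ i‖)) := by field_simp
      _ = _ := by
          rw [integral_const_mul, hi2, show 2 - s.re - 1 = -s.re + 1 by ring,
            Real.rpow_add hpos, Real.rpow_one]
          field_simp
  have hsum : Summable fun i => ∫ t in Ioi (0 : ℝ), ‖F i t‖ :=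
    Summable.of_nonneg_of_le (fun i => integral_nonneg fun t => norm_nonneg _) hnorm
      ((h.summable_norm_rpow hf h0 hgr hs1).mul_left _)
  have key := hasSum_integral_of_summable_integral_norm hint hsum
  simp only [hval] at key
  have hmel : mellin (fun t : ℝ => logDeriv f t - logDeriv f 0) (1 - s) =
      ∫ t in Ioi (0 : ℝ), ∑' i, F i t := by
    refine setIntegral_congr_fun measurableSet_Ioi fun t ht => ?_
    have ht : 0 < t := ht
    have h3 := h.hasSum_logDeriv hf h0 hgr (h.apply_ofReal_ne_zero hf h0 hc hsec ht.le)
    simp only [hF, smul_eq_mul]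
    rw [(h3.mul_left _).tsum_eq]
  rw [hmel]
  exact key

end Zeros

/-! ### Asymptotic expansions and continuation of Mellin transforms -/

/-- `E(t) ∼ A log t + B + ∑_{j ≥ 1} c_j t^{-j}` as `t → +∞`. -/
def HasLogExpansion (E : ℝ → ℂ) (A B : ℂ) (c : ℕ → ℂ) : Prop :=
  ∀ N : ℕ, (fun t : ℝ => E t - (A * (Real.log t : ℂ) + B +
    ∑ j ∈ Finset.Icc 1 N, c j * ((t : ℂ) ^ j)⁻¹)) =O[atTop] fun t : ℝ => (t ^ (N + 1))⁻¹

section Indicator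

open MeasureTheory Set

/-- The terms of the expansion are cut off to `t > 1`: each then has a Mellin transform in a
half-plane, and that transform is a rational function. -/
theorem hasMellin_indicator_pow_inv (j : ℕ) {w : ℂ} (hw : w.re < j) :
    HasMellin ((Ioi (1 : ℝ)).indicator fun t => ((t : ℂ) ^ j)⁻¹) w (1 / (j - w)) := by
  have hre : (w - 1 - j).re < -1 := by simp; linarith
  have heq : ∀ t : ℝ, (t : ℂ) ^ (w - 1) • (Ioi (1 : ℝ)).indicator (fun t => ((t : ℂ) ^ j)⁻¹) t =
      (Ioi (1 : ℝ)).indicator (fun t : ℝ => (t : ℂ) ^ (w - 1 - j)) t := by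
    intro t
    by_cases ht : t ∈ Ioi (1 : ℝ)
    · have ht' : 1 < t := ht
      have : (t : ℂ) ≠ 0 := by exact_mod_cast (by linarith : t ≠ 0)
      rw [indicator_of_mem ht, indicator_of_mem ht, Complex.cpow_sub (w - 1) j this,
        Complex.cpow_natCast, smul_eq_mul, div_eq_mul_inv]
    · rw [indicator_of_notMem ht, indicator_of_notMem ht, smul_zero]
  have hsub : Ioi (0 : ℝ) ∩ Ioi 1 = Ioi 1 := inter_eq_right.2 (Ioi_subset_Ioi zero_le_one)
  constructor
  · simp only [MellinConvergent, heq]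
    rw [IntegrableOn, integrable_indicator_iff measurableSet_Ioi, IntegrableOn,
      Measure.restrict_restrict measurableSet_Ioi, inter_comm, hsub]
    exact integrableOn_Ioi_cpow_of_lt hre one_pos
  · simp only [mellin, heq]
    rw [setIntegral_indicator measurableSet_Ioi, hsub, integral_Ioi_cpow_of_lt hre one_pos]
    simp only [Complex.ofReal_one, Complex.one_cpow]
    rw [show w - 1 - j + 1 = -(j - w) by ring, div_neg, neg_div, neg_neg]

theorem locallyIntegrableOn_indicator_Ioi {g : ℝ → ℂ} (hg : ContinuousOn g (Ioi 0)) :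
    LocallyIntegrableOn ((Ioi (1 : ℝ)).indicator g) (Ioi 0) := by
  have h := hg.locallyIntegrableOn (μ := volume) measurableSet_Ioi
  intro x hx
  obtain ⟨u, hu, hi⟩ := h x hx
  exact ⟨u, hu, hi.indicator measurableSet_Ioi⟩

theorem isBigO_indicator_Ioi_nhds_zero {g : ℝ → ℂ} {h : ℝ → ℝ} :
    (Ioi (1 : ℝ)).indicator g =O[𝓝[>] 0] h := by
  refine (isBigO_zero h _).congr' ?_ EventuallyEq.rfl
  filter_upwards [nhdsWithin_le_nhds (gt_mem_nhds one_pos)] with t ht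
  rw [indicator_of_notMem (by simpa using ht.le)]

/-- A factor `log t` is a derivative in `w`, here of the transform `-1/w` of the indicator. -/
theorem hasMellin_indicator_log {w : ℂ} (hw : w.re < 0) :
    HasMellin ((Ioi (1 : ℝ)).indicator fun t => (Real.log t : ℂ)) w (1 / w ^ 2) := by
  set f : ℝ → ℂ := (Ioi (1 : ℝ)).indicator fun t => ((t : ℂ) ^ 0)⁻¹ with hf
  have hcont : ContinuousOn (fun t : ℝ => ((t : ℂ) ^ 0)⁻¹) (Ioi 0) := by
    simp only [pow_zero, inv_one]
    exact continuousOn_const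
  obtain ⟨h1, h2⟩ := mellin_hasDerivAt_of_isBigO_rpow (a := 0) (b := w.re - 1) (f := f) (s := w)
    (locallyIntegrableOn_indicator_Ioi hcont) (by
      refine IsBigO.of_bound 1 (Eventually.of_forall fun t => ?_)
      rw [hf]
      refine (norm_indicator_le_norm_self _ _).trans ?_
      simp) (by simpa using hw) isBigO_indicator_Ioi_nhds_zero (by linarith)
  have heq : (fun t => Real.log t • f t) =
      (Ioi (1 : ℝ)).indicator fun t => (Real.log t : ℂ) := by
    ext t
    by_cases ht : t ∈ Ioi (1 : ℝ)
    · simp [hf, indicator_of_mem ht]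
    · simp only [hf, indicator_of_notMem ht, smul_zero]
  rw [heq] at h1 h2
  refine ⟨h1, ?_⟩
  have hw0 : w ≠ 0 := by
    rintro rfl
    simp at hw
  have hev : mellin f =ᶠ[𝓝 w] fun w => -w⁻¹ := by
    have : ∀ᶠ z : ℂ in 𝓝 w, z.re < 0 :=
      Complex.continuous_re.continuousAt.eventually_lt continuousAt_const hw
    filter_upwards [this] with z hz
    rw [(hasMellin_indicator_pow_inv 0 (by simpa using hz)).2]
    simp [inv_neg]
  have h3 := (hasDerivAt_inv hw0).neg.congr_of_eventuallyEq hev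
  rw [h2.unique h3]
  simp

end Indicator

section Continuation

open MeasureTheory Set

/-- Removing the cut-off terms up to order `N` leaves a function that is `O(t)` at `0` and
`O(t^(-N-1))` at infinity. Its transform at `1 - s` is holomorphic for `-N < Re s < 2`, and the
removed terms have the displayed fractions as transforms. -/
theorem exists_mellin_continuation {E : ℝ → ℂ} {A B : ℂ} {c : ℕ → ℂ}
    (hE : ContinuousOn E (Ioi 0)) (hE0 : E =O[𝓝[>] 0] fun t => t)
    (hexp : HasLogExpansion E A B c) :
    ∃ M : ℂ → ℂ, (∀ s : ℂ, 1 < s.re → s.re < 2 → M s = mellin E (1 - s)) ∧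
      ∀ N : ℕ, ∃ R : ℂ → ℂ, DifferentiableOn ℂ R {s | -(N : ℝ) < s.re ∧ s.re < 2} ∧
        ∀ s : ℂ, -(N : ℝ) < s.re → s.re < 2 →
          M s = R s + (A / (s - 1) ^ 2 + B / (s - 1) +
            ∑ j ∈ Finset.Icc 1 N, c j / (s + j - 1)) := by
  set p : ℕ → ℝ → ℂ := fun N t => A * (Real.log t : ℂ) + B +
    ∑ j ∈ Finset.Icc 1 N, c j * ((t : ℂ) ^ j)⁻¹ with hp
  set f : ℕ → ℝ → ℂ := fun N t => E t - (Ioi (1 : ℝ)).indicator (p N) t with hf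
  have hpc : ∀ N, ContinuousOn (p N) (Ioi 0) := by
    intro N t ht
    have ht : 0 < t := ht
    have ht' : (t : ℂ) ≠ 0 := by exact_mod_cast ht.ne'
    refine ContinuousAt.continuousWithinAt ?_
    have hlog : ContinuousAt (fun t : ℝ => (Real.log t : ℂ)) t :=
      Complex.continuous_ofReal.continuousAt.comp (Real.continuousAt_log ht.ne')
    refine ((hlog.const_mul A).add continuousAt_const).add ?_
    refine tendsto_finsetSum _ fun j _ => ?_
    have : ContinuousAt (fun t : ℝ => c j * ((t : ℂ) ^ j)⁻¹) t :=
      ContinuousAt.mul continuousAt_const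
        (ContinuousAt.inv₀ (by fun_prop) (pow_ne_zero _ ht'))
    exact this
  have hloc : ∀ N, LocallyIntegrableOn (f N) (Ioi 0) := fun N =>
    (hE.locallyIntegrableOn measurableSet_Ioi).sub (locallyIntegrableOn_indicator_Ioi (hpc N))
  have htop : ∀ N : ℕ, f N =O[atTop] fun t => t ^ (-((N : ℝ) + 1)) := by
    intro N
    refine (hexp N).congr' ?_ ?_
    · filter_upwards [eventually_gt_atTop 1] with t ht
      simp only [hf, hp]
      rw [indicator_of_mem (show t ∈ Ioi (1 : ℝ) from ht)]
    · filter_upwards [eventually_gt_atTop 0] with t ht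
      rw [Real.rpow_neg ht.le]
      exact_mod_cast congrArg _ (Real.rpow_natCast t (N + 1)).symm
  have hbot : ∀ N : ℕ, f N =O[𝓝[>] 0] fun t => t ^ (-(-1 : ℝ)) := by
    intro N
    simp only [neg_neg, Real.rpow_one]
    exact hE0.sub isBigO_indicator_Ioi_nhds_zero
  have hconv : ∀ (N : ℕ) (s : ℂ), -(N : ℝ) < s.re → s.re < 2 →
      MellinConvergent (f N) (1 - s) := fun N s h1 h2 =>
    mellinConvergent_of_isBigO_rpow (hloc N) (htop N)
      (by simp only [Complex.sub_re, Complex.one_re]; linarith) (hbot N)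
      (by simp only [Complex.sub_re, Complex.one_re]; linarith)
  have hdiff : ∀ (N : ℕ) (s : ℂ), -(N : ℝ) < s.re → s.re < 2 →
      DifferentiableAt ℂ (fun s => mellin (f N) (1 - s)) s := fun N s h1 h2 =>
    (mellin_differentiableAt_of_isBigO_rpow (s := 1 - s) (hloc N) (htop N)
      (by simp only [Complex.sub_re, Complex.one_re]; linarith) (hbot N)
      (by simp only [Complex.sub_re, Complex.one_re]; linarith)).comp s (by fun_prop)
  set Q : ℕ → ℂ → ℂ := fun N s => mellin (f N) (1 - s) + (A / (s - 1) ^ 2 + B / (s - 1) +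
    ∑ j ∈ Finset.Icc 1 N, c j / (s + j - 1)) with hQ
  have hstep : ∀ (N : ℕ) (s : ℂ), -(N : ℝ) < s.re → s.re < 2 → Q (N + 1) s = Q N s := by
    intro N s h1 h2
    have hind := hasMellin_indicator_pow_inv (N + 1) (w := 1 - s)
      (by simp only [Complex.sub_re, Complex.one_re]; push_cast; linarith)
    have hfN : f N = fun t => f (N + 1) t +
        c (N + 1) • (Ioi (1 : ℝ)).indicator (fun t => ((t : ℂ) ^ (N + 1))⁻¹) t := by
      ext t
      by_cases ht : t ∈ Ioi (1 : ℝ)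
      · simp only [hf, hp, indicator_of_mem ht, smul_eq_mul]
        rw [Finset.sum_Icc_succ_top (by omega)]
        ring
      · simp only [hf, indicator_of_notMem ht, smul_zero, add_zero]
    have h3 : mellin (f N) (1 - s) = mellin (f (N + 1)) (1 - s) + c (N + 1) / (s + N) := by
      have h4 := hasMellin_add (hconv (N + 1) s (by push_cast; linarith) h2)
        (hind.1.const_smul (c (N + 1)))
      rw [hfN, h4.2, mellin_const_smul, hind.2, smul_eq_mul, mul_one_div]
      congr 2
      push_cast
      ring
    simp only [hQ]
    rw [h3, Finset.sum_Icc_succ_top (by omega)]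
    push_cast
    rw [show s + ((N : ℂ) + 1) - 1 = s + N by ring]
    ring
  have hle : ∀ (N k : ℕ) (s : ℂ), -(N : ℝ) < s.re → s.re < 2 → Q (N + k) s = Q N s := by
    intro N k s h1 h2
    induction k with
    | zero => rfl
    | succ k ih =>
      rw [← ih, ← add_assoc]
      refine hstep (N + k) s ?_ h2
      push_cast
      have : (0 : ℝ) ≤ k := Nat.cast_nonneg k
      linarith
  -- At `s` the stage `N = ⌊|Re s|⌋ + 1` satisfies `-N < Re s`. All stages defined at `s` agree by
  -- `hle`, so the choice is immaterial.
  refine ⟨fun s => Q (⌊|s.re|⌋₊ + 1) s, fun s h1 h2 => ?_, fun N =>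
    ⟨fun s => mellin (f N) (1 - s), fun s hs => (hdiff N s hs.1 hs.2).differentiableWithinAt,
      fun s h1 h2 => ?_⟩⟩
  · have h0 := hle 0 (⌊|s.re|⌋₊ + 1) s (by push_cast; linarith) h2
    rw [zero_add] at h0
    simp only [h0]
    have hre : (1 - s).re < 0 := by simp only [Complex.sub_re, Complex.one_re]; linarith
    have hlog := hasMellin_indicator_log hre
    have hone := hasMellin_indicator_pow_inv 0 (w := 1 - s) (by simpa using h1)
    have hEf : E = fun t => f 0 t + (A • (Ioi (1 : ℝ)).indicator (fun t => (Real.log t : ℂ)) t +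
        B • (Ioi (1 : ℝ)).indicator (fun t => ((t : ℂ) ^ 0)⁻¹) t) := by
      ext t
      by_cases ht : t ∈ Ioi (1 : ℝ)
      · simp [hf, hp, indicator_of_mem ht]
      · simp [hf, hp, indicator_of_notMem ht]
    have h3 := hasMellin_add (hlog.1.const_smul A) (hone.1.const_smul B)
    have h4 := hasMellin_add (hconv 0 s (by push_cast; linarith) h2) h3.1
    rw [hEf, h4.2, h3.2, mellin_const_smul, mellin_const_smul, hlog.2, hone.2]
    simp only [hQ, smul_eq_mul]
    rw [show (1 - s) ^ 2 = (s - 1) ^ 2 by ring]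
    simp
    ring
  · have h3 : -((⌊|s.re|⌋₊ + 1 : ℕ) : ℝ) < s.re := by
      push_cast
      have := Nat.lt_floor_add_one |s.re|
      linarith [neg_abs_le s.re]
    have h4 := hle N (⌊|s.re|⌋₊ + 1) s h1 h2
    have h5 := hle (⌊|s.re|⌋₊ + 1) N s h3 h2
    simp only
    rw [← h5, add_comm, h4]

end Continuation

/-! ### Arithmetic of polar parts -/

/-- `F` has at `p` at most a double pole, with polar part `c₂ / (s - p) ^ 2 + c₁ / (s - p)`. -/
def PolarGerm (F : ℂ → ℂ) (p c₂ c₁ : ℂ) : Prop :=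
  ∃ R : ℂ → ℂ, AnalyticAt ℂ R p ∧
    F =ᶠ[𝓝[≠] p] fun s => c₂ / (s - p) ^ 2 + c₁ / (s - p) + R s

namespace PolarGerm

variable {F G : ℂ → ℂ} {p c₂ c₁ d₂ d₁ : ℂ}

theorem congr (hF : PolarGerm F p c₂ c₁) (h : G =ᶠ[𝓝[≠] p] F) : PolarGerm G p c₂ c₁ := by
  obtain ⟨R, hR, h'⟩ := hF
  exact ⟨R, hR, h.trans h'⟩

theorem of_analyticAt (hF : AnalyticAt ℂ F p) : PolarGerm F p 0 0 :=
  ⟨F, hF, Eventually.of_forall fun s => by simp⟩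

theorem add (hF : PolarGerm F p c₂ c₁) (hG : PolarGerm G p d₂ d₁) :
    PolarGerm (fun s => F s + G s) p (c₂ + d₂) (c₁ + d₁) := by
  obtain ⟨R, hR, h⟩ := hF
  obtain ⟨R', hR', h'⟩ := hG
  refine ⟨fun s => R s + R' s, hR.add hR', ?_⟩
  filter_upwards [h, h'] with s hs hs'
  rw [hs, hs']
  ring

theorem sum {ι : Type*} (t : Finset ι) {F : ι → ℂ → ℂ} {c₂ c₁ : ι → ℂ}
    (h : ∀ i ∈ t, PolarGerm (F i) p (c₂ i) (c₁ i)) :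
    PolarGerm (fun s => ∑ i ∈ t, F i s) p (∑ i ∈ t, c₂ i) (∑ i ∈ t, c₁ i) := by
  classical
  induction t using Finset.induction_on with
  | empty => simpa using of_analyticAt analyticAt_const
  | insert a t ha ih =>
    simp only [Finset.sum_insert ha]
    exact (h a (Finset.mem_insert_self a t)).add
      (ih fun i hi => h i (Finset.mem_insert_of_mem hi))

theorem _root_.AnalyticAt.exists_eq_add_mul {h : ℂ → ℂ} (hh : AnalyticAt ℂ h p) :
    ∃ k : ℂ → ℂ, AnalyticAt ℂ k p ∧ k p = deriv h p ∧ ∀ s, h s = h p + (s - p) * k s := by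
  refine ⟨dslope h p, ?_, dslope_same _ _, fun s => ?_⟩
  · obtain ⟨q, hq⟩ := hh
    exact ⟨_, hq.has_fpower_series_dslope_fslope⟩
  · have := sub_smul_dslope h p s
    rw [smul_eq_mul] at this
    rw [this]
    ring

/-- Only the first two Taylor coefficients of `h` matter; `deriv h p` feeds the double pole into the
residue. -/
theorem mul {h : ℂ → ℂ} (hF : PolarGerm F p c₂ c₁) (hh : AnalyticAt ℂ h p) :
    PolarGerm (fun s => h s * F s) p (h p * c₂) (h p * c₁ + deriv h p * c₂) := by
  obtain ⟨R, hR, hFR⟩ := hF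
  obtain ⟨k, hk, hk0, hhk⟩ := hh.exists_eq_add_mul
  obtain ⟨l, hl, -, hkl⟩ := hk.exists_eq_add_mul
  refine ⟨fun s => deriv h p * c₁ + l s * c₂ + l s * (s - p) * c₁ + h s * R s, by fun_prop, ?_⟩
  filter_upwards [hFR, self_mem_nhdsWithin] with s hs hsp
  have hsp' : s - p ≠ 0 := sub_ne_zero.2 hsp
  have h1 : h s = h p + (s - p) * (deriv h p + (s - p) * l s) := by
    rw [← hk0, ← hkl, ← hhk]
  rw [hs]
  generalize hR' : R s = r
  have h2 : h s * r = (h p + (s - p) * (deriv h p + (s - p) * l s)) * r := by rw [← h1]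
  rw [h2]
  nth_rewrite 1 [h1]
  field_simp
  ring

/-- A zero of the factor `h` cancels a simple pole. -/
theorem mul_of_eq_zero {h : ℂ → ℂ} (hF : PolarGerm F p 0 c₁) (hh : AnalyticAt ℂ h p)
    (h0 : h p = 0) : ∃ R : ℂ → ℂ, AnalyticAt ℂ R p ∧ R p = deriv h p * c₁ ∧
      (fun s => h s * F s) =ᶠ[𝓝[≠] p] R := by
  obtain ⟨R, hR, hFR⟩ := hF
  obtain ⟨k, hk, hk0, hhk⟩ := hh.exists_eq_add_mul
  refine ⟨fun s => k s * c₁ + h s * R s, by fun_prop, by simp [hk0, h0], ?_⟩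
  filter_upwards [hFR, self_mem_nhdsWithin] with s hs hsp
  have hsp' : s - p ≠ 0 := sub_ne_zero.2 hsp
  rw [hs]
  have h1 := hhk s
  rw [h0, zero_add] at h1
  rw [zero_div, zero_add, mul_add]
  congr 1
  rw [h1]
  field_simp

theorem comp_affine {a b p' : ℂ} (ha : a ≠ 0) (hp : a * p' + b = p) (hF : PolarGerm F p c₂ c₁) :
    PolarGerm (fun s => F (a * s + b)) p' (c₂ / a ^ 2) (c₁ / a) := by
  obtain ⟨R, hR, hFR⟩ := hF
  have ht : Tendsto (fun s => a * s + b) (𝓝[≠] p') (𝓝[≠] p) := by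
    refine tendsto_nhdsWithin_iff.2 ⟨?_, ?_⟩
    · have : Continuous fun s : ℂ => a * s + b := by fun_prop
      exact (this.tendsto' p' p hp).mono_left nhdsWithin_le_nhds
    · filter_upwards [self_mem_nhdsWithin] with s hs
      simp only [Set.mem_compl_iff, Set.mem_singleton_iff, ← hp]
      intro h
      exact hs (mul_left_cancel₀ ha (by linear_combination h))
  refine ⟨fun s => R (a * s + b), ?_, ?_⟩
  · rw [← hp] at hR
    exact hR.comp_of_eq (f := fun s => a * s + b) (by fun_prop) rfl
  · filter_upwards [ht.eventually hFR, self_mem_nhdsWithin] with s hs hsp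
    have hsp' : s - p' ≠ 0 := sub_ne_zero.2 hsp
    rw [hs, show a * s + b - p = a * (s - p') by rw [← hp]; ring]
    field_simp

theorem hasPolarPart (hF : PolarGerm F p c₂ c₁) : HasPolarPart F p c₂ c₁ := by
  obtain ⟨R, hR, hFR⟩ := hF
  have ht : Tendsto (fun ε => p + ε) (𝓝[≠] (0 : ℂ)) (𝓝[≠] p) := by
    refine tendsto_nhdsWithin_iff.2 ⟨?_, ?_⟩
    · have : Continuous fun s : ℂ => p + s := by fun_prop
      exact (this.tendsto' 0 p (by simp)).mono_left nhdsWithin_le_nhds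
    · filter_upwards [self_mem_nhdsWithin] with s hs
      simpa using hs
  have h1 : (fun ε => R (p + ε)) =O[𝓝[≠] (0 : ℂ)] fun _ => (1 : ℂ) :=
    Tendsto.isBigO_one ℂ (hR.continuousAt.tendsto.comp (ht.mono_right nhdsWithin_le_nhds))
  refine h1.congr' ?_ EventuallyEq.rfl
  filter_upwards [ht.eventually hFR] with ε hε
  rw [hε]
  simp

theorem meromorphicAt (hF : PolarGerm F p c₂ c₁) : MeromorphicAt F p := by
  obtain ⟨R, hR, hFR⟩ := hF
  refine MeromorphicAt.congr ?_ hFR.symm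
  have := hR.meromorphicAt
  fun_prop

end PolarGerm

/-- A formula containing quotients takes arbitrary values at its removable singularities, division
by zero being `0`. The normal form replaces them by limits, so that analyticity and values at such
points become meaningful. -/
theorem exists_normal_form {F : ℂ → ℂ} (hF : Meromorphic F) :
    ∃ G : ℂ → ℂ, Meromorphic G ∧ (∀ p, G =ᶠ[𝓝[≠] p] F) ∧
      ∀ p h, AnalyticAt ℂ h p → F =ᶠ[𝓝[≠] p] h → G =ᶠ[𝓝 p] h := by
  have hF' : MeromorphicOn F Set.univ := fun x _ => hF x
  have h1 : ∀ p, toMeromorphicNFOn F Set.univ =ᶠ[𝓝[≠] p] F := fun p =>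
    hF'.toMeromorphicNFOn_eq_self_on_nhdsNE (Set.mem_univ p)
  refine ⟨toMeromorphicNFOn F Set.univ, fun p => (hF p).congr (h1 p).symm, h1,
    fun p h hh hFh => ?_⟩
  exact ((meromorphicNFOn_toMeromorphicNFOn F Set.univ
    (Set.mem_univ p)).eventuallyEq_nhdsNE_iff_eventuallyEq_nhds hh.meromorphicNFAt).1
    ((h1 p).trans hFh)

/-! ### Continuation to the whole plane -/

section Continuation

variable {M : ℂ → ℂ} {A B : ℂ} {c : ℕ → ℂ}

/-- The conclusion of `exists_mellin_continuation`: `M` is meromorphic in `Re s < 2`, with a pole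
at most double at `1`, and poles at most simple at `0, -1, -2, …`. -/
def HasMellinPoles (M : ℂ → ℂ) (A B : ℂ) (c : ℕ → ℂ) : Prop :=
  ∀ N : ℕ, ∃ R : ℂ → ℂ, DifferentiableOn ℂ R {s | -(N : ℝ) < s.re ∧ s.re < 2} ∧
    ∀ s : ℂ, -(N : ℝ) < s.re → s.re < 2 →
      M s = R s + (A / (s - 1) ^ 2 + B / (s - 1) + ∑ j ∈ Finset.Icc 1 N, c j / (s + j - 1))

theorem strip_mem_nhds {N : ℕ} {p : ℂ} (h1 : -(N : ℝ) < p.re) (h2 : p.re < 2) :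
    {s : ℂ | -(N : ℝ) < s.re ∧ s.re < 2} ∈ 𝓝 p :=
  ((isOpen_lt continuous_const Complex.continuous_re).inter
    (isOpen_lt Complex.continuous_re continuous_const)).mem_nhds ⟨h1, h2⟩

theorem HasMellinPoles.polarGerm_one (h : HasMellinPoles M A B c) : PolarGerm M 1 A B := by
  obtain ⟨R, hR, hM⟩ := h 0
  have hm := strip_mem_nhds (N := 0) (p := 1) (by simp) (by simp)
  refine ⟨R, hR.analyticAt hm, ?_⟩
  filter_upwards [nhdsWithin_le_nhds hm] with s hs
  rw [hM s hs.1 hs.2]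
  simp
  ring

theorem analyticAt_polar_add_sum {p : ℂ} (hp : p - 1 ≠ 0) (t : Finset ℕ)
    (ht : ∀ i ∈ t, p + i - 1 ≠ 0) : AnalyticAt ℂ (fun s => A / (s - 1) ^ 2 + B / (s - 1) +
      ∑ i ∈ t, c i / (s + i - 1)) p := by
  have h1 : AnalyticAt ℂ (fun s => A / (s - 1) ^ 2) p := by
    fun_prop (disch := exact pow_ne_zero _ hp)
  have h2 : AnalyticAt ℂ (fun s => B / (s - 1)) p := by fun_prop (disch := exact hp)
  refine (h1.add h2).add (Finset.analyticAt_fun_sum _ fun i hi => ?_)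
  have := ht i hi
  fun_prop (disch := assumption)

theorem HasMellinPoles.polarGerm (h : HasMellinPoles M A B c) {j : ℕ} (hj : 1 ≤ j) :
    PolarGerm M (1 - j) 0 (c j) := by
  obtain ⟨R, hR, hM⟩ := h j
  have hj' : (1 : ℝ) ≤ j := by exact_mod_cast hj
  have hm := strip_mem_nhds (N := j) (p := 1 - j) (by simp) (by simp; linarith)
  have hj0 : (1 : ℂ) - j - 1 ≠ 0 := by
    rw [show (1 : ℂ) - j - 1 = -(j : ℂ) by ring, neg_ne_zero]
    exact_mod_cast (by omega : j ≠ 0)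
  refine ⟨fun s => R s + (A / (s - 1) ^ 2 + B / (s - 1) +
    ∑ i ∈ (Finset.Icc 1 j).erase j, c i / (s + i - 1)), ?_, ?_⟩
  · refine (hR.analyticAt hm).add (analyticAt_polar_add_sum hj0 _ fun i hi => ?_)
    rw [show (1 : ℂ) - j + i - 1 = i - j by ring, sub_ne_zero]
    exact_mod_cast (Finset.mem_erase.1 hi).1
  · filter_upwards [nhdsWithin_le_nhds hm] with s hs
    rw [hM s hs.1 hs.2, ← Finset.add_sum_erase _ _ (Finset.mem_Icc.2 ⟨hj, le_rfl⟩),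
      show s - (1 - (j : ℂ)) = s + j - 1 by ring]
    ring

theorem HasMellinPoles.analyticAt (h : HasMellinPoles M A B c) {p : ℂ} (h2 : p.re < 2)
    (h1 : ∀ j : ℕ, p ≠ 1 - j) : AnalyticAt ℂ M p := by
  obtain ⟨N, hN⟩ := exists_nat_gt (-p.re)
  obtain ⟨R, hR, hM⟩ := h N
  have hm := strip_mem_nhds (N := N) (p := p) (by linarith) h2
  have hp1 : p - 1 ≠ 0 := sub_ne_zero.2 (by simpa using h1 0)
  have : AnalyticAt ℂ (fun s => R s + (A / (s - 1) ^ 2 + B / (s - 1) +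
      ∑ j ∈ Finset.Icc 1 N, c j / (s + j - 1))) p := by
    refine (hR.analyticAt hm).add (analyticAt_polar_add_sum hp1 _ fun i _ h0 => h1 i ?_)
    linear_combination h0
  refine this.congr ?_
  filter_upwards [hm] with s hs
  rw [hM s hs.1 hs.2]

/-- The continuation of a function `D`, holomorphic in `Re s > 1`, that is the product of an
entire function `μ` and a Mellin transform in a strip. -/
theorem HasMellinPoles.exists_continuation (h : HasMellinPoles M A B c) {D μ : ℂ → ℂ}
    (hμ : Differentiable ℂ μ) (hD : DifferentiableOn ℂ D {s | 1 < s.re})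
    (hDM : ∀ s : ℂ, 1 < s.re → s.re < 2 → D s = μ s * M s) :
    ∃ F : ℂ → ℂ, Meromorphic F ∧ (∀ s : ℂ, 1 < s.re → F s = D s) ∧
      (∀ p : ℂ, (∀ j : ℕ, p = 1 - j → 1 ≤ j ∧ μ p = 0) → AnalyticAt ℂ F p) ∧
      PolarGerm F 1 (μ 1 * A) (μ 1 * B + deriv μ 1 * A) ∧
      (∀ j : ℕ, 1 ≤ j → PolarGerm F (1 - j) 0 (μ (1 - j) * c j)) ∧
      ∀ j : ℕ, 1 ≤ j → μ (1 - j) = 0 → F (1 - j) = deriv μ (1 - j) * c j := by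
  classical
  -- The two formulas agree in the strip `1 < Re s < 2`, so near each point one of them describes
  -- `F₀`.
  set F₀ : ℂ → ℂ := fun s => if 1 < s.re then D s else μ s * M s with hF₀
  have hright : ∀ p : ℂ, 1 < p.re → F₀ =ᶠ[𝓝 p] D := fun p hp => by
    filter_upwards [(isOpen_lt continuous_const Complex.continuous_re).mem_nhds hp] with s hs
    exact if_pos hs
  have hleft : ∀ p : ℂ, p.re < 2 → F₀ =ᶠ[𝓝 p] fun s => μ s * M s := fun p hp => by
    filter_upwards [(isOpen_lt Complex.continuous_re continuous_const).mem_nhds hp] with s hs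
    simp only [hF₀]
    split_ifs with h1
    · exact hDM s h1 hs
    · rfl
  have hDan : ∀ p : ℂ, 1 < p.re → AnalyticAt ℂ D p := fun p hp =>
    hD.analyticAt ((isOpen_lt continuous_const Complex.continuous_re).mem_nhds hp)
  have hMgerm : ∀ p : ℂ, p.re < 2 → MeromorphicAt M p := by
    intro p hp
    by_cases hex : ∃ j : ℕ, p = 1 - j
    · obtain ⟨j, rfl⟩ := hex
      rcases Nat.eq_zero_or_pos j with rfl | hj
      · simpa using h.polarGerm_one.meromorphicAt
      · exact (h.polarGerm hj).meromorphicAt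
    · push Not at hex
      exact (h.analyticAt hp hex).meromorphicAt
  have hF₀m : Meromorphic F₀ := by
    intro p
    rcases lt_or_ge 1 p.re with hp | hp
    · exact (hDan p hp).meromorphicAt.congr ((hright p hp).symm.filter_mono nhdsWithin_le_nhds)
    · exact ((hμ.analyticAt p).meromorphicAt.mul (hMgerm p (by linarith))).congr
        ((hleft p (by linarith)).symm.filter_mono nhdsWithin_le_nhds)
  obtain ⟨F, hFm, hFF₀, hFan⟩ := exists_normal_form hF₀m
  have hFM : ∀ p : ℂ, p.re < 2 → F =ᶠ[𝓝[≠] p] fun s => μ s * M s := fun p hp =>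
    (hFF₀ p).trans ((hleft p hp).filter_mono nhdsWithin_le_nhds)
  have hFD : ∀ p : ℂ, 1 < p.re → F =ᶠ[𝓝 p] D := fun p hp =>
    hFan p D (hDan p hp) ((hright p hp).filter_mono nhdsWithin_le_nhds)
  have hre : ∀ j : ℕ, ((1 : ℂ) - j).re < 2 := fun j => by
    simp only [Complex.sub_re, Complex.one_re, Complex.natCast_re]
    have : (0 : ℝ) ≤ j := Nat.cast_nonneg j
    linarith
  -- A zero of `μ` at `1 - j` cancels the simple pole of `M` and leaves the finite value `μ'(1 - j)
  -- c_j`.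
  have hzero : ∀ j : ℕ, 1 ≤ j → μ (1 - j) = 0 → ∃ R : ℂ → ℂ, AnalyticAt ℂ R (1 - j) ∧
      R (1 - j) = deriv μ (1 - j) * c j ∧ F =ᶠ[𝓝 (1 - (j : ℂ))] R := by
    intro j hj hμj
    obtain ⟨R, hR, hRv, hRe⟩ := (h.polarGerm hj).mul_of_eq_zero (hμ.analyticAt _) hμj
    exact ⟨R, hR, hRv, hFan _ R hR
      (((hleft _ (hre j)).filter_mono nhdsWithin_le_nhds).trans hRe)⟩
  refine ⟨F, hFm, fun s hs => (hFD s hs).eq_of_nhds, fun p hp => ?_, ?_, fun j hj => ?_,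
    fun j hj hμj => ?_⟩
  · by_cases hex : ∃ j : ℕ, p = 1 - j
    · obtain ⟨j, rfl⟩ := hex
      obtain ⟨hj, hμj⟩ := hp j rfl
      obtain ⟨R, hR, -, hRe⟩ := hzero j hj hμj
      exact hR.congr hRe.symm
    · push Not at hex
      rcases lt_or_ge 1 p.re with h1 | h1
      · exact (hDan p h1).congr (hFD p h1).symm
      · have hMp := (hμ.analyticAt p).mul (h.analyticAt (by linarith) hex)
        exact hMp.congr (hFan p _ hMp
          ((hleft p (by linarith)).filter_mono nhdsWithin_le_nhds)).symm
  · exact (h.polarGerm_one.mul (hμ.analyticAt 1)).congr (hFM 1 (by simp))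
  · have := ((h.polarGerm hj).mul (hμ.analyticAt _)).congr (hFM _ (hre j))
    simpa using this
  · obtain ⟨R, -, hRv, hRe⟩ := hzero j hj hμj
    rw [hRe.eq_of_nhds, hRv]

end Continuation

/-! ### Operations on asymptotic expansions -/

namespace HasLogExpansion

variable {E E' : ℝ → ℂ} {A B A' B' : ℂ} {c c' : ℕ → ℂ}

theorem congr (h : HasLogExpansion E A B c) (hE : E' =ᶠ[atTop] E) : HasLogExpansion E' A B c := by
  intro N
  refine (h N).congr' ?_ EventuallyEq.rfl
  filter_upwards [hE] with t ht
  rw [ht]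

theorem add (h : HasLogExpansion E A B c) (h' : HasLogExpansion E' A' B' c') :
    HasLogExpansion (fun t => E t + E' t) (A + A') (B + B') (fun j => c j + c' j) := by
  intro N
  refine ((h N).add (h' N)).congr_left fun t => ?_
  simp only [add_mul, Finset.sum_add_distrib]
  ring

theorem const_mul (h : HasLogExpansion E A B c) (k : ℂ) :
    HasLogExpansion (fun t => k * E t) (k * A) (k * B) (fun j => k * c j) := by
  intro N
  refine ((h N).const_mul_left k).congr_left fun t => ?_
  simp only [mul_assoc, ← Finset.mul_sum]
  ring

theorem const (k : ℂ) : HasLogExpansion (fun _ => k) 0 k (fun _ => 0) := by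
  intro N
  simpa using isBigO_zero _ _

theorem of_isBigO (h : ∀ N : ℕ, E =O[atTop] fun t : ℝ => (t ^ N)⁻¹) :
    HasLogExpansion E 0 0 (fun _ => 0) := by
  intro N
  simpa using h (N + 1)

/-- The geometric series with its exact remainder. It serves for the factor `(x - 1) ^ q`, whose
logarithmic derivative at `x = 1/2 + t` is `q / (t - 1/2)`. -/
theorem one_div_sub_half :
    HasLogExpansion (fun t => 1 / ((t : ℂ) - 1 / 2)) 0 0 (fun j => (1 / 2) ^ (j - 1)) := by
  intro N
  refine IsBigO.of_bound 2 ?_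
  filter_upwards [eventually_gt_atTop 1] with t ht
  have ht0 : (t : ℂ) ≠ 0 := by exact_mod_cast (by linarith : t ≠ 0)
  have ht1 : (t : ℂ) - 1 / 2 ≠ 0 := by
    intro h
    have h2 : ((t - 1 / 2 : ℝ) : ℂ) = 0 := by push_cast; exact h
    have : t - 1 / 2 = 0 := by exact_mod_cast h2
    linarith
  have hsum : ∀ N : ℕ, 1 / ((t : ℂ) - 1 / 2) -
      ∑ j ∈ Finset.Icc 1 N, (1 / 2 : ℂ) ^ (j - 1) * ((t : ℂ) ^ j)⁻¹ =
      (1 / 2) ^ N * ((t : ℂ) ^ N)⁻¹ * (1 / ((t : ℂ) - 1 / 2)) := by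
    intro N
    induction N with
    | zero => simp
    | succ N ih =>
      rw [Finset.sum_Icc_succ_top (by omega), ← sub_sub, ih, Nat.add_sub_cancel]
      have hu : 1 / ((t : ℂ) - 1 / 2) * (t - 1 / 2) = 1 := one_div_mul_cancel ht1
      have ht2 : (t : ℂ)⁻¹ * t = 1 := inv_mul_cancel₀ ht0
      generalize 1 / ((t : ℂ) - 1 / 2) = u at hu ⊢
      rw [pow_succ, pow_succ, mul_inv]
      linear_combination (1 / 2) ^ N * ((t : ℂ) ^ N)⁻¹ * (t : ℂ)⁻¹ * hu -
        (1 / 2) ^ N * ((t : ℂ) ^ N)⁻¹ * u * ht2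
  rw [zero_mul, zero_add, zero_add, hsum, norm_mul, norm_mul, norm_pow, norm_inv, norm_pow]
  have h3 : t / 2 ≤ ‖(t : ℂ) - 1 / 2‖ := by
    have h4 : (t : ℂ) - 1 / 2 = ((t - 1 / 2 : ℝ) : ℂ) := by push_cast; ring
    rw [h4, Complex.norm_real, Real.norm_of_nonneg (by linarith)]
    linarith
  have h5 : ‖(1 / 2 : ℂ)‖ ^ N ≤ 1 := pow_le_one₀ (norm_nonneg _) (by norm_num)
  rw [Complex.norm_real, Real.norm_of_nonneg (by linarith),
    norm_div (1 : ℂ) ((t : ℂ) - 1 / 2), norm_one,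
    Real.norm_of_nonneg (by positivity)]
  calc ‖(1 / 2 : ℂ)‖ ^ N * (t ^ N)⁻¹ * (1 / ‖(t : ℂ) - 1 / 2‖)
      ≤ 1 * (t ^ N)⁻¹ * (1 / (t / 2)) := by gcongr
    _ = 2 * (t ^ (N + 1))⁻¹ := by
        rw [pow_succ]
        field_simp

end HasLogExpansion

theorem isBigO_pow_inv_comp_half_add (N : ℕ) :
    (fun t : ℝ => ((1 / 2 + t) ^ N)⁻¹) =O[atTop] fun t : ℝ => (t ^ N)⁻¹ := by
  refine IsBigO.of_bound 1 ?_
  filter_upwards [eventually_gt_atTop 0] with t ht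
  rw [Real.norm_of_nonneg (by positivity), Real.norm_of_nonneg (by positivity), one_mul]
  gcongr
  linarith

theorem tendsto_half_add_atTop : Tendsto (fun t : ℝ => 1 / 2 + t) atTop atTop :=
  tendsto_atTop_add_const_left _ _ tendsto_id

/-! ### The Stirling expansion recentred at `1/2` -/

section Stirling

variable {G : ℂ → ℂ} {a₁ a₀ b₁ b₀ : ℂ} {a : ℕ → ℂ}

/-- This is the case `k = 1` of the hypothesis. The relation `exp g = G` makes `g'` the logarithmic
derivative for any branch, and `x (log x - 1)` has derivative exactly `log x`. -/
theorem HasStirlingExpansion.isBigO_logDeriv (h : HasStirlingExpansion G a₁ a₀ b₁ b₀ a)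
    (N : ℕ) : (fun x : ℝ => -logDeriv G x - (a₁ * (Real.log x : ℂ) + b₁ + a₀ * (x : ℂ)⁻¹ -
      ∑ n ∈ Finset.Icc 1 N, n * a n * ((x : ℂ) ^ (n + 1))⁻¹)) =O[atTop]
      fun x : ℝ => (x ^ (N + 2))⁻¹ := by
  obtain ⟨g, hg, hexp, hO⟩ := h
  refine (hO N 1).congr' ?_ EventuallyEq.rfl
  filter_upwards [eventually_gt_atTop 0] with x hx
  have hx0 : (x : ℂ) ≠ 0 := by exact_mod_cast hx.ne'
  have hopen : {z : ℂ | 0 < z.re} ∈ 𝓝 (x : ℂ) :=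
    (isOpen_lt continuous_const Complex.continuous_re).mem_nhds (by simpa using hx)
  have hgx : HasDerivAt g (deriv g x) x := (hg.differentiableAt hopen).hasDerivAt
  have hG : logDeriv G x = deriv g x := by
    have hGx : HasDerivAt G (Complex.exp (g x) * deriv g x) x := by
      refine hgx.cexp.congr_of_eventuallyEq ?_
      filter_upwards [hopen] with z hz using (hexp z hz).symm
    rw [logDeriv_apply, hGx.deriv, ← hexp x (by simpa using hx)]
    field_simp [Complex.exp_ne_zero]
  have hlog : HasDerivAt (fun x : ℝ => (Real.log x : ℂ)) ((x⁻¹ : ℝ) : ℂ) x :=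
    (Real.hasDerivAt_log hx.ne').ofReal_comp
  have hid : HasDerivAt (fun x : ℝ => (x : ℂ)) 1 x := by
    simpa using (hasDerivAt_id x).ofReal_comp
  have hpow : ∀ n ∈ Finset.Icc 1 N, HasDerivAt (fun x : ℝ => a n * ((x : ℂ) ^ n)⁻¹)
      (-(n * a n * ((x : ℂ) ^ (n + 1))⁻¹)) x := by
    intro n hn
    have hn1 : 1 ≤ n := (Finset.mem_Icc.1 hn).1
    have := ((hid.pow n).inv (pow_ne_zero n hx0)).const_mul (a n)
    convert! this using 1
    obtain ⟨k, rfl⟩ : ∃ k, n = k + 1 := ⟨n - 1, by omega⟩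
    simp only [Pi.pow_apply, Nat.add_sub_cancel]
    field_simp
    ring
  have hmain : HasDerivAt (fun x : ℝ => -g (x : ℂ) -
        (a₁ * x * ((Real.log x : ℂ) - 1) + b₁ * x + a₀ * (Real.log x : ℂ) + b₀ +
          ∑ n ∈ Finset.Icc 1 N, a n * ((x : ℂ) ^ n)⁻¹))
      (-deriv g x - (a₁ * 1 * ((Real.log x : ℂ) - 1) + a₁ * x * ((x⁻¹ : ℝ) : ℂ) + b₁ * 1 +
        a₀ * ((x⁻¹ : ℝ) : ℂ) + ∑ n ∈ Finset.Icc 1 N, -(n * a n * ((x : ℂ) ^ (n + 1))⁻¹))) x := by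
    refine hgx.comp_ofReal.neg.sub (((((((hid.const_mul a₁).mul (hlog.sub_const 1))).add
      (hid.const_mul b₁)).add (hlog.const_mul a₀)).add_const b₀).add
      (HasDerivAt.fun_sum hpow))
  rw [iteratedDeriv_one, hmain.deriv, hG, Finset.sum_neg_distrib]
  push_cast
  field_simp
  ring

/-- `-G'/G(1/2 + t)` minus its leading terms, as a function of `w = 1/t`, up to `O(w^{N+2})`. -/
noncomputable def stirlingRemainder (a₁ a₀ : ℂ) (a : ℕ → ℂ) (N : ℕ) (w : ℂ) : ℂ :=
  a₁ * Complex.log (1 + w / 2) + a₀ * (w / (1 + w / 2)) -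
    ∑ n ∈ Finset.Icc 1 N, n * a n * (w / (1 + w / 2)) ^ (n + 1)

theorem analyticAt_stirlingRemainder (N : ℕ) :
    AnalyticAt ℂ (stirlingRemainder a₁ a₀ a N) 0 := by
  have h1 : AnalyticAt ℂ (fun w : ℂ => Complex.log (1 + w / 2)) 0 := by
    refine AnalyticAt.clog (by fun_prop) (by simp)
  have h2 : AnalyticAt ℂ (fun w : ℂ => w / (1 + w / 2)) 0 := by
    fun_prop (disch := simp)
  have h3 : AnalyticAt ℂ (fun w : ℂ => ∑ n ∈ Finset.Icc 1 N,
      n * a n * (w / (1 + w / 2)) ^ (n + 1)) 0 :=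
    Finset.analyticAt_fun_sum _ fun n _ => analyticAt_const.mul (h2.pow _)
  exact ((analyticAt_const.mul h1).add (analyticAt_const.mul h2)).sub h3

/-- The additional term is divisible by `w ^ (N + 2)`, so lower Taylor coefficients do not depend on
the order of truncation. -/
theorem iteratedDeriv_stirlingRemainder_succ {N j : ℕ} (hj : j < N + 2) :
    iteratedDeriv j (stirlingRemainder a₁ a₀ a (N + 1)) 0 =
      iteratedDeriv j (stirlingRemainder a₁ a₀ a N) 0 := by
  rw [← sub_eq_zero, ← iteratedDeriv_fun_sub (analyticAt_stirlingRemainder _).contDiffAt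
    (analyticAt_stirlingRemainder _).contDiffAt]
  have han := (analyticAt_stirlingRemainder (a₁ := a₁) (a₀ := a₀) (a := a) (N + 1)).fun_sub
    (analyticAt_stirlingRemainder (a₁ := a₁) (a₀ := a₀) (a := a) N)
  refine (natCast_le_analyticOrderAt_iff_iteratedDeriv_eq_zero han).1 ?_ j hj
  rw [natCast_le_analyticOrderAt han]
  refine ⟨fun w => -((N + 1 : ℕ) * a (N + 1) * ((1 + w / 2)⁻¹) ^ (N + 2)), ?_, ?_⟩
  · fun_prop (disch := simp)
  · refine Eventually.of_forall fun w => ?_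
    simp only [stirlingRemainder]
    rw [Finset.sum_Icc_succ_top (by omega), sub_zero, smul_eq_mul]
    generalize 1 + w / 2 = k
    ring

/-- With `w = 1/t`, `log (1/2 + t) = log t + log (1 + w/2)` and `1/(1/2 + t) = w / (1 + w/2)`. Apart
from `a₁ log t + b₁`, each truncation is thus analytic in `w` at `0`, and the expansion is its
Taylor expansion. -/
theorem hasLogExpansion_neg_logDeriv (h : HasStirlingExpansion G a₁ a₀ b₁ b₀ a) :
    ∃ c : ℕ → ℂ, c 1 = a₁ / 2 + a₀ ∧
      HasLogExpansion (fun t => -logDeriv G (1 / 2 + t)) a₁ b₁ c := by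
  set d : ℕ → ℕ → ℂ := fun N j =>
    iteratedDeriv j (stirlingRemainder a₁ a₀ a N) 0 / (j.factorial : ℂ) with hd
  have hd_succ : ∀ N j, j < N + 2 → d (N + 1) j = d N j := fun N j hj => by
    simp only [hd]
    rw [iteratedDeriv_stirlingRemainder_succ hj]
  have hd_le : ∀ j k, d (j + k) j = d j j := by
    intro j k
    induction k with
    | zero => rfl
    | succ k ih => rw [← ih, ← add_assoc, hd_succ _ _ (by omega)]
  -- The coefficient of `t^(-j)` is read off at truncation order `j`; by `hd_le` every later order
  -- gives the same number.
  refine ⟨fun j => d j j, ?_, fun N => ?_⟩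
  · have h1 : HasDerivAt (stirlingRemainder a₁ a₀ a 0) (a₁ / 2 + a₀) 0 := by
      have h2 : HasDerivAt (fun w : ℂ => 1 + w / 2) (1 / 2) 0 := by
        simpa using ((hasDerivAt_id (0 : ℂ)).div_const 2).const_add 1
      have h3 := h2.clog (by simp)
      have h4 := (hasDerivAt_id (0 : ℂ)).div h2 (by simp)
      have h5 := (h3.const_mul a₁).add (h4.const_mul a₀)
      convert! h5 using 1
      · ext w
        simp [stirlingRemainder]
      · simp
        ring
    change d 1 1 = _
    rw [hd_succ 0 1 (by norm_num)]
    simp [hd, iteratedDeriv_one, h1.deriv]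
  · obtain ⟨F, hF, hFeq⟩ := (analyticAt_stirlingRemainder (a₁ := a₁) (a₀ := a₀) (a := a)
      N).exists_eq_sum_add_pow_mul (N + 1)
    have hinv : Tendsto (fun t : ℝ => (t : ℂ)⁻¹) atTop (𝓝 0) := by
      have := (Complex.continuous_ofReal.tendsto' 0 0 (by simp)).comp tendsto_inv_atTop_zero
      refine this.congr fun t => by simp
    have hFO : (fun t : ℝ => ((t : ℂ)⁻¹) ^ (N + 1) * F (t : ℂ)⁻¹) =O[atTop]
        fun t : ℝ => (t ^ (N + 1))⁻¹ := by
      have h1 : (fun t : ℝ => F (t : ℂ)⁻¹) =O[atTop] fun _ => (1 : ℝ) :=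
        (hF.continuousAt.tendsto.comp hinv).isBigO_one ℝ
      have h2 : (fun t : ℝ => ((t : ℂ)⁻¹) ^ (N + 1)) =O[atTop] fun t : ℝ => (t ^ (N + 1))⁻¹ := by
        refine IsBigO.of_norm_eventuallyLE ?_
        filter_upwards [eventually_gt_atTop 0] with t ht
        rw [norm_pow, norm_inv, Complex.norm_real, Real.norm_of_nonneg ht.le, inv_pow]
      simpa using h2.mul h1
    have hst : (fun t : ℝ => -logDeriv G (1 / 2 + t) - (a₁ * (Real.log (1 / 2 + t) : ℂ) + b₁ +
        a₀ * (1 / 2 + (t : ℂ))⁻¹ - ∑ n ∈ Finset.Icc 1 N, n * a n *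
          ((1 / 2 + (t : ℂ)) ^ (n + 1))⁻¹)) =O[atTop] fun t : ℝ => (t ^ (N + 1))⁻¹ := by
      have h1 := (h.isBigO_logDeriv N).comp_tendsto tendsto_half_add_atTop
      have h2 := h1.trans (isBigO_pow_inv_comp_half_add (N + 2))
      refine (h2.congr_left fun t => ?_).trans ?_
      · simp only [Function.comp]
        push_cast
        rfl
      · refine IsBigO.of_bound 1 ?_
        filter_upwards [eventually_ge_atTop 1] with t ht
        rw [Real.norm_of_nonneg (by positivity), Real.norm_of_nonneg (by positivity), one_mul]
        exact inv_anti₀ (by positivity) (pow_le_pow_right₀ ht (by omega))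
    refine (hst.add hFO).congr' ?_ EventuallyEq.rfl
    filter_upwards [eventually_gt_atTop 0] with t ht
    have ht0 : (t : ℂ) ≠ 0 := by exact_mod_cast ht.ne'
    have ht1 : (1 / 2 + (t : ℂ)) ≠ 0 := by
      have h4 : 1 / 2 + (t : ℂ) = ((1 / 2 + t : ℝ) : ℂ) := by push_cast; ring
      rw [h4]
      exact_mod_cast (by positivity : 1 / 2 + t ≠ 0)
    have hw : (t : ℂ)⁻¹ / (1 + (t : ℂ)⁻¹ / 2) = (1 / 2 + (t : ℂ))⁻¹ := by
      have : (1 + 2 * (t : ℂ)) ≠ 0 := by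
        intro h0
        apply ht1
        linear_combination h0 / 2
      field_simp
      ring
    have hlog : (Real.log (1 / 2 + t) : ℂ) =
        Real.log t + Complex.log (1 + (t : ℂ)⁻¹ / 2) := by
      have h4 : 1 + (t : ℂ)⁻¹ / 2 = ((1 + t⁻¹ / 2 : ℝ) : ℂ) := by push_cast; ring
      rw [h4, ← Complex.ofReal_log (by positivity), ← Complex.ofReal_add,
        ← Real.log_mul ht.ne' (by positivity)]
      congr 2
      field_simp
      ring
    have hsum : ∑ j ∈ Finset.Icc 1 N, d j j * ((t : ℂ) ^ j)⁻¹ =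
        ∑ i ∈ Finset.range (N + 1), ((t : ℂ)⁻¹ ^ i / i.factorial) •
          iteratedDeriv i (stirlingRemainder a₁ a₀ a N) 0 := by
      rw [Finset.sum_range_succ', ← Finset.Ico_add_one_right_eq_Icc,
        Finset.sum_Ico_eq_sum_range, Nat.add_sub_cancel]
      have h0 : iteratedDeriv 0 (stirlingRemainder a₁ a₀ a N) 0 = 0 := by
        simp [stirlingRemainder]
      rw [h0, smul_zero, add_zero]
      refine Finset.sum_congr rfl fun i hi => ?_
      rw [add_comm 1 i]
      generalize hj : i + 1 = j
      have hj' : j ≤ N := by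
        have := Finset.mem_range.1 hi
        omega
      obtain ⟨k, rfl⟩ := Nat.exists_eq_add_of_le hj'
      rw [← hd_le j k, smul_eq_mul, inv_pow]
      simp only [hd]
      ring
    have hFe := hFeq (t : ℂ)⁻¹
    rw [← hsum, smul_eq_mul] at hFe
    simp only [stirlingRemainder, hw] at hFe
    simp only [← inv_pow] at hFe ⊢
    rw [hlog]
    linear_combination -hFe

end Stirling

/-! ### The binomial expansion of `(w + y)^(-s)` and its remainder -/

theorem ringChoose_eq_prod_div (z : ℂ) (l : ℕ) :
    Ring.choose z l = (∏ j ∈ Finset.range l, (z - j)) / (l.factorial : ℂ) := by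
  have h : (descPochhammer ℤ l).smeval z = ∏ j ∈ Finset.range l, (z - j) := by
    rw [← descPochhammer_eval_eq_prod_range, ← descPochhammer_map (Int.castRingHom ℂ),
      Polynomial.eval_map, ← Polynomial.eval₂_smulOneHom_eq_smeval]
    congr 1
    exact Subsingleton.elim _ _
  rw [Ring.choose_eq_smul, h, smul_eq_mul]
  ring

theorem differentiable_ringChoose (l : ℕ) : Differentiable ℂ fun z : ℂ => Ring.choose z l := by
  simp only [ringChoose_eq_prod_div]
  fun_prop

/-- A majorant of the binomial coefficients `Ring.choose (-s) l`, `‖s‖ ≤ K`. -/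
noncomputable def chooseBound (K : ℝ) (l : ℕ) : ℝ :=
  (∏ j ∈ Finset.range l, (K + j)) / (l.factorial : ℝ)

theorem chooseBound_pos {K : ℝ} (hK : 0 < K) (l : ℕ) : 0 < chooseBound K l :=
  div_pos (Finset.prod_pos fun j _ => by positivity) (by positivity)

theorem norm_ringChoose_neg_le {s : ℂ} {K : ℝ} (hs : ‖s‖ ≤ K) (l : ℕ) :
    ‖Ring.choose (-s) l‖ ≤ chooseBound K l := by
  rw [ringChoose_eq_prod_div, norm_div, norm_prod, Complex.norm_natCast, chooseBound]
  gcongr with j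
  refine (norm_sub_le _ _).trans ?_
  rw [norm_neg, Complex.norm_natCast]
  gcongr

theorem summable_chooseBound {K ρ : ℝ} (hK : 0 < K) (hρ : 0 < ρ) (hρ1 : ρ < 1) (N : ℕ) :
    Summable fun l => chooseBound K (l + N) * ρ ^ l := by
  have h1 : Summable fun l => chooseBound K l * ρ ^ l := by
    refine summable_of_ratio_test_tendsto_lt_one hρ1
      (Eventually.of_forall fun l => (mul_pos (chooseBound_pos hK l) (by positivity)).ne') ?_
    have h2 : ∀ l : ℕ, ‖chooseBound K (l + 1) * ρ ^ (l + 1)‖ / ‖chooseBound K l * ρ ^ l‖ =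
        (1 + (K - 1) * (1 / ((l : ℝ) + 1))) * ρ := by
      intro l
      have h3 : 0 < ∏ j ∈ Finset.range l, (K + j) := Finset.prod_pos fun j _ => by positivity
      rw [Real.norm_of_nonneg (mul_pos (chooseBound_pos hK _) (by positivity)).le,
        Real.norm_of_nonneg (mul_pos (chooseBound_pos hK _) (by positivity)).le]
      simp only [chooseBound, Finset.prod_range_succ, Nat.factorial_succ, pow_succ]
      push_cast
      field_simp
      ring
    simp only [h2]
    have h4 := ((tendsto_one_div_add_atTop_nhds_zero_nat (𝕜 := ℝ)).const_mul (K - 1)).const_add 1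
    simpa using h4.mul_const ρ
  have h5 := ((summable_nat_add_iff N).2 h1).mul_right ((ρ ^ N)⁻¹)
  refine h5.congr fun l => ?_
  rw [pow_add]
  field_simp

theorem hasSum_one_add_cpow {z : ℂ} (hz : ‖z‖ < 1) (a : ℂ) :
    HasSum (fun l : ℕ => Ring.choose a l * z ^ l) ((1 + z) ^ a) := by
  have h := (Complex.one_add_cpow_hasFPowerSeriesOnBall_zero (a := a)).hasSum (y := z) (by
    rwa [Metric.mem_eball, edist_zero_right, ← ofReal_norm, ENNReal.ofReal_lt_one])
  rw [zero_add] at h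
  refine h.congr_fun fun l => ?_
  rw [binomialSeries_apply, smul_eq_mul]
  simp

/-- Both `w` and `1 + y/w` lie in the right half-plane, so their arguments add without leaving the
principal range. -/
theorem add_cpow_eq_mul {w y : ℂ} (hw : 0 < w.re) (hy : ‖y‖ < ‖w‖) (a : ℂ) :
    (w + y) ^ a = w ^ a * (1 + y / w) ^ a := by
  have hw0 : w ≠ 0 := by
    rintro rfl
    simp at hw
  have hη : ‖y / w‖ < 1 := by
    rw [norm_div, div_lt_one (norm_pos_iff.2 hw0)]
    exact hy
  have h1re : 0 < (1 + y / w).re := by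
    have := Complex.abs_re_le_norm (y / w)
    rw [Complex.add_re, Complex.one_re]
    linarith [neg_abs_le (y / w).re]
  have h10 : 1 + y / w ≠ 0 := by
    intro h0
    rw [h0] at h1re
    simp at h1re
  have hwy : w + y = w * (1 + y / w) := by field_simp
  have ha1 := abs_lt.1 (Complex.abs_arg_lt_pi_div_two_iff.2 (Or.inl hw))
  have ha2 := abs_lt.1 (Complex.abs_arg_lt_pi_div_two_iff.2 (Or.inl h1re))
  rw [hwy, Complex.cpow_def_of_ne_zero (mul_ne_zero hw0 h10), Complex.cpow_def_of_ne_zero hw0,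
    Complex.cpow_def_of_ne_zero h10, ← Complex.exp_add, ← add_mul,
    (Complex.log_mul_eq_add_log_iff hw0 h10).2 ⟨by linarith [ha1.1, ha2.1], by
      linarith [ha1.2, ha2.2]⟩]

/-- The remainder of order `N` in the expansion of `(w + y) ^ (-s)` in powers of `y`. -/
noncomputable def cpowRemainder (w y : ℂ) (N : ℕ) (s : ℂ) : ℂ :=
  (w + y) ^ (-s) - ∑ l ∈ Finset.range N, Ring.choose (-s) l * w ^ (-(s + l)) * y ^ l

theorem differentiable_cpowRemainder {w y : ℂ} (hw : w ≠ 0) (hwy : w + y ≠ 0) (N : ℕ) :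
    Differentiable ℂ (cpowRemainder w y N) := by
  have h1 : Differentiable ℂ fun s : ℂ => (w + y) ^ (-s) :=
    (differentiable_id.neg).const_cpow (Or.inl hwy)
  refine h1.sub (Differentiable.fun_sum fun l _ => ?_)
  have h2 : Differentiable ℂ fun s : ℂ => w ^ (-(s + (l : ℂ))) :=
    Differentiable.const_cpow (by fun_prop) (Or.inl hw)
  exact (((differentiable_ringChoose l).comp differentiable_id.neg).mul h2).mul_const _

theorem cpowRemainder_succ (w y : ℂ) (N : ℕ) (s : ℂ) :
    cpowRemainder w y N s = cpowRemainder w y (N + 1) s +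
      Ring.choose (-s) N * w ^ (-(s + N)) * y ^ N := by
  rw [cpowRemainder, cpowRemainder, Finset.sum_range_succ]
  ring

/-- At `s = -m` the power is a polynomial in `y` of degree `m < N`, already exhausted by the
subtracted terms. This yields the error `O(ε)` for `n ≥ 1` and keeps the remainder out of the finite
part at `0`. -/
theorem cpowRemainder_neg_natCast (w y : ℂ) {m N : ℕ} (hm : m < N) :
    cpowRemainder w y N (-(m : ℂ)) = 0 := by
  rw [cpowRemainder, neg_neg, Complex.cpow_natCast, add_comm w y, add_pow,
    sub_eq_zero]
  have h1 : Finset.range (m + 1) ⊆ Finset.range N := Finset.range_subset_range.2 hm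
  rw [← Finset.sum_subset h1 (fun l _ hl => ?_)]
  · refine Finset.sum_congr rfl fun l hl => ?_
    have hl' : l ≤ m := Nat.lt_succ_iff.1 (Finset.mem_range.1 hl)
    rw [Ring.choose_natCast, show -(-(m : ℂ) + l) = ((m - l : ℕ) : ℂ) by
      rw [Nat.cast_sub hl']; ring, Complex.cpow_natCast]
    ring
  · have hl' : m < l := by simpa [Nat.lt_succ_iff] using hl
    rw [Ring.choose_natCast, Nat.choose_eq_zero_of_lt hl']
    simp

theorem norm_cpow_neg_le {w : ℂ} (hw : w ≠ 0) {s : ℂ} {K : ℝ} (hs : ‖s‖ ≤ K) :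
    ‖w ^ (-s)‖ ≤ ‖w‖ ^ (-s.re) * Real.exp (Real.pi * K) := by
  rw [Complex.norm_cpow_of_ne_zero hw, div_eq_mul_inv, ← Real.exp_neg, Complex.neg_re,
    Complex.neg_im]
  gcongr
  calc -(Complex.arg w * -s.im) ≤ |Complex.arg w * s.im| := by
        rw [mul_neg, neg_neg]
        exact le_abs_self _
    _ = |Complex.arg w| * |s.im| := abs_mul _ _
    _ ≤ Real.pi * K := by
        gcongr
        · exact Complex.abs_arg_le_pi w
        · exact (Complex.abs_im_le_norm s).trans hs

theorem hasSum_cpowRemainder {w y : ℂ} (hw : 0 < w.re) (hy : ‖y‖ < ‖w‖) (N : ℕ) (s : ℂ) :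
    HasSum (fun l : ℕ => Ring.choose (-s) (l + N) * w ^ (-(s + (l + N : ℕ))) * y ^ (l + N))
      (cpowRemainder w y N s) := by
  have hw0 : w ≠ 0 := by
    rintro rfl
    simp at hw
  have hη : ‖y / w‖ < 1 := by
    rw [norm_div, div_lt_one (norm_pos_iff.2 hw0)]
    exact hy
  have h1 := (hasSum_one_add_cpow hη (-s)).mul_left (w ^ (-s))
  rw [← add_cpow_eq_mul hw hy] at h1
  have h2 : ∀ l : ℕ, w ^ (-s) * (Ring.choose (-s) l * (y / w) ^ l) =
      Ring.choose (-s) l * w ^ (-(s + l)) * y ^ l := by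
    intro l
    rw [neg_add, Complex.cpow_add _ _ hw0, Complex.cpow_neg w l, Complex.cpow_natCast, div_pow]
    ring
  simp only [h2] at h1
  exact (hasSum_nat_add_iff' N).2 h1

theorem norm_cpowRemainder_term_le {w y : ℂ} (hw0 : w ≠ 0) {ρ K : ℝ}
    (hy : ‖y‖ ≤ ρ * ‖w‖) {s : ℂ} (hs : ‖s‖ ≤ K) (hK : 0 < K) (N l : ℕ) :
    ‖Ring.choose (-s) (l + N) * w ^ (-(s + (l + N : ℕ))) * y ^ (l + N)‖ ≤
      ‖w‖ ^ (-(s.re + N)) * (Real.exp (Real.pi * K) * ‖y‖ ^ N) *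
        (chooseBound K (l + N) * ρ ^ l) := by
  have hpos : 0 < ‖w‖ := norm_pos_iff.2 hw0
  have h1 : w ^ (-(s + (l + N : ℕ))) * y ^ (l + N) =
      w ^ (-s) * ((w ^ N)⁻¹ * y ^ N * (y / w) ^ l) := by
    rw [neg_add, Complex.cpow_add _ _ hw0, Complex.cpow_neg w (l + N : ℕ), Complex.cpow_natCast,
      div_pow, pow_add, pow_add]
    field_simp
  have h2 : ‖w‖ ^ (-(s.re + N)) = ‖w‖ ^ (-s.re) * (‖w‖ ^ N)⁻¹ := by
    rw [neg_add, Real.rpow_add hpos, Real.rpow_neg hpos.le (N : ℝ), Real.rpow_natCast]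
  have h3 : ‖y / w‖ ≤ ρ := by
    rw [norm_div, div_le_iff₀ hpos]
    exact hy
  rw [mul_assoc, h1, norm_mul, norm_mul, norm_mul, norm_mul, norm_inv, norm_pow, norm_pow,
    norm_pow, h2]
  calc ‖Ring.choose (-s) (l + N)‖ * (‖w ^ (-s)‖ * ((‖w‖ ^ N)⁻¹ * ‖y‖ ^ N * ‖y / w‖ ^ l))
      ≤ chooseBound K (l + N) * ((‖w‖ ^ (-s.re) * Real.exp (Real.pi * K)) *
        ((‖w‖ ^ N)⁻¹ * ‖y‖ ^ N * ρ ^ l)) := by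
        gcongr
        · exact (chooseBound_pos hK _).le
        · exact norm_ringChoose_neg_le hs _
        · exact norm_cpow_neg_le hw0 hs
    _ = _ := by ring

theorem norm_cpowRemainder_le {w y : ℂ} (hw : 0 < w.re) {ρ K : ℝ} (hρ : 0 < ρ) (hρ1 : ρ < 1)
    (hy : ‖y‖ ≤ ρ * ‖w‖) {s : ℂ} (hs : ‖s‖ ≤ K) (hK : 0 < K) (N : ℕ) :
    ‖cpowRemainder w y N s‖ ≤ ‖w‖ ^ (-(s.re + N)) * (Real.exp (Real.pi * K) * ‖y‖ ^ N) *
      ∑' l, chooseBound K (l + N) * ρ ^ l := by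
  have hw0 : w ≠ 0 := by
    rintro rfl
    simp at hw
  have hpos : 0 < ‖w‖ := norm_pos_iff.2 hw0
  have hyw : ‖y‖ < ‖w‖ := hy.trans_lt (by nlinarith)
  rw [← (hasSum_cpowRemainder hw hyw N s).tsum_eq]
  exact tsum_of_norm_bounded ((summable_chooseBound hK hρ hρ1 N).hasSum.mul_left _)
    fun l => norm_cpowRemainder_term_le hw0 hy hs hK N l

/-! ### Zeta functions with a shifted parameter -/

section Shift

variable {ι : Type*} {w : ι → ℂ} {r₀ : ℝ}

theorem finite_norm_le_of_summable (hw : ∀ i, w i ≠ 0) {r : ℝ} (hr : 0 < r)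
    (h : Summable fun i => ‖w i‖ ^ (-r)) (R : ℝ) : {i | ‖w i‖ ≤ R}.Finite := by
  rcases le_or_gt R 0 with hR | hR
  · refine Set.finite_empty.subset fun i hi => ?_
    exact absurd (norm_pos_iff.2 (hw i)) (not_lt.2 (le_trans hi hR))
  · have h1 := h.tendsto_cofinite_zero.eventually (gt_mem_nhds (Real.rpow_pos_of_pos hR (-r)))
    refine Set.Finite.subset h1 fun i hi => ?_
    simp only [Set.mem_compl_iff, Set.mem_ofPred_eq, not_lt]
    exact Real.rpow_le_rpow_of_nonpos (norm_pos_iff.2 (hw i)) hi (by linarith)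

/-- Weierstrass' test near `s₀`. For all but finitely many `i` the remainder gains the factor `‖w i‖
^ (-N)`; the others are entire in `s` and are bounded on a compact disc. With `y = 0` and `N = 0`
this also covers the unshifted series. -/
theorem summable_and_analyticAt_cpowRemainder (hr₀ : 0 < r₀) (hw : ∀ i, w i ≠ 0)
    (hsum : ∀ r, r₀ < r → Summable fun i => ‖w i‖ ^ (-r)) (hre : ∀ᶠ i in cofinite, 0 < (w i).re)
    {y : ℂ} (hy : ∀ i, w i + y ≠ 0) {N : ℕ} {s₀ : ℂ} (hs₀ : r₀ < s₀.re + N) :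
    (Summable fun i => cpowRemainder (w i) y N s₀) ∧
      AnalyticAt ℂ (fun s => ∑' i, cpowRemainder (w i) y N s) s₀ := by
  classical
  obtain ⟨r, hr, hrs⟩ := exists_between hs₀
  set K : ℝ := ‖s₀‖ + 1 with hK
  have hK0 : 0 < K := by positivity
  set U : Set ℂ := Metric.ball 0 K ∩ {s | r < s.re + N} with hU
  have hUo : IsOpen U := Metric.isOpen_ball.inter
    (isOpen_lt continuous_const (Complex.continuous_re.add continuous_const))
  have hs₀U : s₀ ∈ U := ⟨by simp [hK], hrs⟩
  have hdiff : ∀ i, Differentiable ℂ (cpowRemainder (w i) y N) := fun i =>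
    differentiable_cpowRemainder (hw i) (hy i) N
  have hbdd : ∀ i, ∃ B, ∀ s ∈ Metric.closedBall (0 : ℂ) K, ‖cpowRemainder (w i) y N s‖ ≤ B :=
    fun i => (isCompact_closedBall 0 K).exists_bound_of_continuousOn
      (hdiff i).continuous.continuousOn
  choose B hB using hbdd
  set C : ℝ := Real.exp (Real.pi * K) * ‖y‖ ^ N * ∑' l, chooseBound K (l + N) * (1 / 2) ^ l
    with hC
  have hC0 : 0 ≤ C := mul_nonneg (by positivity)
    (tsum_nonneg fun l => mul_nonneg (chooseBound_pos hK0 _).le (by positivity))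
  set P : ι → Prop := fun i => 0 < (w i).re ∧ 1 ≤ ‖w i‖ ∧ ‖y‖ ≤ 1 / 2 * ‖w i‖ with hP
  have hPev : ∀ᶠ i in cofinite, P i := by
    have h1 := (finite_norm_le_of_summable hw (by linarith) (hsum r hr)
      (1 + 2 * ‖y‖)).compl_mem_cofinite
    filter_upwards [hre, h1] with i hi1 hi2
    have hi2 : 1 + 2 * ‖y‖ < ‖w i‖ := not_le.1 hi2
    exact ⟨hi1, by linarith [norm_nonneg y], by linarith⟩
  set u : ι → ℝ := fun i => if P i then C * ‖w i‖ ^ (-r) else B i with hu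
  have husum : Summable u := by
    have h1 := (hsum r hr).mul_left C
    refine (h1.congr_cofinite ?_)
    filter_upwards [hPev] with i hi
    simp only [hu, if_pos hi]
  have hle : ∀ i, ∀ s ∈ U, ‖cpowRemainder (w i) y N s‖ ≤ u i := by
    intro i s hs
    have hsK : ‖s‖ ≤ K := le_of_lt (by simpa using hs.1)
    by_cases hi : P i
    · simp only [hu, if_pos hi]
      refine (norm_cpowRemainder_le hi.1 (by norm_num) (by norm_num) hi.2.2 hsK hK0 N).trans ?_
      rw [mul_assoc, mul_comm C]
      refine mul_le_mul_of_nonneg_right ?_ hC0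
      have hsr : r < s.re + N := hs.2
      exact Real.rpow_le_rpow_of_exponent_le hi.2.1 (by linarith)
    · simp only [hu, if_neg hi]
      exact hB i s (by simpa using hsK)
  refine ⟨Summable.of_norm_bounded husum fun i => hle i s₀ hs₀U, ?_⟩
  exact (Complex.differentiableOn_tsum_of_summable_norm husum
    (fun i => (hdiff i).differentiableOn) hUo hle).analyticAt (hUo.mem_nhds hs₀U)

theorem cpowRemainder_zero (w y s : ℂ) : cpowRemainder w y 0 s = (w + y) ^ (-s) := by
  simp [cpowRemainder]

/-- Shifting the parameter of a zeta function `∑ w_i ^ (-s)`. -/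
theorem exists_shifted_zeta (hr₀ : 0 < r₀) (hw : ∀ i, w i ≠ 0)
    (hsum : ∀ r, r₀ < r → Summable fun i => ‖w i‖ ^ (-r)) (hre : ∀ᶠ i in cofinite, 0 < (w i).re)
    {Z : ℂ → ℂ} (hZ : ∀ s : ℂ, r₀ < s.re → HasSum (fun i => w i ^ (-s)) (Z s))
    {y : ℂ} (hy : ∀ i, w i + y ≠ 0) :
    ∃ H : ℂ → ℂ, (∀ s : ℂ, r₀ < s.re → HasSum (fun i => (w i + y) ^ (-s)) (H s)) ∧
      ∀ N : ℕ, ∀ s : ℂ, r₀ < s.re + N →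
        H s = (∑ l ∈ Finset.range N, Ring.choose (-s) l * Z (s + l) * y ^ l) +
          ∑' i, cpowRemainder (w i) y N s := by
  set Q : ℕ → ℂ → ℂ := fun N s =>
    (∑ l ∈ Finset.range N, Ring.choose (-s) l * Z (s + l) * y ^ l) +
      ∑' i, cpowRemainder (w i) y N s with hQ
  -- Going from `N` to `N + 1` takes the `N`-th binomial term out of each remainder. Summed over `i`
  -- it gives `C(-s, N) Z(s + N) y^N`, because `Re (s + N) > r₀`.
  have hstep : ∀ (N : ℕ) (s : ℂ), r₀ < s.re + N → Q (N + 1) s = Q N s := by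
    intro N s hs
    have h1 := (summable_and_analyticAt_cpowRemainder hr₀ hw hsum hre hy (N := N + 1) (s₀ := s)
      (by push_cast; linarith)).1
    have h2 := ((hZ (s + N) (by simpa using hs)).mul_left (Ring.choose (-s) N)).mul_right (y ^ N)
    have h3 := (h1.hasSum.add h2).tsum_eq
    simp only [← cpowRemainder_succ] at h3
    simp only [hQ]
    rw [Finset.sum_range_succ, h3]
    ring
  have hle : ∀ (N k : ℕ) (s : ℂ), r₀ < s.re + N → Q (N + k) s = Q N s := by
    intro N k s hs
    induction k with
    | zero => rfl
    | succ k ih =>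
      rw [← ih, ← add_assoc]
      refine hstep (N + k) s ?_
      push_cast
      have : (0 : ℝ) ≤ k := Nat.cast_nonneg k
      linarith
  have key : ∀ N : ℕ, ∀ s : ℂ, r₀ < s.re + N → Q (⌊|r₀ - s.re|⌋₊ + 1) s = Q N s := by
    intro N s hs
    have h3 : r₀ < s.re + (⌊|r₀ - s.re|⌋₊ + 1 : ℕ) := by
      push_cast
      have := Nat.lt_floor_add_one |r₀ - s.re|
      linarith [le_abs_self (r₀ - s.re)]
    rw [← hle _ N s h3, add_comm, hle N _ s hs]
  refine ⟨fun s => Q (⌊|r₀ - s.re|⌋₊ + 1) s, fun s hs => ?_, key⟩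
  simp only [key 0 s (by simpa using hs)]
  have h1 := (summable_and_analyticAt_cpowRemainder hr₀ hw hsum hre hy (N := 0) (s₀ := s)
    (by simpa using hs)).1.hasSum
  simpa only [hQ, cpowRemainder_zero, Finset.range_zero, Finset.sum_empty, zero_add] using h1

/-- Only finitely many `w i` satisfy `‖w i‖ ≤ 2‖y‖`, and the remaining ratios are below `1/2`; hence
the strict inequalities become uniform. -/
theorem exists_ratio_bound (hw : ∀ i, w i ≠ 0) (hfin : ∀ R : ℝ, {i | ‖w i‖ ≤ R}.Finite)
    {y : ℂ} (hyw : ∀ i, ‖y‖ < ‖w i‖) : ∃ ρ : ℝ, 0 < ρ ∧ ρ < 1 ∧ ∀ i, ‖y‖ ≤ ρ * ‖w i‖ := by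
  have h1 : ∀ᶠ ρ : ℝ in 𝓝[<] 1, ∀ i ∈ {i | ‖w i‖ ≤ 2 * ‖y‖}, ‖y‖ / ‖w i‖ < ρ := by
    refine (eventually_all_finite (hfin _)).2 fun i _ => nhdsWithin_le_nhds (lt_mem_nhds ?_)
    rw [div_lt_one (norm_pos_iff.2 (hw i))]
    exact hyw i
  have h2 : ∀ᶠ ρ : ℝ in 𝓝[<] 1, 1 / 2 < ρ := nhdsWithin_le_nhds (lt_mem_nhds (by norm_num))
  obtain ⟨ρ, h1, h2, h3⟩ := (h1.and (h2.and self_mem_nhdsWithin)).exists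
  refine ⟨ρ, by linarith, h3, fun i => ?_⟩
  have hpos := norm_pos_iff.2 (hw i)
  by_cases hi : ‖w i‖ ≤ 2 * ‖y‖
  · exact ((div_lt_iff₀ hpos).1 (h1 i hi)).le
  · nlinarith

/-- The expansion of a shifted zeta function in powers of the shift. -/
theorem hasSum_shifted_zeta (hr₀ : 0 < r₀) (hre : ∀ i, 0 < (w i).re)
    (hsum : ∀ r, r₀ < r → Summable fun i => ‖w i‖ ^ (-r))
    {Z : ℂ → ℂ} (hZ : ∀ s : ℂ, r₀ < s.re → HasSum (fun i => w i ^ (-s)) (Z s))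
    {y : ℂ} (hyw : ∀ i, ‖y‖ < ‖w i‖) {N : ℕ} {s : ℂ} (hs : r₀ < s.re + N) :
    HasSum (fun l : ℕ => Ring.choose (-s) l * Z (s + l) * y ^ l)
      ((∑ l ∈ Finset.range N, Ring.choose (-s) l * Z (s + l) * y ^ l) +
        ∑' i, cpowRemainder (w i) y N s) := by
  have hw : ∀ i, w i ≠ 0 := fun i h => by
    have := hre i
    rw [h] at this
    simp at this
  obtain ⟨ρ, hρ, hρ1, hyρ⟩ := exists_ratio_bound hw
    (finite_norm_le_of_summable hw (r := s.re + N) (by linarith) (hsum _ hs)) hyw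
  set K : ℝ := ‖s‖ + 1
  have hK : 0 < K := by positivity
  have hsK : ‖s‖ ≤ K := by simp [K]
  -- The double family of terms of index at least `N` is dominated by a product of two summable
  -- families. Summing it in both orders exchanges the series over `i` with the power series in `y`.
  set T : ι × ℕ → ℂ := fun p =>
    Ring.choose (-s) (p.2 + N) * w p.1 ^ (-(s + (p.2 + N : ℕ))) * y ^ (p.2 + N) with hT
  have hTs : Summable T := by
    have h1 := ((hsum _ hs).mul_right (Real.exp (Real.pi * K) * ‖y‖ ^ N)).mul_of_nonneg
      (summable_chooseBound hK hρ hρ1 N) (fun i => by positivity)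
      (fun l => mul_nonneg (chooseBound_pos hK _).le (by positivity))
    exact Summable.of_norm_bounded h1 fun p =>
      norm_cpowRemainder_term_le (hw p.1) (hyρ p.1) hsK hK N p.2
  have h1 : HasSum (fun i => cpowRemainder (w i) y N s) (∑' p, T p) :=
    hTs.hasSum.prod_fiberwise fun i => hasSum_cpowRemainder (hre i) (hyw i) N s
  have h2 : HasSum (fun l : ℕ => Ring.choose (-s) (l + N) * Z (s + (l + N : ℕ)) * y ^ (l + N))
      (∑' p, T p) := by
    have h3 : HasSum (fun p : ℕ × ι => T p.swap) (∑' p, T p) :=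
      (Equiv.prodComm ℕ ι).hasSum_iff.2 hTs.hasSum
    have h4 : ∀ l : ℕ, HasSum (fun i => T (i, l))
        (Ring.choose (-s) (l + N) * Z (s + (l + N : ℕ)) * y ^ (l + N)) := by
      intro l
      have hl : (0 : ℝ) ≤ l := Nat.cast_nonneg l
      have h5 : r₀ < (s + (l + N : ℕ)).re := by
        rw [Complex.add_re, Complex.natCast_re]
        push_cast
        linarith
      have h6 := ((hZ _ h5).mul_left (Ring.choose (-s) (l + N))).mul_right (y ^ (l + N))
      exact h6
    exact HasSum.prod_fiberwise (f := fun p : ℕ × ι => T p.swap) h3 h4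
  rw [h1.tsum_eq, add_comm]
  exact (hasSum_nat_add_iff N).1 h2

end Shift

/-! ### Logarithmic derivatives along the positive axis -/

section LogDeriv

variable {f : ℂ → ℂ}

theorem analyticAt_logDeriv (hf : Differentiable ℂ f) {z : ℂ} (hz : f z ≠ 0) :
    AnalyticAt ℂ (logDeriv f) z :=
  (hf.analyticAt z).deriv.div (hf.analyticAt z) hz

theorem continuousOn_logDeriv_ofReal (hf : Differentiable ℂ f)
    (hne : ∀ t : ℝ, 0 ≤ t → f t ≠ 0) (k : ℂ) :
    ContinuousOn (fun t : ℝ => logDeriv f t - k) (Set.Ioi 0) := by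
  intro t ht
  have ht : 0 < t := ht
  have h1 : ContinuousAt (fun t : ℝ => logDeriv f t) t :=
    (analyticAt_logDeriv hf (hne t ht.le)).continuousAt.comp (f := fun t : ℝ => (t : ℂ))
      Complex.continuous_ofReal.continuousAt
  exact (h1.sub continuousAt_const).continuousWithinAt

theorem isBigO_logDeriv_ofReal (hf : Differentiable ℂ f) (h0 : f 0 ≠ 0) :
    (fun t : ℝ => logDeriv f t - logDeriv f 0) =O[𝓝[>] 0] fun t => t := by
  have h1 := (analyticAt_logDeriv hf h0).differentiableAt.isBigO_sub
  have h2 : Tendsto (fun t : ℝ => (t : ℂ)) (𝓝[>] 0) (𝓝 0) :=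
    (Complex.continuous_ofReal.tendsto' 0 0 (by simp)).mono_left nhdsWithin_le_nhds
  refine (h1.comp_tendsto h2).trans ?_
  refine IsBigO.of_bound 1 (Eventually.of_forall fun t => ?_)
  simp

theorem logDeriv_comp_const_add (f : ℂ → ℂ) (a z : ℂ) :
    logDeriv (fun z => f (a + z)) z = logDeriv f (a + z) := by
  rw [logDeriv_apply, logDeriv_apply, deriv_comp_const_add]

theorem analyticOrderAt_comp_const_add (f : ℂ → ℂ) (a z : ℂ) :
    analyticOrderAt (fun z => f (a + z)) z = analyticOrderAt f (a + z) := by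
  have h : HasDerivAt (fun z => a + z) 1 z := (hasDerivAt_id z).const_add a
  exact analyticOrderAt_comp_of_deriv_ne_zero (f := f) (g := fun z => a + z) (by fun_prop)
    (by rw [h.deriv]; exact one_ne_zero)

end LogDeriv

theorem sin_pi_mul_ne_zero_of_re {s : ℂ} (h1 : 1 < s.re) (h2 : s.re < 2) :
    Complex.sin (Real.pi * s) ≠ 0 := by
  intro h
  obtain ⟨k, hk⟩ := Complex.sin_eq_zero_iff.1 h
  have hpi : (Real.pi : ℂ) ≠ 0 := by exact_mod_cast Real.pi_ne_zero
  have hs : s = k := mul_left_cancel₀ hpi (by rw [hk]; ring)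
  rw [hs, Complex.intCast_re] at h1 h2
  have h3 : (1 : ℤ) < k := by exact_mod_cast h1
  have h4 : k < (2 : ℤ) := by exact_mod_cast h2
  omega

/-! ### The zeta function over the zeros of `G` -/

section Shadow

variable {G : ℂ → ℂ}

/-- The zeros of `G`, repeated according to their multiplicities, and shifted by `-1/2`. -/
noncomputable def shiftedZeros (G : ℂ → ℂ) (i : Σ x : ℂ, Fin (analyticOrderNatAt G x)) : ℂ :=
  i.1 - 1 / 2

theorem enumeratesZeros_shiftedZeros (hG : Differentiable ℂ G) (h0 : G (1 / 2) ≠ 0) :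
    EnumeratesZeros (fun z => G (1 / 2 + z)) (shiftedZeros G) := by
  intro z
  rw [analyticOrderAt_comp_const_add]
  -- `analyticOrderNatAt` is `0` at infinite order, so the count is right only because `G` is not
  -- identically zero.
  have hne : analyticOrderAt G (1 / 2 + z) ≠ ⊤ := by
    refine AnalyticOnNhd.analyticOrderAt_ne_top_of_isPreconnected (U := Set.univ)
      (x := 1 / 2) (fun x _ => hG.analyticAt x) isPreconnected_univ trivial trivial ?_
    rw [(hG.analyticAt _).analyticOrderAt_eq_zero.2 h0]
    simp
  have hset : {i | shiftedZeros G i = z} =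
      Sigma.mk (1 / 2 + z) '' (Set.univ : Set (Fin (analyticOrderNatAt G (1 / 2 + z)))) := by
    ext ⟨x, k⟩
    simp only [shiftedZeros, Set.mem_ofPred_eq, Set.image_univ, Set.mem_range]
    constructor
    · intro h
      obtain rfl : x = 1 / 2 + z := by rw [← h]; ring
      exact ⟨k, rfl⟩
    · rintro ⟨k', h⟩
      have : 1 / 2 + z = x := congrArg Sigma.fst h
      rw [← this]
      ring
  rw [hset, Function.Injective.encard_image sigma_mk_injective, Set.encard_univ,
    ENat.card_eq_coe_fintype_card, Fintype.card_fin, Nat.cast_analyticOrderNatAt hne]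

theorem shiftedZeros_re (htriv : ∀ x : ℂ, G x = 0 → x.re ≤ 0)
    (i : Σ x : ℂ, Fin (analyticOrderNatAt G x)) : (shiftedZeros G i).re ≤ -(1 / 2) := by
  obtain ⟨x, k⟩ := i
  have hx : G x = 0 := apply_eq_zero_of_analyticOrderNatAt_ne_zero fun h => by
    rw [h] at k
    exact k.elim0
  simp only [shiftedZeros, Complex.sub_re]
  have := htriv x hx
  norm_num
  linarith

theorem half_mul_add_norm_le {ζ : ℂ} (hζ : ζ.re ≤ 0) {t : ℝ} (ht : 0 ≤ t) :
    1 / 2 * (t + ‖ζ‖) ≤ ‖(t : ℂ) - ζ‖ := by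
  have h1 : t ≤ ‖(t : ℂ) - ζ‖ := by
    have := Complex.re_le_norm ((t : ℂ) - ζ)
    simp only [Complex.sub_re, Complex.ofReal_re] at this
    linarith
  have h2 : ‖ζ‖ ≤ ‖(t : ℂ) - ζ‖ := by
    rw [← sq_le_sq₀ (norm_nonneg _) (norm_nonneg _), ← Complex.normSq_eq_norm_sq,
      ← Complex.normSq_eq_norm_sq, Complex.normSq_apply, Complex.normSq_apply]
    simp only [Complex.sub_re, Complex.ofReal_re, Complex.sub_im, Complex.ofReal_im]
    nlinarith
  linarith

theorem hasSum_shadowTerm {s S : ℂ}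
    (h : HasSum (fun i => (-shiftedZeros G i) ^ (-s)) S) :
    HasSum (fun z => shadowTerm G (1 / 2) z s) S := by
  refine h.sigma fun x => ?_
  have := hasSum_fintype fun k : Fin (analyticOrderNatAt G x) =>
    (-shiftedZeros G ⟨x, k⟩) ^ (-s)
  convert! this using 1
  simp [shadowTerm, shiftedZeros]

/-- The zeta function over the zeros of `G`. -/
theorem exists_shadow_zeta (hG : Differentiable ℂ G) (hgr : HasOrderOneGrowth G)
    (htriv : ∀ x : ℂ, G x = 0 → x.re ≤ 0) {A B : ℂ} {c : ℕ → ℂ}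
    (hexp : HasLogExpansion (fun t => -logDeriv G (1 / 2 + t)) A B c) :
    ∃ S : ℂ → ℂ, IsMeromorphicContinuation (shadowTerm G (1 / 2)) 1 S ∧
      (∀ s : ℂ, s ≠ 1 → AnalyticAt ℂ S s) ∧ ∀ j : ℕ, 1 ≤ j → S (1 - j) = (-1) ^ j * c j := by
  have h0 : G (1 / 2) ≠ 0 := fun h => by
    have := htriv _ h
    norm_num at this
  set f : ℂ → ℂ := fun z => G (1 / 2 + z) with hf
  have hfd : Differentiable ℂ f := hG.comp (by fun_prop)
  have hf0 : f 0 ≠ 0 := by simpa [hf] using h0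
  have hfgr : HasOrderOneGrowth f := hgr.comp_const_add _
  have hen := enumeratesZeros_shiftedZeros hG h0
  have hsec : ∀ i, ∀ t : ℝ, 0 ≤ t →
      1 / 2 * (t + ‖shiftedZeros G i‖) ≤ ‖(t : ℂ) - shiftedZeros G i‖ := fun i t ht =>
    half_mul_add_norm_le ((shiftedZeros_re htriv i).trans (by norm_num)) ht
  set E : ℝ → ℂ := fun t => logDeriv f t - logDeriv f 0 with hE
  have hexpE : HasLogExpansion E (-1 * A + 0) (-1 * B + -logDeriv f 0) (fun j => -1 * c j + 0) := by
    refine ((hexp.const_mul (-1)).add (HasLogExpansion.const (-logDeriv f 0))).congr ?_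
    refine Eventually.of_forall fun t => ?_
    simp only [hE, hf]
    rw [logDeriv_comp_const_add]
    ring
  obtain ⟨M, hM, hMp⟩ := exists_mellin_continuation
    (continuousOn_logDeriv_ofReal hfd
      (fun t ht => hen.apply_ofReal_ne_zero hfd hf0 one_half_pos hsec ht) _)
    (isBigO_logDeriv_ofReal hfd hf0) hexpE
  have hMp : HasMellinPoles M _ _ _ := hMp
  have hw : ∀ i, -shiftedZeros G i ≠ 0 := fun i => neg_ne_zero.2 (hen.ne_zero hfd hf0 i)
  have hsum : ∀ r : ℝ, 1 < r → Summable fun i => ‖-shiftedZeros G i‖ ^ (-r) := fun r hr => by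
    simpa only [norm_neg] using hen.summable_norm_rpow hfd hf0 hfgr hr
  have hD : ∀ s : ℂ, 1 < s.re → (Summable fun i => (-shiftedZeros G i) ^ (-s)) ∧
      AnalyticAt ℂ (fun s => ∑' i, (-shiftedZeros G i) ^ (-s)) s := by
    intro s hs
    have := summable_and_analyticAt_cpowRemainder one_pos hw hsum
      (Eventually.of_forall fun i => by
        have := shiftedZeros_re htriv i
        rw [Complex.neg_re]
        linarith) (y := 0) (by simpa using hw) (N := 0) (s₀ := s) (by simpa using hs)
    simpa only [cpowRemainder_zero, add_zero] using this
  -- This factor inverts `π / sin(πs)`. It vanishes at every integer and therefore cancels all the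
  -- poles at `1 - j`, `j ≥ 1`.
  set μ : ℂ → ℂ := fun s => Complex.sin (Real.pi * s) / Real.pi with hμ
  have hpi : (Real.pi : ℂ) ≠ 0 := by exact_mod_cast Real.pi_ne_zero
  have hμd : ∀ s, HasDerivAt μ (Complex.cos (Real.pi * s)) s := by
    intro s
    have h1 : HasDerivAt (fun s : ℂ => (Real.pi : ℂ) * s) Real.pi s := by
      simpa using (hasDerivAt_id s).const_mul (Real.pi : ℂ)
    have := h1.csin.div_const (Real.pi : ℂ)
    convert! this using 1
    field_simp
  have hμz : ∀ j : ℕ, μ (1 - j) = 0 := by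
    intro j
    simp only [hμ]
    rw [mul_sub, mul_one, Complex.sin_pi_sub, mul_comm, Complex.sin_nat_mul_pi, zero_div]
  obtain ⟨S, hSm, hSD, hSan, -, -, hSv⟩ := hMp.exists_continuation
    (D := fun s => ∑' i, (-shiftedZeros G i) ^ (-s)) (μ := μ)
    (fun s => (hμd s).differentiableAt)
    (fun s hs => (hD s hs).2.differentiableAt.differentiableWithinAt) (by
      intro s hs1 hs2
      have h1 := hen.hasSum_mellin_logDeriv hfd hf0 hfgr one_half_pos hsec hs1 hs2
      rw [hM s hs1 hs2, ← h1.tsum_eq, tsum_mul_right]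
      have h2 := sin_pi_mul_ne_zero_of_re hs1 hs2
      simp only [hμ]
      generalize Complex.sin (Real.pi * s) = σ at h2 ⊢
      field_simp)
  refine ⟨S, ⟨hSm, fun s hs => hasSum_shadowTerm ?_⟩, fun s hs => hSan s fun j hj => ?_,
    fun j hj => ?_⟩
  · rw [hSD s hs]
    exact (hD s hs).1.hasSum
  · refine ⟨?_, by rw [hj]; exact hμz j⟩
    rcases Nat.eq_zero_or_pos j with rfl | h
    · exact absurd (by simpa using hj) hs
    · exact h
  -- Two signs cancel: the expansion of `E` carries `-c_j`, and `μ'(1 - j) = cos(π(1 - j)) =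
  -- -(-1)^j`.
  · rw [hSv j hj (hμz j), (hμd _).deriv, mul_sub, mul_one, Complex.cos_pi_sub, mul_comm _ (j : ℂ),
      show (j : ℂ) * Real.pi = ((j * Real.pi : ℝ) : ℂ) by push_cast; ring,
      ← Complex.ofReal_cos, Real.cos_nat_mul_pi]
    push_cast
    ring

end Shadow

/-! ### The zeta function over the `τ k` -/

section Nontrivial

/-- As `Re τ > 0`, the arguments of `±iτ` are `arg τ ± π/2` with no jump, so the two powers differ
from `τ ^ a` by the phases `exp(±iπa/2)`. -/
theorem cpow_I_mul_add_cpow {τ : ℂ} (hτ : 0 < τ.re) (a : ℂ) :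
    (-(Complex.I * τ)) ^ a + (Complex.I * τ) ^ a = 2 * Complex.cos (Real.pi * a / 2) * τ ^ a := by
  have hτ0 : τ ≠ 0 := by
    rintro rfl
    simp at hτ
  have harg := abs_lt.1 (Complex.abs_arg_lt_pi_div_two_iff.2 (Or.inl hτ))
  have hpi := Real.pi_pos
  have h1 : Complex.log (Complex.I * τ) = Complex.log Complex.I + Complex.log τ := by
    rw [Complex.log_mul_eq_add_log_iff Complex.I_ne_zero hτ0, Complex.arg_I]
    exact ⟨by linarith [harg.1], by linarith [harg.2]⟩
  have h2 : Complex.log (-Complex.I * τ) = Complex.log (-Complex.I) + Complex.log τ := by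
    rw [Complex.log_mul_eq_add_log_iff (neg_ne_zero.2 Complex.I_ne_zero) hτ0, Complex.arg_neg_I]
    exact ⟨by linarith [harg.1], by linarith [harg.2]⟩
  rw [← neg_mul, Complex.cpow_def_of_ne_zero (mul_ne_zero (neg_ne_zero.2 Complex.I_ne_zero) hτ0),
    Complex.cpow_def_of_ne_zero (mul_ne_zero Complex.I_ne_zero hτ0),
    Complex.cpow_def_of_ne_zero hτ0, h1, h2, Complex.log_I, Complex.log_neg_I, Complex.two_cos,
    add_mul, add_mul, Complex.exp_add, Complex.exp_add, ← add_mul]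
  congr 1
  rw [add_comm]
  congr 2 <;> ring

variable {L G Ξ : ℂ → ℂ} {q : ℕ} {τ : ℕ → ℂ}

namespace IsPrimaryFunction

theorem abs_im_lt (h : IsPrimaryFunction L G Ξ q τ) (k : ℕ) : |(τ k).im| < 1 / 2 := by
  have h1 : Ξ (1 / 2 + Complex.I * τ k) = 0 := by
    apply apply_eq_zero_of_analyticOrderAt_ne_zero
    rw [h.zeros]
    have : {k' : ℕ | 1 / 2 + Complex.I * τ k' = 1 / 2 + Complex.I * τ k}.encard ≠ 0 :=
      Set.encard_ne_zero.2 ⟨k, rfl⟩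
    exact fun h0 => this (add_eq_zero.1 h0).1
  have h2 := h.strip _ h1
  simp only [Complex.add_re, Complex.mul_re, Complex.I_re, Complex.I_im, zero_mul, one_mul,
    zero_sub] at h2
  norm_num at h2
  rw [abs_lt]
  constructor <;> linarith [h2.1, h2.2]

theorem re_zero_le (h : IsPrimaryFunction L G Ξ q τ) (k : ℕ) : (τ 0).re ≤ (τ k).re :=
  h.τ_re_mono (Nat.zero_le k)

theorem ne_zero_τ (h : IsPrimaryFunction L G Ξ q τ) (k : ℕ) : τ k ≠ 0 := fun h0 => by
  have := h.τ_re_pos k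
  rw [h0] at this
  simp at this

theorem Ξ_ne_zero (h : IsPrimaryFunction L G Ξ q τ) {x : ℂ} (hx : x.im = 0) : Ξ x ≠ 0 := by
  intro h0
  have h1 : analyticOrderAt Ξ x ≠ 0 := analyticOrderAt_ne_zero.2 ⟨h.order_Ξ.1.analyticAt x, h0⟩
  rw [h.zeros] at h1
  have h2 : {k : ℕ | 1 / 2 + Complex.I * τ k = x}.encard ≠ 0 ∨
      {k : ℕ | 1 / 2 - Complex.I * τ k = x}.encard ≠ 0 := by
    by_contra! hcon
    rw [hcon.1, hcon.2] at h1
    simp at h1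
  rcases h2 with h2 | h2 <;> obtain ⟨k, hk⟩ := Set.encard_ne_zero.1 h2 <;>
  · have h3 := congrArg Complex.im (Set.mem_ofPred_eq ▸ hk)
    have h4 := h.τ_re_pos k
    simp [hx] at h3
    linarith

/-- The zeros of `Ξ (1/2 + ·)`. -/
def centeredZeros (τ : ℕ → ℂ) : ℕ ⊕ ℕ → ℂ :=
  Sum.elim (fun k => Complex.I * τ k) fun k => -(Complex.I * τ k)

theorem enumeratesZeros (h : IsPrimaryFunction L G Ξ q τ) :
    EnumeratesZeros (fun z => Ξ (1 / 2 + z)) (centeredZeros τ) := by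
  intro z
  rw [analyticOrderAt_comp_const_add, h.zeros]
  have hset : {i | centeredZeros τ i = z} = Sum.inl '' {k : ℕ | 1 / 2 + Complex.I * τ k = 1 / 2 + z} ∪
      Sum.inr '' {k : ℕ | 1 / 2 - Complex.I * τ k = 1 / 2 + z} := by
    ext i
    rcases i with k | k
    · simp [centeredZeros]
    · simp [centeredZeros, sub_eq_add_neg]
  rw [hset, Set.encard_union_eq, Sum.inl_injective.encard_image, Sum.inr_injective.encard_image]
  rw [Set.disjoint_left]
  rintro _ ⟨a, -, rfl⟩ ⟨b, -, hb⟩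
  exact Sum.inr_ne_inl hb

/-- The zeros `±iτ_k` have imaginary part at least `δ = Re τ_0` in modulus, while `‖τ_k‖ ≤ Re τ_k +
1/2`. If `D` is the distance to `t`, then `t + ‖τ_k‖ ≤ D + 2‖τ_k‖ ≤ 3D + 1 ≤ (3 + 1/δ) D`. -/
theorem exists_sector (h : IsPrimaryFunction L G Ξ q τ) :
    ∃ c > 0, ∀ i, ∀ t : ℝ, 0 ≤ t → c * (t + ‖centeredZeros τ i‖) ≤ ‖(t : ℂ) - centeredZeros τ i‖ := by
  have hδ := h.τ_re_pos 0
  set δ := (τ 0).re with hδ_def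
  have hnorm : ∀ i, ∃ k, ‖centeredZeros τ i‖ = ‖τ k‖ ∧ |(centeredZeros τ i).im| = (τ k).re := by
    rintro (k | k) <;> refine ⟨k, ?_, ?_⟩ <;> simp [centeredZeros, abs_of_pos (h.τ_re_pos k)]
  refine ⟨(3 + 1 / δ)⁻¹, by positivity, fun i t ht => ?_⟩
  obtain ⟨k, hk1, hk2⟩ := hnorm i
  rw [inv_mul_le_iff₀ (by positivity), hk1]
  have h1 : (τ k).re ≤ ‖(t : ℂ) - centeredZeros τ i‖ := by
    rw [← hk2]
    simpa using Complex.abs_im_le_norm ((t : ℂ) - centeredZeros τ i)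
  have h2 : t ≤ ‖(t : ℂ) - centeredZeros τ i‖ + ‖τ k‖ := by
    have := norm_add_le ((t : ℂ) - centeredZeros τ i) (centeredZeros τ i)
    rw [hk1, sub_add_cancel, Complex.norm_real, Real.norm_of_nonneg ht] at this
    exact this
  have h3 : ‖τ k‖ ≤ (τ k).re + 1 / 2 := by
    have := Complex.norm_le_abs_re_add_abs_im (τ k)
    rw [abs_of_pos (h.τ_re_pos k)] at this
    linarith [h.abs_im_lt k]
  have h4 : 1 ≤ 1 / δ * ‖(t : ℂ) - centeredZeros τ i‖ := by
    rw [one_div_mul_eq_div, le_div_iff₀ hδ, one_mul]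
    exact (h.re_zero_le k).trans h1
  linarith

theorem entire_zeros (h : IsPrimaryFunction L G Ξ q τ) :
    Differentiable ℂ (fun z => Ξ (1 / 2 + z)) ∧ HasOrderOneGrowth (fun z => Ξ (1 / 2 + z)) ∧
      Ξ (1 / 2 + 0) ≠ 0 :=
  ⟨h.order_Ξ.1.comp (by fun_prop), h.order_Ξ.hasOrderOneGrowth.comp_const_add _,
    h.Ξ_ne_zero (by simp)⟩

theorem summable_τ (h : IsPrimaryFunction L G Ξ q τ) {r : ℝ} (hr : 1 < r) :
    Summable fun k => ‖τ k‖ ^ (-r) := by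
  obtain ⟨hd, hgr, h0⟩ := h.entire_zeros
  have := (h.enumeratesZeros.summable_norm_rpow hd h0 hgr hr).comp_injective Sum.inl_injective
  refine this.congr fun k => ?_
  simp [centeredZeros]

/-- `Ξ (1/2 + z)` is even. Hence subtracting the value at `0` does not alter the constant `B` of the
expansion. -/
theorem logDeriv_Ξ_half (h : IsPrimaryFunction L G Ξ q τ) :
    logDeriv (fun z => Ξ (1 / 2 + z)) 0 = 0 := by
  have h1 : ∀ z : ℂ, Ξ (1 / 2 + z) = Ξ (1 / 2 + -z) := fun z => by
    rw [h.symmetry]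
    congr 1
    ring
  have h2 : deriv (fun z => Ξ (1 / 2 + z)) 0 = -deriv (fun z => Ξ (1 / 2 + z)) 0 := by
    conv_lhs => rw [funext h1]
    have := deriv_comp_neg (fun z => Ξ (1 / 2 + z)) 0
    simpa using this
  rw [logDeriv_apply, self_eq_neg.1 h2, zero_div]

theorem exp_decay (h : IsPrimaryFunction L G Ξ q τ) (N : ℕ) :
    (fun x : ℝ => logDeriv L x) =O[atTop] fun x : ℝ => (x ^ N)⁻¹ := by
  refine (h.log_decay 1 N).congr' ?_ EventuallyEq.rfl
  -- The decay of `log L` forces `L → 1`, so `L` eventually stays in the slit plane and the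
  -- principal logarithm has derivative `L'/L`.
  have h1 : Tendsto (fun x : ℝ => Complex.log (L x)) atTop (𝓝 0) := by
    have h2 := h.log_decay 0 1
    simp only [iteratedDeriv_zero, pow_one] at h2
    exact h2.trans_tendsto tendsto_inv_atTop_zero
  have h3 : Tendsto (fun x : ℝ => L x) atTop (𝓝 1) := by
    have h4 := (Complex.continuous_exp.tendsto' 0 1 Complex.exp_zero).comp h1
    refine h4.congr' ?_
    filter_upwards [eventually_gt_atTop 1] with x hx
    exact Complex.exp_log (h.ne_zero x (by simpa using hx))
  filter_upwards [h3.eventually (Complex.isOpen_slitPlane.mem_nhds Complex.one_mem_slitPlane),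
    eventually_gt_atTop 1] with x hx hx1
  have hLx : HasDerivAt L (deriv L x) x := (h.analyticAt x (by
    exact_mod_cast hx1.ne')).differentiableAt.hasDerivAt
  rw [iteratedDeriv_one, (hLx.clog hx).comp_ofReal.deriv, logDeriv_apply]

theorem logDeriv_eq (h : IsPrimaryFunction L G Ξ q τ) {x : ℝ} (hx : 1 < x) :
    logDeriv Ξ x = -logDeriv G x + (q * (1 / ((x : ℂ) - 1)) + logDeriv L x) := by
  have hx1 : (x : ℂ) ≠ 1 := by exact_mod_cast hx.ne'
  have hxs : (x : ℂ) - 1 ≠ 0 := sub_ne_zero.2 hx1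
  have hL0 : L x ≠ 0 := h.ne_zero x (by simpa using hx)
  have hG0 : G x ≠ 0 := fun h0 => by
    have := h.trivial_zeros _ h0
    rw [Complex.ofReal_re] at this
    linarith
  have hΞ0 : Ξ x ≠ 0 := h.Ξ_ne_zero (by simp)
  have h1 : logDeriv (fun z => G z * Ξ z) x = logDeriv (fun z => (z - 1) ^ q * L z) x := by
    have he : (fun z => G z * Ξ z) =ᶠ[𝓝 (x : ℂ)] fun z => (z - 1) ^ q * L z := by
      filter_upwards [isOpen_ne.mem_nhds hx1] with z hz using h.factorization z hz
    rw [logDeriv_apply, logDeriv_apply, he.deriv_eq, he.eq_of_nhds]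
  rw [logDeriv_mul (x : ℂ) hG0 hΞ0 (h.order_G.1 _) (h.order_Ξ.1 _),
    logDeriv_mul (f := fun z : ℂ => (z - 1) ^ q) (x : ℂ) (pow_ne_zero q hxs) hL0 (by fun_prop)
      (h.analyticAt x hx1).differentiableAt,
    logDeriv_fun_pow (by fun_prop)] at h1
  have h2 : logDeriv (fun z : ℂ => z - 1) x = 1 / ((x : ℂ) - 1) := by
    rw [logDeriv_apply, deriv_sub_const, deriv_id'']
  rw [h2] at h1
  linear_combination h1

theorem hasLogExpansion (h : IsPrimaryFunction L G Ξ q τ) {A B : ℂ} {c : ℕ → ℂ}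
    (hexp : HasLogExpansion (fun t => -logDeriv G (1 / 2 + t)) A B c) :
    HasLogExpansion (fun t => logDeriv Ξ (1 / 2 + t)) A B
      (fun j => c j + q * (1 / 2) ^ (j - 1)) := by
  have h1 : HasLogExpansion (fun t : ℝ => logDeriv L ((1 / 2 + t : ℝ) : ℂ)) 0 0 fun _ => 0 :=
    HasLogExpansion.of_isBigO fun N =>
      ((h.exp_decay N).comp_tendsto tendsto_half_add_atTop).trans (isBigO_pow_inv_comp_half_add N)
  have h2 := hexp.add ((HasLogExpansion.one_div_sub_half.const_mul (q : ℂ)).add h1)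
  simp only [mul_zero, add_zero] at h2
  refine h2.congr ?_
  filter_upwards [eventually_gt_atTop 1] with t ht
  have h3 := h.logDeriv_eq (x := 1 / 2 + t) (by linarith)
  push_cast at h3 ⊢
  rw [h3]
  ring_nf

theorem hasSum_neg_zeros_cpow (hτ : ∀ k, 0 < (τ k).re) {s T : ℂ}
    (hs : Summable fun i => (-centeredZeros τ i) ^ (-s)) (hT : HasSum (fun k => τ k ^ (-s)) T) :
    HasSum (fun i => (-centeredZeros τ i) ^ (-s)) (T * (2 * Complex.cos (Real.pi * s / 2))) := by
  have hl : Summable fun k => (-(Complex.I * τ k)) ^ (-s) := by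
    have := hs.comp_injective Sum.inl_injective
    simpa only [centeredZeros, Function.comp_def, Sum.elim_inl] using this
  have hr : Summable fun k => (Complex.I * τ k) ^ (-s) := by
    have := hs.comp_injective Sum.inr_injective
    simpa only [centeredZeros, Function.comp_def, Sum.elim_inr, neg_neg] using this
  have h2 : (fun k => (-(Complex.I * τ k)) ^ (-s) + (Complex.I * τ k) ^ (-s)) =
      fun k => τ k ^ (-s) * (2 * Complex.cos (Real.pi * s / 2)) := by
    funext k
    rw [cpow_I_mul_add_cpow (hτ k), mul_neg, neg_div, Complex.cos_neg, mul_comm]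
  have h3 := hl.hasSum.add hr.hasSum
  rw [h2] at h3
  rw [← h3.unique (hT.mul_right _)]
  refine HasSum.sum ?_ ?_
  · simpa only [centeredZeros, Function.comp_def, Sum.elim_inl] using hl.hasSum
  · simpa only [centeredZeros, Function.comp_def, Sum.elim_inr, neg_neg] using hr.hasSum

/-- The zeta function over the `τ k`. -/
theorem exists_zeta (h : IsPrimaryFunction L G Ξ q τ) {A B : ℂ} {c : ℕ → ℂ}
    (hexp : HasLogExpansion (fun t => -logDeriv G (1 / 2 + t)) A B c) :
    ∃ Z : ℂ → ℂ, Meromorphic Z ∧ (∀ s : ℂ, 1 < s.re → HasSum (fun k => τ k ^ (-s)) (Z s)) ∧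
      (∀ s : ℂ, (∀ m : ℕ, s ≠ 1 - 2 * m) → AnalyticAt ℂ Z s) ∧
      PolarGerm Z 1 (A / Real.pi) (B / Real.pi) ∧
      (∀ j : ℕ, 1 ≤ j → PolarGerm Z (1 - j) 0
        (Complex.sin (Real.pi * (1 - j) / 2) / Real.pi * (c j + q * (1 / 2) ^ (j - 1)))) ∧
      Z 0 = (c 1 + q) / 2 := by
  obtain ⟨hfd, hfgr, hf0⟩ := h.entire_zeros
  obtain ⟨κ, hκ, hsec⟩ := h.exists_sector
  have hen := h.enumeratesZeros
  have hpi : (Real.pi : ℂ) ≠ 0 := by exact_mod_cast Real.pi_ne_zero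
  have hmel : ∀ s : ℂ, 1 < s.re → s.re < 2 → _ := fun s hs1 hs2 =>
    hen.hasSum_mellin_logDeriv hfd hf0 hfgr hκ hsec hs1 hs2
  have hcont := continuousOn_logDeriv_ofReal hfd
    (fun t ht => hen.apply_ofReal_ne_zero hfd hf0 hκ hsec ht) (logDeriv (fun z => Ξ (1 / 2 + z)) 0)
  have hbig := isBigO_logDeriv_ofReal hfd hf0
  have hexpE : HasLogExpansion (fun t : ℝ => logDeriv (fun z => Ξ (1 / 2 + z)) t -
      logDeriv (fun z => Ξ (1 / 2 + z)) 0) A B (fun j => c j + q * (1 / 2) ^ (j - 1)) := by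
    refine (h.hasLogExpansion hexp).congr (Eventually.of_forall fun t => ?_)
    simp only
    rw [h.logDeriv_Ξ_half, sub_zero, logDeriv_comp_const_add]
  obtain ⟨M, hM, hMp⟩ := exists_mellin_continuation hcont hbig hexpE
  have hMp : HasMellinPoles M _ _ _ := hMp
  have hD : ∀ s : ℂ, 1 < s.re → (Summable fun k => τ k ^ (-s)) ∧
      AnalyticAt ℂ (fun s => ∑' k, τ k ^ (-s)) s := by
    intro s hs
    have := summable_and_analyticAt_cpowRemainder one_pos h.ne_zero_τ (fun r => h.summable_τ)
      (Eventually.of_forall h.τ_re_pos) (y := 0) (by simpa using h.ne_zero_τ) (N := 0) (s₀ := s)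
      (by simpa using hs)
    simpa only [cpowRemainder_zero, add_zero] using this
  -- The pairing factor `2 cos(πs/2)` divides `sin(πs)`, leaving `sin(πs/2)`, which vanishes at even
  -- integers only. At `1` one has `μ = 1/π` and `μ' = 0`, so the double pole persists with both
  -- coefficients divided by `π`.
  set μ : ℂ → ℂ := fun s => Complex.sin (Real.pi * s / 2) / Real.pi with hμ
  have hμd : ∀ s, HasDerivAt μ (Complex.cos (Real.pi * s / 2) / 2) s := by
    intro s
    have h1 : HasDerivAt (fun s : ℂ => (Real.pi : ℂ) * s / 2) (Real.pi / 2) s := by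
      simpa using ((hasDerivAt_id s).const_mul (Real.pi : ℂ)).div_const 2
    have := h1.csin.div_const (Real.pi : ℂ)
    convert! this using 1
    field_simp
  have hμ1 : μ 1 = 1 / Real.pi := by
    simp only [hμ, mul_one, Complex.sin_pi_div_two]
  have hμ1' : deriv μ 1 = 0 := by
    rw [(hμd 1).deriv, mul_one, Complex.cos_pi_div_two, zero_div]
  have hμ0 : μ 0 = 0 := by simp [hμ]
  obtain ⟨Z, hZm, hZD, hZan, hZ1, hZj, hZv⟩ := hMp.exists_continuation
    (D := fun s => ∑' k, τ k ^ (-s)) (μ := μ)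
    (fun s => (hμd s).differentiableAt)
    (fun s hs => (hD s hs).2.differentiableAt.differentiableWithinAt) (by
      intro s hs1 hs2
      have hT := (hD s hs1).1.hasSum
      have h1 : HasSum (fun i => (-centeredZeros τ i) ^ (-s)) ((∑' k, τ k ^ (-s)) *
          (2 * Complex.cos (Real.pi * s / 2))) := by
        have hs0 := sin_pi_mul_ne_zero_of_re hs1 hs2
        have hc0 : (Real.pi : ℂ) / Complex.sin (Real.pi * s) ≠ 0 := div_ne_zero hpi hs0
        have h2 : Summable fun i => (-centeredZeros τ i) ^ (-s) :=
          (summable_mul_right_iff hc0).1 (hmel s hs1 hs2).summable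
        exact hasSum_neg_zeros_cpow h.τ_re_pos h2 hT
      have h2 := (h1.mul_right _).unique (hmel s hs1 hs2)
      have h3 := sin_pi_mul_ne_zero_of_re hs1 hs2
      have h4 : Complex.sin (Real.pi * s) =
          2 * Complex.sin (Real.pi * s / 2) * Complex.cos (Real.pi * s / 2) := by
        rw [← Complex.sin_two_mul]
        congr 1
        ring
      rw [hM s hs1 hs2, ← h2]
      rw [h4] at h3 ⊢
      simp only [hμ]
      generalize Complex.sin (Real.pi * s / 2) = σ at h3 ⊢
      generalize Complex.cos (Real.pi * s / 2) = γ at h3 ⊢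
      have h5 : σ ≠ 0 := by
        rintro rfl
        simp at h3
      have h6 : γ ≠ 0 := by
        rintro rfl
        simp at h3
      field_simp)
  refine ⟨Z, hZm, fun s hs => ?_, fun s hs => hZan s fun j hj => ?_, ?_, hZj, ?_⟩
  · rw [hZD s hs]
    exact (hD s hs).1.hasSum
  · rcases Nat.even_or_odd' j with ⟨m, rfl | rfl⟩
    · exact absurd (by rw [hj]; push_cast; ring) (hs m)
    · refine ⟨by omega, ?_⟩
      rw [hj, hμ]
      simp only
      rw [show (Real.pi : ℂ) * (1 - ((2 * m + 1 : ℕ) : ℂ)) / 2 = -(m * Real.pi) by push_cast; ring,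
        Complex.sin_neg, Complex.sin_nat_mul_pi, neg_zero, zero_div]
  · rw [hμ1, hμ1', zero_mul, add_zero, one_div_mul_eq_div, one_div_mul_eq_div] at hZ1
    exact hZ1
  -- The point `0` is `1 - j` with `j = 1`; there `μ'(0) = 1/2` and the coefficient is `c 1 + q`.
  · have := hZv 1 le_rfl
    rw [Nat.cast_one, sub_self, (hμd 0).deriv] at this
    rw [this hμ0]
    simp
    ring

end IsPrimaryFunction

end Nontrivial

/-! ### Poles and finite parts of the shifted series -/

section Assembly

theorem MeromorphicAt.comp_mul_add {F : ℂ → ℂ} {a b p : ℂ} (hF : MeromorphicAt F (a * p + b)) :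
    MeromorphicAt (fun s => F (a * s + b)) p :=
  hF.comp_analyticAt (g := fun s => a * s + b) (by fun_prop)

theorem meromorphic_of_shifted {Z H : ℂ → ℂ} {T : ℕ → ℂ → ℂ} {y : ℂ} {r₀ : ℝ}
    (hZ : Meromorphic Z) (hT : ∀ N : ℕ, ∀ s : ℂ, r₀ < s.re + N → AnalyticAt ℂ (T N) s)
    (hH : ∀ N : ℕ, ∀ s : ℂ, r₀ < s.re + N →
      H s = (∑ l ∈ Finset.range N, Ring.choose (-s) l * Z (s + l) * y ^ l) + T N s) :
    Meromorphic H := by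
  intro p
  obtain ⟨N, hN⟩ := exists_nat_gt (r₀ - p.re)
  have hm : {s : ℂ | r₀ < s.re + N} ∈ 𝓝 p :=
    (isOpen_lt continuous_const (Complex.continuous_re.add continuous_const)).mem_nhds
      (show r₀ < p.re + N by linarith)
  have h1 : MeromorphicAt (fun s =>
      (∑ l ∈ Finset.range N, Ring.choose (-s) l * Z (s + l) * y ^ l) + T N s) p := by
    refine MeromorphicAt.add (MeromorphicAt.fun_sum fun l _ => ?_) (hT N p (by linarith)).meromorphicAt
    have h2 : MeromorphicAt (fun s => Z (s + l)) p := by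
      have := (hZ (1 * p + l)).comp_mul_add (a := 1) (b := l)
      simpa only [one_mul] using this
    have h3 : MeromorphicAt (fun s : ℂ => Ring.choose (-s) l) p :=
      (((differentiable_ringChoose l).comp differentiable_neg).analyticAt p).meromorphicAt
    exact (h3.mul h2).mul (MeromorphicAt.const _ _)
  refine h1.congr (nhdsWithin_le_nhds ?_)
  filter_upwards [hm] with s hs using (hH N s hs).symm

/-- At `s = 1 - n` only the last factor `(-s - (n - 1)) / n` vanishes, and the product of the others
is `C(n-1, n-1) = 1`. -/
theorem hasDerivAt_ringChoose_neg {n : ℕ} (hn : 1 ≤ n) :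
    HasDerivAt (fun s : ℂ => Ring.choose (-s) n) (-(1 / (n : ℂ))) (1 - n) := by
  obtain ⟨m, rfl⟩ : ∃ m, n = m + 1 := ⟨n - 1, by omega⟩
  have hm : ((m : ℂ) + 1) ≠ 0 := by exact_mod_cast m.succ_ne_zero
  have h1 : (fun s : ℂ => Ring.choose (-s) (m + 1)) =
      fun s : ℂ => Ring.choose (-s) m * ((-s - (m : ℂ)) / ((m : ℂ) + 1)) := by
    funext s
    rw [ringChoose_eq_prod_div, ringChoose_eq_prod_div, Finset.prod_range_succ,
      Nat.factorial_succ]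
    push_cast
    have : (m.factorial : ℂ) ≠ 0 := by exact_mod_cast m.factorial_ne_zero
    field_simp
  have h2 : HasDerivAt (fun s : ℂ => Ring.choose (-s) m) _ (1 - ((m + 1 : ℕ) : ℂ)) :=
    ((differentiable_ringChoose m).comp differentiable_neg _).hasDerivAt
  have h3 : HasDerivAt (fun s : ℂ => (-s - m) / ((m : ℂ) + 1)) (-1 / ((m : ℂ) + 1))
      (1 - ((m + 1 : ℕ) : ℂ)) :=
    (((hasDerivAt_id _).neg.sub_const _).div_const _)
  have h4 := h2.mul h3
  rw [h1]
  convert! h4 using 1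
  have h5 : -(1 - ((m + 1 : ℕ) : ℂ)) = m := by push_cast; ring
  rw [h5, sub_self, Ring.choose_natCast, Nat.choose_self]
  push_cast
  ring

theorem ringChoose_neg_one_sub {n : ℕ} (hn : 1 ≤ n) (l : ℕ) :
    Ring.choose (-(1 - (n : ℂ))) l = ((n - 1).choose l : ℂ) := by
  rw [show -(1 - (n : ℂ)) = ((n - 1 : ℕ) : ℂ) by push_cast [hn]; ring, Ring.choose_natCast]

/-- Only the indices `l = n - 2m` survive, and `C(n-1, n-2m) = C(n-1, 2m-1)` by symmetry. -/
theorem sum_range_choose_eq {ρ R : ℕ → ℂ} {n : ℕ} (hodd : ∀ m : ℕ, ρ (2 * m + 1) = 0)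
    (heven : ∀ m : ℕ, 1 ≤ m → ρ (2 * m) = 2 * R m) (y : ℂ) :
    ∑ l ∈ Finset.range n, ((n - 1).choose l : ℂ) * y ^ l * ρ (n - l) =
      2 * ∑ m ∈ Finset.Icc 1 (n / 2), ((n - 1).choose (2 * m - 1) : ℂ) * R m * y ^ (n - 2 * m) := by
  rw [Finset.mul_sum]
  refine (Finset.sum_of_injOn (fun m => n - 2 * m) ?_ ?_ ?_ ?_).symm
  · intro a ha b hb hab
    simp only [Finset.coe_Icc, Set.mem_Icc] at ha hb hab
    omega
  · intro m hm
    simp only [Finset.coe_Icc, Set.mem_Icc, Finset.coe_range, Set.mem_Iio] at hm ⊢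
    omega
  · intro l hl hl'
    simp only [Finset.coe_Icc, Set.mem_image, Set.mem_Icc, Finset.mem_range, not_exists,
      not_and] at hl hl'
    rcases Nat.even_or_odd' (n - l) with ⟨m, h | h⟩
    · exact absurd (by omega) (hl' m (by omega))
    · rw [h, hodd, mul_zero]
  · intro m hm
    simp only [Finset.mem_Icc] at hm
    have h1 : n - (n - 2 * m) = 2 * m := by omega
    have h2 : (n - 1).choose (n - 2 * m) = (n - 1).choose (2 * m - 1) := by
      rw [← Nat.choose_symm (by omega)]
      congr 1
      omega
    simp only [h1, h2]
    rw [heven m hm.1]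
    ring

theorem eventually_lt_re_add {r₀ : ℝ} (N : ℕ) {p : ℂ} (h : r₀ < p.re + N) :
    ∀ᶠ s in 𝓝 p, r₀ < s.re + N :=
  (isOpen_lt continuous_const (Complex.continuous_re.add continuous_const)).mem_nhds h

section Shifted

variable {Z H : ℂ → ℂ} {T : ℕ → ℂ → ℂ} {y : ℂ}

theorem analyticAt_of_shifted
    (hT : ∀ N : ℕ, ∀ s : ℂ, 1 < s.re + N → AnalyticAt ℂ (T N) s)
    (hH : ∀ N : ℕ, ∀ s : ℂ, 1 < s.re + N →
      H s = (∑ l ∈ Finset.range N, Ring.choose (-s) l * Z (s + l) * y ^ l) + T N s)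
    (hZ : ∀ s : ℂ, (∀ m : ℕ, s ≠ 1 - 2 * m) → AnalyticAt ℂ Z s) {p : ℂ}
    (hp : ∀ n : ℕ, p ≠ 1 - n) : AnalyticAt ℂ H p := by
  obtain ⟨N, hN⟩ := exists_nat_gt (1 - p.re)
  have h1 : AnalyticAt ℂ (fun s =>
      (∑ l ∈ Finset.range N, Ring.choose (-s) l * Z (s + l) * y ^ l) + T N s) p := by
    refine AnalyticAt.add (Finset.analyticAt_fun_sum _ fun l _ => ?_) (hT N p (by linarith))
    have h2 : AnalyticAt ℂ (fun s => Z (s + l)) p := by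
      refine (hZ (p + l) fun m hm => hp (2 * m + l) ?_).fun_comp (f := fun s : ℂ => s + l)
        (by fun_prop)
      push_cast
      linear_combination hm
    have h3 : AnalyticAt ℂ (fun s : ℂ => Ring.choose (-s) l) p :=
      ((differentiable_ringChoose l).comp differentiable_neg).analyticAt p
    exact (h3.mul h2).mul analyticAt_const
  refine h1.congr ?_
  filter_upwards [eventually_lt_re_add N (show 1 < p.re + N by linarith)] with s hs
    using (hH N s hs).symm

theorem polarGerm_of_shifted_of_lt {A B p : ℂ} {r₀ : ℝ}
    (hT : ∀ N : ℕ, ∀ s : ℂ, r₀ < s.re + N → AnalyticAt ℂ (T N) s)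
    (hH : ∀ N : ℕ, ∀ s : ℂ, r₀ < s.re + N →
      H s = (∑ l ∈ Finset.range N, Ring.choose (-s) l * Z (s + l) * y ^ l) + T N s)
    (hZ : PolarGerm Z p A B) (hp : r₀ < p.re + (1 : ℕ)) : PolarGerm H p A B := by
  have h1 := hZ.add (PolarGerm.of_analyticAt (hT 1 p hp))
  simp only [add_zero] at h1
  refine h1.congr (nhdsWithin_le_nhds ?_)
  filter_upwards [eventually_lt_re_add 1 hp] with s hs
  rw [hH 1 s hs]
  simp

/-- Near `1 - n` the terms `l < n` meet the simple poles of `Z` at `1 - (n - l)`. The term `l = n`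
meets the double pole at `1`, but its coefficient vanishes there with derivative `-y^n / n`; what is
left is a simple pole in which `B` plays no role. -/
theorem polarGerm_of_shifted {A B : ℂ} {ρ : ℕ → ℂ}
    (hT : ∀ N : ℕ, ∀ s : ℂ, 1 < s.re + N → AnalyticAt ℂ (T N) s)
    (hH : ∀ N : ℕ, ∀ s : ℂ, 1 < s.re + N →
      H s = (∑ l ∈ Finset.range N, Ring.choose (-s) l * Z (s + l) * y ^ l) + T N s)
    (hZ1 : PolarGerm Z 1 A B) (hZ : ∀ j : ℕ, 1 ≤ j → PolarGerm Z (1 - j) 0 (ρ j))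
    {n : ℕ} (hn : 1 ≤ n) :
    PolarGerm H (1 - n) 0
      ((∑ l ∈ Finset.range n, ((n - 1).choose l : ℂ) * y ^ l * ρ (n - l)) - y ^ n / n * A) := by
  have hch : ∀ l : ℕ, AnalyticAt ℂ (fun s : ℂ => Ring.choose (-s) l * y ^ l) (1 - n) := fun l =>
    (((differentiable_ringChoose l).comp differentiable_neg).mul_const _).analyticAt _
  have h1 : PolarGerm (fun s => ∑ l ∈ Finset.range n, Ring.choose (-s) l * y ^ l * Z (s + l))
      (1 - n) (∑ l ∈ Finset.range n, 0)
      (∑ l ∈ Finset.range n, ((n - 1).choose l : ℂ) * y ^ l * ρ (n - l)) := by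
    refine PolarGerm.sum _ fun l hl => ?_
    have hl := Finset.mem_range.1 hl
    have h2 := ((hZ (n - l) (by omega)).comp_affine (a := 1) (b := l) (p' := 1 - n) one_ne_zero
      (by push_cast [hl.le]; ring)).mul (hch l)
    simpa only [one_mul, zero_div, mul_zero, div_one, add_zero, ringChoose_neg_one_sub hn]
      using h2
  have h3 := (hZ1.comp_affine (a := 1) (b := n) (p' := 1 - n) one_ne_zero (by ring)).mul (hch n)
  have h4 : deriv (fun s : ℂ => Ring.choose (-s) n * y ^ n) (1 - n) = -(1 / (n : ℂ)) * y ^ n :=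
    ((hasDerivAt_ringChoose_neg hn).mul_const _).deriv
  simp only [one_mul, one_pow, div_one] at h3
  rw [h4, ringChoose_neg_one_sub hn, Nat.choose_eq_zero_of_lt (by omega)] at h3
  have hre : (1 : ℝ) < (1 - (n : ℂ)).re + (n + 1 : ℕ) := by
    simp only [Complex.sub_re, Complex.one_re, Complex.natCast_re]
    push_cast
    linarith
  have h5 := (h1.add h3).add (PolarGerm.of_analyticAt (hT (n + 1) (1 - n) hre))
  have h6 := h5.congr (G := H) (nhdsWithin_le_nhds (by
    filter_upwards [eventually_lt_re_add (n + 1) hre] with s hs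
    rw [hH _ s hs, Finset.sum_range_succ]
    congr 2
    · exact Finset.sum_congr rfl fun l _ => by ring
    · ring))
  convert! h6 using 1
  · simp
  · push_cast
    ring

/-- The difference is `T (n + 1)` near `1 - n`. It is analytic there, and for `n ≥ 1` it vanishes at
`1 - n = -(n - 1)`. -/
theorem isBigO_shifted_sub_sum
    (hT : ∀ N : ℕ, ∀ s : ℂ, 1 < s.re + N → AnalyticAt ℂ (T N) s)
    (hH : ∀ N : ℕ, ∀ s : ℂ, 1 < s.re + N →
      H s = (∑ l ∈ Finset.range N, Ring.choose (-s) l * Z (s + l) * y ^ l) + T N s)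
    (hT0 : ∀ N m : ℕ, m < N → T N (-(m : ℂ)) = 0) (n : ℕ) :
    (fun ε : ℂ => H (1 - n + 2 * ε) - ∑ l ∈ Finset.range (n + 1),
        Ring.choose (-(1 - n + 2 * ε)) l * Z (1 - n + 2 * ε + l) * y ^ l)
      =O[𝓝[≠] (0 : ℂ)] fun ε : ℂ => if n = 0 then 1 else ε := by
  have hre : (1 : ℝ) < (1 - (n : ℂ) + 2 * 0).re + (n + 1 : ℕ) := by
    simp
    linarith
  have hc : ContinuousAt (fun ε : ℂ => 1 - (n : ℂ) + 2 * ε) 0 := by fun_prop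
  have hev := hc.eventually (eventually_lt_re_add (n + 1) hre)
  have han : AnalyticAt ℂ (fun ε : ℂ => T (n + 1) (1 - n + 2 * ε)) 0 :=
    (hT (n + 1) _ hre).fun_comp (f := fun ε : ℂ => 1 - (n : ℂ) + 2 * ε) (by fun_prop)
  have h1 : (fun ε : ℂ => H (1 - n + 2 * ε) - ∑ l ∈ Finset.range (n + 1),
      Ring.choose (-(1 - n + 2 * ε)) l * Z (1 - n + 2 * ε + l) * y ^ l) =ᶠ[𝓝[≠] 0]
      fun ε => T (n + 1) (1 - n + 2 * ε) := by
    filter_upwards [nhdsWithin_le_nhds hev] with ε hε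
    rw [hH _ _ hε]
    ring
  refine IsBigO.congr' ?_ h1.symm EventuallyEq.rfl
  rcases Nat.eq_zero_or_pos n with rfl | hn
  · simp only [if_true]
    exact (han.continuousAt.tendsto.mono_left nhdsWithin_le_nhds).isBigO_one ℂ
  · simp only [hn.ne', if_false]
    have h2 := han.differentiableAt.isBigO_sub
    have h3 : T (n + 1) (1 - n + 2 * 0) = 0 := by
      have : 1 - (n : ℂ) + 2 * 0 = -((n - 1 : ℕ) : ℂ) := by
        push_cast [hn]
        ring
      rw [this]
      exact hT0 (n + 1) (n - 1) (by omega)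
    simp only [h3, sub_zero] at h2
    exact h2.mono nhdsWithin_le_nhds

/-- With two terms, `H(2ε) = Z(2ε) - 2ε y Z(1 + 2ε) + T_2(2ε)` and `T_2(0) = 0`. The pole of `Z` at
`1` turns the middle term into `-(A/2) y / ε - B y + o(1)`. -/
theorem tendsto_finite_part_of_shifted {A B : ℂ}
    (hT : ∀ N : ℕ, ∀ s : ℂ, 1 < s.re + N → AnalyticAt ℂ (T N) s)
    (hH : ∀ N : ℕ, ∀ s : ℂ, 1 < s.re + N →
      H s = (∑ l ∈ Finset.range N, Ring.choose (-s) l * Z (s + l) * y ^ l) + T N s)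
    (hT0 : ∀ N m : ℕ, m < N → T N (-(m : ℂ)) = 0)
    (hZ1 : PolarGerm Z 1 A B) (hZ0 : AnalyticAt ℂ Z 0) :
    Tendsto (fun ε : ℂ => H (2 * ε) - -(A / 2) * y / ε) (𝓝[≠] 0) (𝓝 (Z 0 - B * y)) := by
  obtain ⟨R, hR, hZR⟩ := hZ1.comp_affine (a := 2) (b := 1) (p' := 0) two_ne_zero (by ring)
  have hre : (1 : ℝ) < (2 * (0 : ℂ)).re + (2 : ℕ) := by simp
  have hc : ContinuousAt (fun ε : ℂ => 2 * ε) 0 := by fun_prop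
  have hev := hc.eventually (eventually_lt_re_add 2 hre)
  have hT2 : T 2 (2 * 0) = 0 := by simpa using hT0 2 0 (by norm_num)
  have h1 : ContinuousAt (fun ε => Z (2 * ε) - B * y - 2 * ε * y * R ε + T 2 (2 * ε)) 0 := by
    have hz : ContinuousAt (fun ε : ℂ => Z (2 * ε)) 0 :=
      ContinuousAt.comp' (f := fun ε : ℂ => 2 * ε) (by simpa using hZ0.continuousAt) hc
    have ht : ContinuousAt (fun ε : ℂ => T 2 (2 * ε)) 0 :=
      ContinuousAt.comp' (f := fun ε : ℂ => 2 * ε) (hT 2 _ hre).continuousAt hc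
    have hr : ContinuousAt (fun ε => 2 * ε * y * R ε) 0 :=
      ContinuousAt.mul (by fun_prop) hR.continuousAt
    exact ((hz.sub continuousAt_const).sub hr).add ht
  have h2 := h1.tendsto.mono_left (nhdsWithin_le_nhds (s := {0}ᶜ))
  simp only [hT2] at h2
  simp only [mul_zero, zero_mul, sub_zero, add_zero] at h2
  refine h2.congr' ?_
  filter_upwards [hZR, nhdsWithin_le_nhds hev, self_mem_nhdsWithin] with ε h3 h4 h5
  have h5 : ε ≠ 0 := h5
  rw [hH 2 _ h4, Finset.sum_range_succ, Finset.sum_range_one, Nat.cast_one, h3]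
  simp only [Ring.choose_zero_right, Ring.choose_one_right, Nat.cast_zero, add_zero, pow_zero,
    pow_one, sub_zero]
  field_simp
  ring

end Shifted

end Assembly

/-! ### The second zeta function and the theorem -/

section Main

variable {L G Ξ : ℂ → ℂ} {q : ℕ} {τ : ℕ → ℂ}

theorem sq_cpow_of_re_pos {w : ℂ} (hw : 0 < w.re) (s : ℂ) : (w ^ 2) ^ s = w ^ (2 * s) := by
  have h := abs_lt.1 (Complex.abs_arg_lt_pi_div_two_iff.2 (Or.inl hw))
  have := Complex.cpow_nat_mul' (x := w) (n := 2) (by push_cast; linarith [h.1])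
    (by push_cast; linarith [h.2]) s
  simpa using this.symm

theorem sq_mem_slitPlane_of_re_pos {w : ℂ} (hw : 0 < w.re) : w ^ 2 ∈ Complex.slitPlane := by
  rw [Complex.mem_slitPlane_iff, sq, Complex.mul_re, Complex.mul_im]
  by_cases h : w.im = 0
  · left
    rw [h]
    nlinarith
  · right
    have := mul_ne_zero hw.ne' h
    intro h0
    apply this
    linarith

namespace IsPrimaryFunction

theorem summable_τ_sq (h : IsPrimaryFunction L G Ξ q τ) {r : ℝ} (hr : 1 / 2 < r) :
    Summable fun k => ‖τ k ^ 2‖ ^ (-r) := by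
  refine (h.summable_τ (r := 2 * r) (by linarith)).congr fun k => ?_
  rw [norm_pow, ← Real.rpow_natCast, ← Real.rpow_mul (norm_nonneg _)]
  congr 1
  push_cast
  ring

/-- If `Re (τ²) ≤ 0` then `|Re τ| ≤ |Im τ| < 1/2`, so `‖τ‖ < 1`; this happens for finitely many `k`
only. -/
theorem eventually_re_τ_sq_pos (h : IsPrimaryFunction L G Ξ q τ) :
    ∀ᶠ k in cofinite, 0 < (τ k ^ 2).re := by
  refine (finite_norm_le_of_summable h.ne_zero_τ (r := 2) two_pos
    (h.summable_τ one_lt_two) 1).subset fun k hk => ?_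
  simp only [Set.mem_compl_iff, Set.mem_ofPred_eq, sq, Complex.mul_re, not_lt] at hk ⊢
  have h1 := Complex.norm_le_abs_re_add_abs_im (τ k)
  have h2 := h.abs_im_lt k
  have h3 : |(τ k).re| ≤ |(τ k).im| := by
    rw [← sq_le_sq]
    nlinarith
  linarith

/-- The zeta function over the `τ k ^ 2 + v`. -/
theorem exists_second_zeta (h : IsPrimaryFunction L G Ξ q τ) {Z : ℂ → ℂ} (hZm : Meromorphic Z)
    (hZs : ∀ s : ℂ, 1 < s.re → HasSum (fun k => τ k ^ (-s)) (Z s)) {A B : ℂ}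
    (hZ1 : PolarGerm Z 1 (A / Real.pi) (B / Real.pi)) (v : ℂ) :
    ∃ F : ℂ → ℂ, (v = 0 → F = fun σ => Z (2 * σ)) ∧
      ((∀ k, τ k ^ 2 + v ∈ Complex.slitPlane) →
        IsMeromorphicContinuation (secondTerm τ v) (1 / 2) F ∧
        HasPolarPart F (1 / 2) (A / (4 * Real.pi)) (B / (2 * Real.pi))) := by
  have hpi : (Real.pi : ℂ) ≠ 0 := by exact_mod_cast Real.pi_ne_zero
  have hm : Meromorphic fun σ => Z (2 * σ) := fun p => by
    have := (hZm (2 * p + 0)).comp_mul_add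
    simpa only [add_zero] using this
  have hs : ∀ σ : ℂ, (1 / 2 : ℝ) < σ.re → HasSum (fun k => (τ k ^ 2) ^ (-σ)) (Z (2 * σ)) := by
    intro σ hσ
    have := hZs (2 * σ) (by simp; linarith)
    convert! this using 2 with k
    rw [sq_cpow_of_re_pos (h.τ_re_pos k), mul_neg]
  have hp : PolarGerm (fun σ => Z (2 * σ)) (1 / 2) (A / (4 * Real.pi)) (B / (2 * Real.pi)) := by
    have := hZ1.comp_affine (a := 2) (b := 0) (p' := 1 / 2) two_ne_zero (by norm_num)
    simp only [add_zero] at this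
    convert! this using 1 <;> field_simp
    norm_num
  -- For `v = 0` the continuation is taken to be `Z (2σ)` itself, so that the two functions agree
  -- everywhere and not merely in the half-plane of convergence.
  rcases eq_or_ne v 0 with rfl | hv
  · refine ⟨_, fun _ => rfl, fun _ => ⟨⟨hm, fun σ hσ => ?_⟩, hp.hasPolarPart⟩⟩
    simpa only [secondTerm, add_zero] using hs σ hσ
  by_cases hadm : ∀ k, τ k ^ 2 + v ∈ Complex.slitPlane
  · have hw : ∀ k, τ k ^ 2 ≠ 0 := fun k => pow_ne_zero 2 (h.ne_zero_τ k)
    have hwv : ∀ k, τ k ^ 2 + v ≠ 0 := fun k => Complex.slitPlane_ne_zero (hadm k)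
    obtain ⟨F, hF, hFN⟩ := exists_shifted_zeta one_half_pos hw (fun r => h.summable_τ_sq)
      h.eventually_re_τ_sq_pos hs hwv
    set T : ℕ → ℂ → ℂ := fun N s => ∑' k, cpowRemainder (τ k ^ 2) v N s
    have hT : ∀ N : ℕ, ∀ s : ℂ, (1 / 2 : ℝ) < s.re + N → AnalyticAt ℂ (T N) s := fun N s hsN =>
      (summable_and_analyticAt_cpowRemainder one_half_pos hw (fun r => h.summable_τ_sq)
        h.eventually_re_τ_sq_pos hwv hsN).2
    have hFN : ∀ N : ℕ, ∀ s : ℂ, 1 / 2 < s.re + N → F s = (∑ l ∈ Finset.range N,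
        Ring.choose (-s) l * Z (2 * (s + l)) * v ^ l) + T N s := hFN
    clear_value T
    have h1 : Meromorphic F := meromorphic_of_shifted (Z := fun σ => Z (2 * σ)) hm hT hFN
    have h2 : PolarGerm F (1 / 2) (A / (4 * Real.pi)) (B / (2 * Real.pi)) :=
      polarGerm_of_shifted_of_lt (Z := fun σ => Z (2 * σ)) hT hFN hp (by norm_num)
    exact ⟨F, fun h0 => absurd h0 hv, fun _ => ⟨⟨h1, hF⟩, h2.hasPolarPart⟩⟩
  · exact ⟨fun _ => 0, fun h0 => absurd h0 hv, fun h0 => absurd h0 hadm⟩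

end IsPrimaryFunction

theorem sin_pi_mul_one_sub_odd (m : ℕ) :
    Complex.sin (Real.pi * (1 - ((2 * m + 1 : ℕ) : ℂ)) / 2) = 0 := by
  rw [show (Real.pi : ℂ) * (1 - ((2 * m + 1 : ℕ) : ℂ)) / 2 = -(m * Real.pi) by push_cast; ring,
    Complex.sin_neg, Complex.sin_nat_mul_pi, neg_zero]

theorem sin_pi_mul_one_sub_even (m : ℕ) :
    Complex.sin (Real.pi * (1 - ((2 * m : ℕ) : ℂ)) / 2) = (-1) ^ m := by
  rw [show (Real.pi : ℂ) * (1 - ((2 * m : ℕ) : ℂ)) / 2 = Real.pi / 2 - ((m * Real.pi : ℝ) : ℂ) by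
      push_cast; ring, Complex.sin_pi_div_two_sub, ← Complex.ofReal_cos, Real.cos_nat_mul_pi]
  push_cast
  rfl

theorem half_pow_eq_zpow {m : ℕ} (hm : 1 ≤ m) :
    (1 / 2 : ℂ) ^ (2 * m - 1) = (2 : ℂ) ^ (1 - 2 * (m : ℤ)) := by
  rw [one_div, inv_pow, ← zpow_natCast, ← zpow_neg]
  congr 1
  omega

end Main

theorem mainTheorem8
    (L G Ξ : ℂ → ℂ) (q : ℕ) (τ : ℕ → ℂ) (hL : IsPrimaryFunction L G Ξ q τ)
    (a₁ a₀ b₁ b₀ : ℂ) (a : ℕ → ℂ) (hG : HasStirlingExpansion G a₁ a₀ b₁ b₀ a) :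
    ∃ (S : ℂ → ℂ) (Z H : ℂ → ℂ → ℂ),
      -- `S s` is the zeta function `𝐙(s, 1/2)` over the zeros of `G`
      IsMeromorphicContinuation (shadowTerm G (1 / 2)) 1 S ∧
      (∀ s : ℂ, s ≠ 1 → AnalyticAt ℂ S s) ∧
      -- `Z σ v` is the second zeta function `𝒵(σ, v)`
      (∀ v : ℂ, (∀ k, τ k ^ 2 + v ∈ Complex.slitPlane) →
        IsMeromorphicContinuation (secondTerm τ v) (1 / 2) (fun σ => Z σ v) ∧
        HasPolarPart (fun σ => Z σ v) (1 / 2) (a₁ / (4 * Real.pi)) (b₁ / (2 * Real.pi))) ∧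
      -- `𝒵(σ) = 𝒵(σ, 0)` and the residues `ℛ_m`
      (∀ k, τ k ^ 2 + 0 ∈ Complex.slitPlane) ∧
      (∀ σ : ℂ, (∀ m : ℕ, σ ≠ 1 / 2 - m) → AnalyticAt ℂ (fun σ => Z σ 0) σ) ∧
      (∀ m : ℕ, 1 ≤ m →
        HasPolarPart (fun σ => Z σ 0) (1 / 2 - m) 0 (secondResidue S q m)) ∧
      -- `H σ y` is the half zeta function `𝔷(σ, y)`
      ∀ y : ℂ, (∀ k, τ k + y ∈ Complex.slitPlane) →
        IsMeromorphicContinuation (halfTerm τ y) (1 / 2) (fun σ => H σ y) ∧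
        (∀ σ : ℂ, (∀ n : ℕ, σ ≠ (1 - n) / 2) → AnalyticAt ℂ (fun σ => H σ y) σ) ∧
        -- the expansion in powers of `y`
        ((∀ k, ‖y‖ < ‖τ k‖) → ∀ σ : ℂ, (∀ n : ℕ, σ ≠ (1 - n) / 2) →
          HasSum (fun l : ℕ => Ring.choose (-2 * σ) l * Z (σ + l / 2) 0 * y ^ l) (H σ y)) ∧
        -- the behavior near `σ = (1 - n) / 2`
        (∀ n : ℕ,
          (fun ε : ℂ => H ((1 - n) / 2 + ε) y -
            ∑ l ∈ Finset.range (n + 1),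
              Ring.choose ((n : ℂ) - 1 - 2 * ε) l * Z ((1 - n + l) / 2 + ε) 0 * y ^ l)
          =O[𝓝[≠] (0 : ℂ)] fun ε : ℂ => if n = 0 then 1 else ε) ∧
        -- the polar part at `σ = 1/2`
        HasPolarPart (fun σ => H σ y) (1 / 2) (a₁ / (4 * Real.pi)) (b₁ / (2 * Real.pi)) ∧
        -- the simple poles at `σ = (1 - n) / 2`, `n ≥ 1`
        (∀ n : ℕ, 1 ≤ n →
          HasPolarPart (fun σ => H σ y) ((1 - n) / 2) 0
            (halfResidue a₁ (secondResidue S q) n y)) ∧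
        -- the residue and the finite part at `σ = 0`
        halfResidue a₁ (secondResidue S q) 1 y = -(a₁ / (2 * Real.pi)) * y ∧
        Tendsto (fun ε : ℂ => H ε y - -(a₁ / (2 * Real.pi)) * y / ε) (𝓝[≠] (0 : ℂ))
          (𝓝 (a₁ / 4 + (a₀ + q) / 2 - b₁ / Real.pi * y)) := by
  have hpi : (Real.pi : ℂ) ≠ 0 := by exact_mod_cast Real.pi_ne_zero
  obtain ⟨c, hc1, hexp⟩ := hasLogExpansion_neg_logDeriv hG
  obtain ⟨S, hS, hSan, hSv⟩ :=
    exists_shadow_zeta hL.order_G.1 hL.order_G.hasOrderOneGrowth hL.trivial_zeros hexp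
  obtain ⟨Z₁, hZm, hZs, hZan, hZ1, hZj, hZ0⟩ := hL.exists_zeta hexp
  set ρ : ℕ → ℂ := fun j =>
    Complex.sin (Real.pi * (1 - j) / 2) / Real.pi * (c j + q * (1 / 2) ^ (j - 1)) with hρ
  have hZj : ∀ j : ℕ, 1 ≤ j → PolarGerm Z₁ (1 - j) 0 (ρ j) := hZj
  have hodd : ∀ m : ℕ, ρ (2 * m + 1) = 0 := fun m => by
    simp only [hρ]
    rw [sin_pi_mul_one_sub_odd, zero_div, zero_mul]
  -- Here the two zeta functions meet: `c (2m)` is the value at `1 - 2m` of the zeta function over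
  -- the zeros of `G`, and the sine equals `(-1)^m`.
  have heven : ∀ m : ℕ, 1 ≤ m → ρ (2 * m) = 2 * secondResidue S q m := fun m hm => by
    simp only [hρ]
    rw [sin_pi_mul_one_sub_even, secondResidue, half_pow_eq_zpow hm,
      show (1 : ℂ) - 2 * m = 1 - ((2 * m : ℕ) : ℂ) by push_cast; ring, hSv (2 * m) (by omega),
      pow_mul (-1 : ℂ) 2 m, neg_one_sq, one_pow, one_mul]
    field_simp
  choose Z hZz hZadm using hL.exists_second_zeta hZm hZs hZ1
  have hZz : Z 0 = fun σ => Z₁ (2 * σ) := hZz 0 rfl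
  have hhalf : ∀ y : ℂ, ∃ H : ℂ → ℂ, (∀ k, τ k + y ∈ Complex.slitPlane) →
      (∀ s : ℂ, 1 < s.re → HasSum (fun k => (τ k + y) ^ (-s)) (H s)) ∧
        ∀ N : ℕ, ∀ s : ℂ, 1 < s.re + N →
          H s = (∑ l ∈ Finset.range N, Ring.choose (-s) l * Z₁ (s + l) * y ^ l) +
            ∑' k, cpowRemainder (τ k) y N s := by
    intro y
    by_cases hy : ∀ k, τ k + y ∈ Complex.slitPlane
    · obtain ⟨H, hH⟩ := exists_shifted_zeta one_pos hL.ne_zero_τ (fun r => hL.summable_τ)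
        (Eventually.of_forall hL.τ_re_pos) hZs fun k => Complex.slitPlane_ne_zero (hy k)
      exact ⟨H, fun _ => hH⟩
    · exact ⟨fun _ => 0, fun h => absurd h hy⟩
  choose H hH using hhalf
  -- The half zeta function is the shifted series at `s = 2σ`. This rescaling divides the
  -- coefficients of double and simple poles by `4` and `2`.
  refine ⟨S, fun σ v => Z v σ, fun σ y => H y (2 * σ), hS, hSan, hZadm, fun k => ?_,
    fun σ hσ => ?_, fun m hm => ?_, fun y hy => ?_⟩
  · rw [add_zero]
    exact sq_mem_slitPlane_of_re_pos (hL.τ_re_pos k)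
  · simp only [hZz]
    refine (hZan (2 * σ) fun m hm => hσ m ?_).fun_comp (f := fun σ : ℂ => 2 * σ) (by fun_prop)
    linear_combination hm / 2
  · simp only [hZz]
    have h1 := (hZj (2 * m) (by omega)).comp_affine (a := 2) (b := 0) (p' := 1 / 2 - m)
      two_ne_zero (by push_cast; ring)
    rw [heven m hm, zero_div, mul_div_cancel_left₀ _ two_ne_zero] at h1
    simpa only [add_zero] using h1.hasPolarPart
  obtain ⟨hHs, hHN⟩ := hH y hy
  have hy0 : ∀ k, τ k + y ≠ 0 := fun k => Complex.slitPlane_ne_zero (hy k)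
  set T : ℕ → ℂ → ℂ := fun N s => ∑' k, cpowRemainder (τ k) y N s
  have hT : ∀ N : ℕ, ∀ s : ℂ, 1 < s.re + N → AnalyticAt ℂ (T N) s := fun N s hs =>
    (summable_and_analyticAt_cpowRemainder one_pos hL.ne_zero_τ (fun r => hL.summable_τ)
      (Eventually.of_forall hL.τ_re_pos) hy0 hs).2
  have hT0 : ∀ N m : ℕ, m < N → T N (-(m : ℂ)) = 0 := fun N m hm => by
    simp only [T, cpowRemainder_neg_natCast _ _ hm, tsum_zero]
  have hHN : ∀ N : ℕ, ∀ s : ℂ, 1 < s.re + N →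
      H y s = (∑ l ∈ Finset.range N, Ring.choose (-s) l * Z₁ (s + l) * y ^ l) + T N s := hHN
  have hres1 : halfResidue a₁ (secondResidue S q) 1 y = -(a₁ / (2 * Real.pi)) * y := by
    simp [halfResidue]
  refine ⟨⟨fun p => ?_, fun σ hσ => ?_⟩, fun σ hσ => ?_, fun hyτ σ hσ => ?_, fun n => ?_, ?_,
    fun n hn => ?_, hres1, ?_⟩
  · have := (meromorphic_of_shifted hZm hT hHN (2 * p + 0)).comp_mul_add
    simpa only [add_zero] using this
  · have := hHs (2 * σ) (by simp; linarith)
    simpa only [halfTerm, neg_mul] using this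
  · refine (analyticAt_of_shifted hT hHN hZan (p := 2 * σ) fun n hn => hσ n ?_).fun_comp
      (f := fun σ : ℂ => 2 * σ) (by fun_prop)
    linear_combination hn / 2
  · obtain ⟨N, hN⟩ := exists_nat_gt (1 - (2 * σ).re)
    have hN' : 1 < (2 * σ).re + N := by linarith
    have h1 := hasSum_shifted_zeta one_pos hL.τ_re_pos (fun r => hL.summable_τ) hZs hyτ hN'
    simp only [hZz]
    rw [hHN N _ hN']
    convert! h1 using 4 with l
    · ring_nf
    · ring_nf
  · have h1 := isBigO_shifted_sub_sum hT hHN hT0 n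
    refine h1.congr_left fun ε => ?_
    simp only [hZz]
    congr 1
    · congr 1
      ring
    · refine Finset.sum_congr rfl fun l _ => ?_
      congr 3 <;> ring
  · have h1 := (polarGerm_of_shifted_of_lt hT hHN hZ1 (by norm_num)).comp_affine (a := 2) (b := 0) (p' := 1 / 2)
      two_ne_zero (by norm_num)
    simp only [add_zero] at h1
    convert! h1.hasPolarPart using 1 <;> field_simp
    norm_num
  · have h1 := (polarGerm_of_shifted hT hHN hZ1 hZj hn).comp_affine (a := 2) (b := 0)
      (p' := (1 - n) / 2) two_ne_zero (by ring)
    simp only [add_zero] at h1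
    rw [sum_range_choose_eq hodd heven] at h1
    have hn0 : (n : ℂ) ≠ 0 := by exact_mod_cast (by omega : n ≠ 0)
    convert! h1.hasPolarPart using 1
    · simp
    · rw [halfResidue]
      field_simp
      ring
  · have h1 := tendsto_finite_part_of_shifted hT hHN hT0 hZ1
      (hZan 0 fun m hm => by
        have h2 : ((2 * m : ℕ) : ℂ) = (1 : ℕ) := by push_cast; linear_combination hm
        have h3 : 2 * m = 1 := by exact_mod_cast h2
        omega)
    rw [hZ0, hc1] at h1
    convert! h1 using 2
    · ring
    · ring_nf
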